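/- Let $M$ be a smooth (finite-dimensional, Hausdorff, second countable) manifold and let $E\to M$, $V\to M$ be smooth real vector bundles of finite rank. Let $C^\infty(E[1]\oplus V[2])=\Gamma(\Lambda E^*\otimes S V^*)$ be the graded algebra of functions on the graded manifold $E[1]\oplus V[2]$ (functions on $M$ have degree $0$, sections of $E^*$ degree $1$, sections of $V^*$ degree $2$; the sections are those that are locally polynomials in smooth functions on $M$ and smooth sections of $E^*$ and $V^*$). A Q2-manifold with a splitting is such a graded manifold together with a Q-structure, that is, a graded derivation $Q$ of $C^\infty(E[1]\oplus V[2])$ of degree $+1$ with $Q^2=0$. In local coordinates $x^i$ of $M$ and local frames $\xi_a$ of $E$, $b_D$ of $V$, with dual frames $\xi^a$, $b^D$, it has the form $$Q=\rho^i_a\xi^a\frac{\partial}{\partial x^i}-\tfrac12 C^a_{bc}\xi^b\xi^c\frac{\partial}{\partial\xi^a}+t^a_D b^D\frac{\partial}{\partial\xi^a}-\Gamma^D_{aC}\xi^ab^C\frac{\partial}{\partial b^D}+\tfrac16H^D_{abc}\xi^a\xi^b\xi^c\frac{\partial}{\partial b^D},$$ and the last term defines the anomaly $H\in\Gamma(\Lambda^3E^*\otimes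 V)$. **Proposition.** The Q-structures on $E[1]\oplus V[2]$ with $H=0$ are in one-to-one correspondence with the crossed modules of Lie algebroids on $(E,V)$, i.e. with complexes of Lie algebroids $V\xrightarrow{\,t\,}E\xrightarrow{\,\rho\,}TM$ over $M$ (Lie algebroid structures on $E$, with anchor $\rho$, and on $V$; $TM$ is the standard Lie algebroid; $t$ and $\rho$ are morphisms of Lie algebroids over $\mathrm{id}_M$ and $\rho\circ t=0$, so that the anchor of $V$ vanishes) together with a representation (flat $E$-connection) $\nabla$ of $E$ on $V$ such that $$t(\nabla_\psi v)=[\psi,t(v)],\qquad \nabla_{t(v)}w=[v,w]_V\qquad(\psi\in\Gamma(E),\ v,w\in\Gamma(V)).$$ A Q-structure with $H=0$ and a crossed module correspond to each other if and only if $\rho(\xi_a)=\rho^i_a\partial_i$, $[\xi_a,\xi_b]=C^c_{ab}\xi_c$, $t(b_D)=t^a_D\xi_a$ and $\nabla_{\xi_a}b_D=\Gamma^C_{aD}b_C$; equivalently, for $f\in C^\infty(M)$, $\alpha\in\Gamma(E^*)$, $\beta\in\Gamma(V^*)$, $\psi,\varphi\in\Gamma(E)$, $v\in\Gamma(V)$: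 $(Qf)(\psi)=\rho(\psi)f$; the part of $Q\alpha$ in $\Gamma(\Lambda^2E^*)$ is $(\psi,\varphi)\mapsto\rho(\psi)\alpha(\varphi)-\rho(\varphi)\alpha(\psi)-\alpha([\psi,\varphi])$ and its part in $\Gamma(V^*)$ is $v\mapsto\alpha(t(v))$; the part of $Q\beta$ in $\Gamma(E^*\otimes V^*)$ is $(\psi,v)\mapsto\rho(\psi)\beta(v)-\beta(\nabla_\psi v)$. -/

import Mathlib

open scoped Manifold ContDiff Bundle TensorProduct
open Bundle Filter Topology

noncomputable section

namespace Q2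

/-! ## Smooth vector bundles over a smooth manifold

`M` is a smooth manifold without boundary modelled on the finite-dimensional space `B`; a smooth
vector bundle over `M` is given by its fibres `E : M → Type*` with model fibre `F`. -/

section Bundles

variable (B : Type*) [NormedAddCommGroup B] [NormedSpace ℝ B]
  {M : Type*} [TopologicalSpace M] [ChartedSpace B M]

/-- Smooth sections `Γ(E)`. -/
abbrev Sec (F : Type*) [NormedAddCommGroup F] [NormedSpace ℝ F]
    (E : M → Type*) [TopologicalSpace (TotalSpace F E)] [∀ x, TopologicalSpace (E x)]
    [FiberBundle F E] : Type _ :=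
  ContMDiffSection 𝓘(ℝ, B) F ∞ E

/-- Smooth functions `C^∞(M)`. -/
abbrev Fn (M : Type*) [TopologicalSpace M] [ChartedSpace B M] : Type _ :=
  ContMDiffMap 𝓘(ℝ, B) 𝓘(ℝ, ℝ) M ℝ ∞

variable {B}

/-- The derivative `X f` of the function `f` at `x` in the direction of the tangent vector `X`. -/
def dirDeriv (f : Fn B M) (x : M) (X : TangentSpace 𝓘(ℝ, B) x) : ℝ :=
  mvfderiv 𝓘(ℝ, B) f x X

variable (B)

/-- Smooth bundle maps `E → E'` that are linear on the fibres and cover the identity of `M`. -/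
structure BundleMap
    (F : Type*) [NormedAddCommGroup F] [NormedSpace ℝ F]
    (E : M → Type*) [TopologicalSpace (TotalSpace F E)] [∀ x, TopologicalSpace (E x)]
    [∀ x, AddCommGroup (E x)] [∀ x, Module ℝ (E x)] [FiberBundle F E]
    (F' : Type*) [NormedAddCommGroup F'] [NormedSpace ℝ F']
    (E' : M → Type*) [TopologicalSpace (TotalSpace F' E')] [∀ x, TopologicalSpace (E' x)]
    [∀ x, AddCommGroup (E' x)] [∀ x, Module ℝ (E' x)] [FiberBundle F' E'] where
  toFun : ∀ x, E x →ₗ[ℝ] E' x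
  smooth : ContMDiff (𝓘(ℝ, B).prod 𝓘(ℝ, F)) (𝓘(ℝ, B).prod 𝓘(ℝ, F')) ∞
    (fun p : TotalSpace F E => (⟨p.1, toFun p.1 p.2⟩ : TotalSpace F' E'))

/-- Smooth sections of the dual bundle `E*`, that is, smooth functions on the total space of `E`
that are linear on the fibres. -/
structure DualSec
    (F : Type*) [NormedAddCommGroup F] [NormedSpace ℝ F]
    (E : M → Type*) [TopologicalSpace (TotalSpace F E)] [∀ x, TopologicalSpace (E x)]
    [∀ x, AddCommGroup (E x)] [∀ x, Module ℝ (E x)] [FiberBundle F E] where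
  toFun : ∀ x, Module.Dual ℝ (E x)
  smooth : ContMDiff (𝓘(ℝ, B).prod 𝓘(ℝ, F)) 𝓘(ℝ, ℝ) ∞
    (fun p : TotalSpace F E => toFun p.1 p.2)

variable {B}

section One

variable {F : Type*} [NormedAddCommGroup F] [NormedSpace ℝ F]
  {E : M → Type*} [TopologicalSpace (TotalSpace F E)] [∀ x, TopologicalSpace (E x)]
  [∀ x, AddCommGroup (E x)] [∀ x, Module ℝ (E x)] [FiberBundle F E]

/-- The function `x ↦ α_x(ψ_x)`. -/
def DualSec.pair (α : DualSec B F E) (ψ : Sec B F E) : Fn B M :=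
  ⟨fun x => α.toFun x (ψ x), α.smooth.comp ψ.contMDiff⟩

/-- The product `f ψ` of a function and a section. -/
def smulSec [VectorBundle ℝ F E] (f : Fn B M) (ψ : Sec B F E) : Sec B F E :=
  ⟨fun x => f x • ψ x, ContMDiff.smul_section f.contMDiff ψ.contMDiff⟩

variable {F' : Type*} [NormedAddCommGroup F'] [NormedSpace ℝ F']
  {E' : M → Type*} [TopologicalSpace (TotalSpace F' E')] [∀ x, TopologicalSpace (E' x)]
  [∀ x, AddCommGroup (E' x)] [∀ x, Module ℝ (E' x)] [FiberBundle F' E']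

/-- The action of a bundle map on sections. -/
def BundleMap.onSec (φ : BundleMap B F E F' E') (ψ : Sec B F E) : Sec B F' E' :=
  ⟨fun x => φ.toFun x (ψ x), φ.smooth.comp ψ.contMDiff⟩

end One

end Bundles

/-! ## Lie algebroids and their crossed modules -/

section Algebroids

/-- A Lie algebroid structure on the vector bundle `E`. -/
structure LieAlgebroid
    (B : Type*) [NormedAddCommGroup B] [NormedSpace ℝ B]
    {M : Type*} [TopologicalSpace M] [ChartedSpace B M] [IsManifold 𝓘(ℝ, B) ∞ M]
    (F : Type*) [NormedAddCommGroup F] [NormedSpace ℝ F]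
    (E : M → Type*) [TopologicalSpace (TotalSpace F E)] [∀ x, TopologicalSpace (E x)]
    [∀ x, AddCommGroup (E x)] [∀ x, Module ℝ (E x)] [FiberBundle F E] [VectorBundle ℝ F E] where
  anchor : BundleMap B F E B (TangentSpace 𝓘(ℝ, B) : M → Type _)
  bracket : Sec B F E →ₗ[ℝ] Sec B F E →ₗ[ℝ] Sec B F E
  bracket_self : ∀ ψ, bracket ψ ψ = 0
  jacobi : ∀ ψ₁ ψ₂ ψ₃, bracket ψ₁ (bracket ψ₂ ψ₃) =
    bracket (bracket ψ₁ ψ₂) ψ₃ + bracket ψ₂ (bracket ψ₁ ψ₃)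
  leibniz : ∀ (ψ₁ ψ₂ : Sec B F E) (f : Fn B M) (x : M),
    bracket ψ₁ (smulSec f ψ₂) x =
      f x • bracket ψ₁ ψ₂ x + dirDeriv f x (anchor.toFun x (ψ₁ x)) • ψ₂ x

lemma minSmoothness_two_le : minSmoothness ℝ 2 ≤ ∞ := by
  rw [minSmoothness_of_isRCLikeNormedField]
  exact ENat.LEInfty.out

lemma minSmoothness_three_le : minSmoothness ℝ 3 ≤ ∞ := by
  rw [minSmoothness_of_isRCLikeNormedField]
  exact ENat.LEInfty.out

/-- The standard Lie algebroid `TM`: the anchor is the identity and the bracket is the Lie bracket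
of vector fields. -/
def tangentLieAlgebroid
    (B : Type*) [NormedAddCommGroup B] [NormedSpace ℝ B] [FiniteDimensional ℝ B]
    (M : Type*) [TopologicalSpace M] [ChartedSpace B M] [IsManifold 𝓘(ℝ, B) ∞ M] :
    LieAlgebroid B B (TangentSpace 𝓘(ℝ, B) : M → Type _) :=
  have : CompleteSpace B := FiniteDimensional.complete ℝ B
  have : IsManifold 𝓘(ℝ, B) (minSmoothness ℝ 2) M := IsManifold.of_le minSmoothness_two_le
  have : IsManifold 𝓘(ℝ, B) (minSmoothness ℝ 3) M := IsManifold.of_le minSmoothness_three_le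
  { anchor := ⟨fun _ => LinearMap.id, contMDiff_id⟩
    bracket := LinearMap.mk₂ ℝ
      (fun X Y => ⟨VectorField.mlieBracket 𝓘(ℝ, B) X Y, by
        have : IsManifold 𝓘(ℝ, B) ((⊤ : ℕ∞) + 1) M := ‹IsManifold 𝓘(ℝ, B) ∞ M›
        exact ContDiff.mlieBracket_vectorField (m := ⊤) (n := ⊤) X.contMDiff Y.contMDiff
          (by simp)⟩)
      (fun X X' Y => by
        ext x
        exact VectorField.mlieBracket_add_left X.mdifferentiableAt X'.mdifferentiableAt)
      (fun c X Y => by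
        ext x
        exact VectorField.mlieBracket_const_smul_left X.mdifferentiableAt)
      (fun X Y Y' => by
        ext x
        exact VectorField.mlieBracket_add_right Y.mdifferentiableAt Y'.mdifferentiableAt)
      (fun c X Y => by
        ext x
        exact VectorField.mlieBracket_const_smul_right Y.mdifferentiableAt)
    bracket_self := fun X => by
      ext x
      exact congrFun VectorField.mlieBracket_self x
    jacobi := fun X Y Z => by
      ext x
      exact VectorField.leibniz_identity_mlieBracket_apply
        (X.contMDiff.contMDiffAt.of_le minSmoothness_two_le)
        (Y.contMDiff.contMDiffAt.of_le minSmoothness_two_le)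
        (Z.contMDiff.contMDiffAt.of_le minSmoothness_two_le)
    leibniz := fun X Y f x =>
      (VectorField.mlieBracket_smul_right
        (f.contMDiff.mdifferentiable (by simp) x) Y.mdifferentiableAt).trans (add_comm _ _) }

variable {B : Type*} [NormedAddCommGroup B] [NormedSpace ℝ B]
  {M : Type*} [TopologicalSpace M] [ChartedSpace B M] [IsManifold 𝓘(ℝ, B) ∞ M]
  {F : Type*} [NormedAddCommGroup F] [NormedSpace ℝ F]
  {E : M → Type*} [TopologicalSpace (TotalSpace F E)] [∀ x, TopologicalSpace (E x)]
  [∀ x, AddCommGroup (E x)] [∀ x, Module ℝ (E x)] [FiberBundle F E] [VectorBundle ℝ F E]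

/-- Morphisms of Lie algebroids covering the identity of `M`. -/
structure IsLieAlgebroidHom
    {F' : Type*} [NormedAddCommGroup F'] [NormedSpace ℝ F']
    {E' : M → Type*} [TopologicalSpace (TotalSpace F' E')] [∀ x, TopologicalSpace (E' x)]
    [∀ x, AddCommGroup (E' x)] [∀ x, Module ℝ (E' x)] [FiberBundle F' E'] [VectorBundle ℝ F' E']
    (A : LieAlgebroid B F E) (A' : LieAlgebroid B F' E') (φ : BundleMap B F E F' E') : Prop where
  anchor_comp : ∀ x (e : E x), A'.anchor.toFun x (φ.toFun x e) = A.anchor.toFun x e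
  map_bracket : ∀ ψ₁ ψ₂, φ.onSec (A.bracket ψ₁ ψ₂) = A'.bracket (φ.onSec ψ₁) (φ.onSec ψ₂)

/-- A representation of the Lie algebroid `E` on the vector bundle `V`: a flat `E`-connection. -/
structure Representation (A : LieAlgebroid B F E)
    (G : Type*) [NormedAddCommGroup G] [NormedSpace ℝ G]
    (V : M → Type*) [TopologicalSpace (TotalSpace G V)] [∀ x, TopologicalSpace (V x)]
    [∀ x, AddCommGroup (V x)] [∀ x, Module ℝ (V x)] [FiberBundle G V] [VectorBundle ℝ G V] where
  conn : Sec B F E →ₗ[ℝ] Sec B G V →ₗ[ℝ] Sec B G V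
  smul_left : ∀ (f : Fn B M) ψ v, conn (smulSec f ψ) v = smulSec f (conn ψ v)
  leibniz : ∀ (ψ : Sec B F E) (f : Fn B M) (v : Sec B G V) (x : M),
    conn ψ (smulSec f v) x = dirDeriv f x (A.anchor.toFun x (ψ x)) • v x + f x • conn ψ v x
  flat : ∀ ψ₁ ψ₂ v, conn ψ₁ (conn ψ₂ v) - conn ψ₂ (conn ψ₁ v) - conn (A.bracket ψ₁ ψ₂) v = 0

end Algebroids

/-- A crossed module of Lie algebroids on `(E, V)`: a complex of Lie algebroids
`V → E → TM`, whose arrows `t` and `ρ` are morphisms of Lie algebroids with `ρ ∘ t = 0` (so that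
the anchor `ρ ∘ t` of `V` vanishes), together with a compatible representation of `E` on `V`. -/
structure CrossedModule
    (B : Type*) [NormedAddCommGroup B] [NormedSpace ℝ B] [FiniteDimensional ℝ B]
    {M : Type*} [TopologicalSpace M] [ChartedSpace B M] [IsManifold 𝓘(ℝ, B) ∞ M]
    (F : Type*) [NormedAddCommGroup F] [NormedSpace ℝ F]
    (E : M → Type*) [TopologicalSpace (TotalSpace F E)] [∀ x, TopologicalSpace (E x)]
    [∀ x, AddCommGroup (E x)] [∀ x, Module ℝ (E x)] [FiberBundle F E] [VectorBundle ℝ F E]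
    (G : Type*) [NormedAddCommGroup G] [NormedSpace ℝ G]
    (V : M → Type*) [TopologicalSpace (TotalSpace G V)] [∀ x, TopologicalSpace (V x)]
    [∀ x, AddCommGroup (V x)] [∀ x, Module ℝ (V x)] [FiberBundle G V] [VectorBundle ℝ G V] where
  algE : LieAlgebroid B F E
  algV : LieAlgebroid B G V
  t : BundleMap B G V F E
  t_hom : IsLieAlgebroidHom algV algE t
  anchor_hom : IsLieAlgebroidHom algE (tangentLieAlgebroid B M) algE.anchor
  complex : ∀ x (v : V x), algE.anchor.toFun x (t.toFun x v) = 0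
  rep : Representation algE G V
  t_conn : ∀ ψ v, t.onSec (rep.conn ψ v) = algE.bracket ψ (t.onSec v)
  conn_t : ∀ v w, rep.conn (t.onSec v) w = algV.bracket v w

/-! ## Functions on the graded manifold `E[1] ⊕ V[2]`

The fibre at a point is the algebra `Λ(E_x*) ⊗ S(V_x*)`. In local coordinates `x^i` on `M` and
local frames `ξ^a` of `E*` and `b^D` of `V*` (of degrees 0, 1 and 2), a function is a polynomial in
the `ξ^a` and `b^D` whose coefficients are smooth functions of the `x^i`. -/

section Fibre

variable (U W : Type*) [AddCommGroup U] [Module ℝ U] [AddCommGroup W] [Module ℝ W]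

/-- The algebra `Λ(U*) ⊗ S(W*)`. -/
def Fib : Type _ :=
  ExteriorAlgebra ℝ (Module.Dual ℝ U) ⊗[ℝ] SymmetricAlgebra ℝ (Module.Dual ℝ W)

instance : Ring (Fib U W) :=
  inferInstanceAs
    (Ring (ExteriorAlgebra ℝ (Module.Dual ℝ U) ⊗[ℝ] SymmetricAlgebra ℝ (Module.Dual ℝ W)))

instance : Algebra ℝ (Fib U W) :=
  inferInstanceAs
    (Algebra ℝ (ExteriorAlgebra ℝ (Module.Dual ℝ U) ⊗[ℝ] SymmetricAlgebra ℝ (Module.Dual ℝ W)))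

/-- The inclusion `ω ↦ ω ⊗ 1` of `Λ(U*)`. -/
def inclOdd : ExteriorAlgebra ℝ (Module.Dual ℝ U) →ₐ[ℝ] Fib U W :=
  (Algebra.TensorProduct.includeLeft : ExteriorAlgebra ℝ (Module.Dual ℝ U) →ₐ[ℝ]
    ExteriorAlgebra ℝ (Module.Dual ℝ U) ⊗[ℝ] SymmetricAlgebra ℝ (Module.Dual ℝ W))

/-- The inclusion `P ↦ 1 ⊗ P` of `S(W*)`. -/
def inclEven : SymmetricAlgebra ℝ (Module.Dual ℝ W) →ₐ[ℝ] Fib U W :=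
  (Algebra.TensorProduct.includeRight : SymmetricAlgebra ℝ (Module.Dual ℝ W) →ₐ[ℝ]
    ExteriorAlgebra ℝ (Module.Dual ℝ U) ⊗[ℝ] SymmetricAlgebra ℝ (Module.Dual ℝ W))

/-- Elements of `U*` as generators (of degree 1). -/
def genOdd : Module.Dual ℝ U →ₗ[ℝ] Fib U W :=
  (inclOdd U W).toLinearMap ∘ₗ ExteriorAlgebra.ι ℝ

/-- Elements of `W*` as generators (of degree 2). -/
def genEven : Module.Dual ℝ W →ₗ[ℝ] Fib U W :=
  (inclEven U W).toLinearMap ∘ₗ SymmetricAlgebra.ι ℝ (Module.Dual ℝ W)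

/-- The part of degree `k`: the sum of the `Λ^p(U*) ⊗ S^q(W*)` with `p + 2 q = k`. -/
def fibDegree (k : ℕ) : Submodule ℝ (Fib U W) :=
  ⨆ (p : ℕ) (q : ℕ) (_ : p + 2 * q = k),
    LinearMap.range (genOdd U W) ^ p * LinearMap.range (genEven U W) ^ q

variable {U W}

/-- Evaluation of the even generators at `w`, i.e. `ω ⊗ P ↦ P(w) ω`. -/
def evalEven (w : W) : Fib U W →ₐ[ℝ] ExteriorAlgebra ℝ (Module.Dual ℝ U) :=
  (((Algebra.TensorProduct.rid ℝ ℝ (ExteriorAlgebra ℝ (Module.Dual ℝ U))).toAlgHom.comp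
    (Algebra.TensorProduct.map (AlgHom.id ℝ (ExteriorAlgebra ℝ (Module.Dual ℝ U)))
      (SymmetricAlgebra.lift (Module.Dual.eval ℝ W w)))) :
    ExteriorAlgebra ℝ (Module.Dual ℝ U) ⊗[ℝ] SymmetricAlgebra ℝ (Module.Dual ℝ W) →ₐ[ℝ]
      ExteriorAlgebra ℝ (Module.Dual ℝ U))

/-- Interior product `ι_u` on `Λ(U*)`: `ι_u(α ω) = α(u) ω - α ι_u(ω)` for `α ∈ U*`. -/
def interiorProd (u : U) :
    ExteriorAlgebra ℝ (Module.Dual ℝ U) →ₗ[ℝ] ExteriorAlgebra ℝ (Module.Dual ℝ U) :=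
  CliffordAlgebra.contractLeft (Q := (0 : QuadraticForm ℝ (Module.Dual ℝ U)))
    (Module.Dual.eval ℝ U u)

/-- The component of degree `0` in `Λ⁰(U*) = ℝ`. -/
def body : ExteriorAlgebra ℝ (Module.Dual ℝ U) →ₐ[ℝ] ℝ :=
  ExteriorAlgebra.algebraMapInv

end Fibre

section Functions

variable (B : Type*) [NormedAddCommGroup B] [NormedSpace ℝ B]
  {M : Type*} [TopologicalSpace M] [ChartedSpace B M]
  (F : Type*) [NormedAddCommGroup F] [NormedSpace ℝ F]
  (E : M → Type*) [TopologicalSpace (TotalSpace F E)] [∀ x, TopologicalSpace (E x)]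
  [∀ x, AddCommGroup (E x)] [∀ x, Module ℝ (E x)] [FiberBundle F E]
  (G : Type*) [NormedAddCommGroup G] [NormedSpace ℝ G]
  (V : M → Type*) [TopologicalSpace (TotalSpace G V)] [∀ x, TopologicalSpace (V x)]
  [∀ x, AddCommGroup (V x)] [∀ x, Module ℝ (V x)] [FiberBundle G V]

/-- Polynomials in smooth functions on `M` and smooth sections of `E*` and of `V*`. -/
def polyFun : Subalgebra ℝ (∀ x, Fib (E x) (V x)) :=
  Algebra.adjoin ℝ
    (Set.range (fun f : Fn B M => fun x => algebraMap ℝ (Fib (E x) (V x)) (f x)) ∪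
      Set.range (fun α : DualSec B F E => fun x => genOdd (E x) (V x) (α.toFun x)) ∪
      Set.range (fun β : DualSec B G V => fun x => genEven (E x) (V x) (β.toFun x)))

/-- The algebra `C^∞(E[1] ⊕ V[2])` of global functions: the fields of elements of
`Λ(E_x*) ⊗ S(V_x*)` that near each point of `M` are polynomials in smooth functions on `M` and
smooth sections of `E*` and of `V*`. -/
def superFun : Subalgebra ℝ (∀ x, Fib (E x) (V x)) where
  carrier := {s | ∀ x₀, ∃ g ∈ polyFun B F E G V, ∀ᶠ x in 𝓝 x₀, s x = g x}
  mul_mem' := fun {s s'} hs hs' x₀ => by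
    obtain ⟨g, hg, h⟩ := hs x₀
    obtain ⟨g', hg', h'⟩ := hs' x₀
    refine ⟨g * g', mul_mem hg hg', ?_⟩
    filter_upwards [h, h'] with x hx hx'
    simp only [Pi.mul_apply, hx, hx']
  add_mem' := fun {s s'} hs hs' x₀ => by
    obtain ⟨g, hg, h⟩ := hs x₀
    obtain ⟨g', hg', h'⟩ := hs' x₀
    refine ⟨g + g', add_mem hg hg', ?_⟩
    filter_upwards [h, h'] with x hx hx'
    simp only [Pi.add_apply, hx, hx']
  algebraMap_mem' := fun r _ => ⟨_, algebraMap_mem _ r, Eventually.of_forall fun _ => rfl⟩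

variable {B F E G V}

lemma polyFun_le : polyFun B F E G V ≤ superFun B F E G V :=
  fun s hs _ => ⟨s, hs, Eventually.of_forall fun _ => rfl⟩

/-- A function is homogeneous of degree `k` if it takes values in the parts of degree `k`. -/
def IsHomogeneous (k : ℕ) (s : superFun B F E G V) : Prop :=
  ∀ x, s.1 x ∈ fibDegree (E x) (V x) k

variable (F E G V) in
/-- Smooth functions on `M`, as functions of degree 0. -/
def ofFn (f : Fn B M) : superFun B F E G V :=
  ⟨fun x => algebraMap ℝ (Fib (E x) (V x)) (f x),
    polyFun_le (Algebra.subset_adjoin (Or.inl (Or.inl ⟨f, rfl⟩)))⟩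

variable (G V) in
/-- Sections of `E*`, as functions of degree 1. -/
def ofDualE (α : DualSec B F E) : superFun B F E G V :=
  ⟨fun x => genOdd (E x) (V x) (α.toFun x),
    polyFun_le (Algebra.subset_adjoin (Or.inl (Or.inr ⟨α, rfl⟩)))⟩

variable (F E) in
/-- Sections of `V*`, as functions of degree 2. -/
def ofDualV (β : DualSec B G V) : superFun B F E G V :=
  ⟨fun x => genEven (E x) (V x) (β.toFun x),
    polyFun_le (Algebra.subset_adjoin (Or.inr ⟨β, rfl⟩))⟩

variable (B F E G V) in
/-- A Q-structure on the graded manifold `E[1] ⊕ V[2]`: a vector field `Q` (graded derivation of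
the algebra of functions) of degree `+1` with `Q² = 0`. The pair `(E[1] ⊕ V[2], Q)` is a
Q2-manifold with a splitting. -/
structure QStructure where
  Q : superFun B F E G V →ₗ[ℝ] superFun B F E G V
  degree_one : ∀ k s, IsHomogeneous k s → IsHomogeneous (k + 1) (Q s)
  graded_leibniz : ∀ k s s', IsHomogeneous k s →
    Q (s * s') = Q s * s' + (-1 : ℝ) ^ k • (s * Q s')
  square_zero : ∀ s, Q (Q s) = 0

/-- The anomaly `H ∈ Γ(Λ³E* ⊗ V)`, given through its contractions with the sections `β` of `V*`:
`⟨H, β⟩ ∈ Γ(Λ³E*)` is the part of the degree 3 function `Q β` that is free of generators in `V*`,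
i.e. its restriction to `E[1]` along the splitting. -/
def QStructure.anomaly (q : QStructure B F E G V) (β : DualSec B G V) (x : M) :
    ExteriorAlgebra ℝ (Module.Dual ℝ (E x)) :=
  evalEven (0 : V x) ((q.Q (ofDualV F E β)).1 x)

/-- The condition `H = 0`. -/
def QStructure.AnomalyFree (q : QStructure B F E G V) : Prop :=
  ∀ β x, q.anomaly β x = 0

variable [FiniteDimensional ℝ B] [IsManifold 𝓘(ℝ, B) ∞ M] [VectorBundle ℝ F E] [VectorBundle ℝ G V]

/-- `q` is built from the anchor `ρ`, the bracket, `t` and the connection of `X`, that is, in local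
frames with `ρ(ξ_a) = ρ^i_a ∂_i`, `[ξ_a, ξ_b] = C^c_{ab} ξ_c`, `t(b_D) = t^a_D ξ_a` and
`∇_{ξ_a} b_D = Γ^C_{aD} b_C`,
`Q = ρ^i_a ξ^a ∂/∂x^i - ½ C^a_{bc} ξ^b ξ^c ∂/∂ξ^a + t^a_D b^D ∂/∂ξ^a - Γ^D_{aC} ξ^a b^C ∂/∂b^D`
up to a term `ξ^a ξ^b ξ^c ∂/∂b^D` (the anomaly). In invariant terms, for `f ∈ C^∞(M)`,
`α ∈ Γ(E*)`, `β ∈ Γ(V*)`: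
* `Q f ∈ Γ(E*)` is `ψ ↦ ρ(ψ) f`;
* the part of `Q α` in `Γ(Λ²E*)` is `(ψ, φ) ↦ ρ(ψ) α(φ) - ρ(φ) α(ψ) - α([ψ, φ])`;
* the part of `Q α` in `Γ(V*)` is `v ↦ α(t v)`;
* the part of `Q β` in `Γ(E* ⊗ V*)` is `(ψ, v) ↦ ρ(ψ) β(v) - β(∇_ψ v)`. -/
structure Corresponds (q : QStructure B F E G V) (X : CrossedModule B F E G V) : Prop where
  anchor : ∀ (f : Fn B M) (ψ : Sec B F E) (x : M),
    body (interiorProd (ψ x) (evalEven (0 : V x) ((q.Q (ofFn F E G V f)).1 x))) =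
      dirDeriv f x (X.algE.anchor.toFun x (ψ x))
  bracket : ∀ (α : DualSec B F E) (ψ φ : Sec B F E) (x : M),
    body (interiorProd (φ x) (interiorProd (ψ x)
        (evalEven (0 : V x) ((q.Q (ofDualE G V α)).1 x)))) =
      dirDeriv (α.pair φ) x (X.algE.anchor.toFun x (ψ x)) -
        dirDeriv (α.pair ψ) x (X.algE.anchor.toFun x (φ x)) -
        α.toFun x (X.algE.bracket ψ φ x)
  t : ∀ (α : DualSec B F E) (v : Sec B G V) (x : M),
    body (evalEven (v x) ((q.Q (ofDualE G V α)).1 x)) = α.toFun x (X.t.toFun x (v x))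
  conn : ∀ (β : DualSec B G V) (ψ : Sec B F E) (v : Sec B G V) (x : M),
    body (interiorProd (ψ x) (evalEven (v x) ((q.Q (ofDualV F E β)).1 x))) =
      dirDeriv (β.pair v) x (X.algE.anchor.toFun x (ψ x)) - β.toFun x (X.rep.conn ψ v x)

end Functions

end Q2

end

set_option linter.unusedSectionVars false
set_option linter.unusedVariables false

noncomputable section

namespace Q2

/-! ### The fibre algebra `Λ(U*) ⊗ S(W*)`: universal property, derivations, grading -/

section FibreAlgebra

variable {U W : Type*} [AddCommGroup U] [Module ℝ U] [AddCommGroup W] [Module ℝ W]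

/-! Everything is expressed through the contractions `i_ψ` (`contractE`, odd, degree -1) and `i_v`
(`contractV`, even, degree -2). A derivation of the algebra of functions is local, so it is
determined by its values on the generators `f`, `α`, `β` (`eq_zero_of_generators`). A homogeneous
function of positive degree is determined by its contractions, because the Euler derivation equals
`∑ ξ^i i_{e_i} + 2 ∑ η^j i_{b_j}` (`euler_eq_sum`). Hence an odd derivation `Q` of degree one is
encoded by the functions obtained by contracting `Q f`, `Q α`, `Q β` down to degree zero. These are
the anchor, the bracket, `t`, the connection and the anomaly; `Components` records them with
vanishing anomaly.

From `Q` to the crossed module. The Leibniz rule of `Q` makes the components tensorial where they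
have to be, so they come from bundle maps and sections (`exists_components`). Put `L_ψ = [Q, i_ψ]`
and `L_v = [Q, i_v]` with graded commutators. For vanishing anomaly, `[L_ψ, i_φ] = i_{[ψ,φ]}`,
`[L_ψ, i_v] = i_{∇_ψ v}`, `[L_v, i_w] = 0`, and `L_v = -i_{t v}` on functions of degree one. If `Q²
= 0`, then `L_ψ` commutes with `Q`, and the graded Jacobi identity gives `[L_ψ, L_φ] = L_{[ψ,φ]}`,
`[L_ψ, L_v] = L_{∇_ψ v}` and `[L_v, L_w] = 0`. The first relation contains the Jacobi identity, the
flatness of `∇` and the anchor property; the second, applied to `α`, is `t(∇_ψ v) = [ψ, t v]`; the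
third, applied to `β`, says that `∇_{t v} w` is antisymmetric. Finally `i_v Q² f = 0` is `ρ ∘ t =
0`. The bracket of `V` is then forced to be `∇_{t v} w`, and its Jacobi identity follows from
flatness and equivariance.

From the crossed module to `Q`. At each point a derivation into the fibre is written down in a local
trivialization, with horizontal part the anchor and vertical part given by the bracket, `t` and the
connection (`exists_pointQ`). Its components are tensorial, hence independent of the trivialization
and smooth, and these pointwise derivations form a global one (`CrossedModule.exists_components`).
Then `Q² = 0` follows by running the calculus backwards (`Components.square_zero`): the curvature
`[L_ψ, L_φ] - L_{[ψ,φ]}` vanishes, and `[i_ψ, Q²]` and `Q²` are shown to vanish on the generators in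
order of degree.

Both constructions are unique (`Components.unique`, `Components.crossedModule_unique`), so they are
inverse to each other. -/

lemma genOdd_mul_self (α : Module.Dual ℝ U) : genOdd U W α * genOdd U W α = 0 := by
  simp only [genOdd, LinearMap.comp_apply, AlgHom.toLinearMap_apply, ← map_mul,
    ExteriorAlgebra.ι_sq_zero, map_zero]

lemma genOdd_mul_genOdd (α α' : Module.Dual ℝ U) :
    genOdd U W α * genOdd U W α' = -(genOdd U W α' * genOdd U W α) := by
  have h := genOdd_mul_self (W := W) (α + α')
  simp only [map_add, mul_add, add_mul, genOdd_mul_self, zero_add, add_zero] at h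
  exact eq_neg_of_add_eq_zero_left ((add_comm _ _).trans h)

/-- Induction over the algebra `Λ(U*) ⊗ S(W*)`. -/
@[elab_as_elim]
lemma Fib.induction {p : Fib U W → Prop} (hC : ∀ r, p (algebraMap ℝ (Fib U W) r))
    (hO : ∀ α, p (genOdd U W α)) (hE : ∀ β, p (genEven U W β))
    (hmul : ∀ a b, p a → p b → p (a * b)) (hadd : ∀ a b, p a → p b → p (a + b)) (a : Fib U W) :
    p a := by
  have h1 : ∀ η, p (inclOdd U W η) := fun η => by
    induction η using ExteriorAlgebra.induction with
    | algebraMap r => rw [AlgHom.commutes]; exact hC r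
    | ι α => exact hO α
    | mul a b ha hb => rw [map_mul]; exact hmul _ _ ha hb
    | add a b ha hb => rw [map_add]; exact hadd _ _ ha hb
  have h2 : ∀ P, p (inclEven U W P) := fun P => by
    induction P using SymmetricAlgebra.induction with
    | algebraMap r => rw [AlgHom.commutes]; exact hC r
    | ι α => exact hE α
    | mul a b ha hb => rw [map_mul]; exact hmul _ _ ha hb
    | add a b ha hb => rw [map_add]; exact hadd _ _ ha hb
  refine TensorProduct.induction_on (motive := p) a ?_ (fun η P => ?_) hadd
  · have := hC 0
    rwa [map_zero] at this
  · have := hmul _ _ (h1 η) (h2 P)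
    have e : inclOdd U W η * inclEven U W P = (η ⊗ₜ[ℝ] P :
        ExteriorAlgebra ℝ (Module.Dual ℝ U) ⊗[ℝ] SymmetricAlgebra ℝ (Module.Dual ℝ W)) :=
      (Algebra.TensorProduct.tmul_mul_tmul η 1 1 P).trans (by rw [mul_one, one_mul])
    rwa [e] at this

/-- Induction over the algebra `Λ(U*) ⊗ S(W*)` by left multiplication with generators. -/
@[elab_as_elim]
lemma Fib.induction_left {p : Fib U W → Prop} (h1 : p 1) (hsmul : ∀ (r : ℝ) a, p a → p (r • a))
    (hO : ∀ α a, p a → p (genOdd U W α * a)) (hE : ∀ β a, p a → p (genEven U W β * a))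
    (hadd : ∀ a b, p a → p b → p (a + b)) (a : Fib U W) : p a := by
  have key : ∀ a b, p b → p (a * b) := fun a => by
    induction a using Fib.induction with
    | hC r => intro b hb; rw [← Algebra.smul_def]; exact hsmul r b hb
    | hO α => exact hO α
    | hE β => exact hE β
    | hmul a b ha hb => intro c hc; rw [mul_assoc]; exact ha _ (hb _ hc)
    | hadd a b ha hb => intro c hc; rw [add_mul]; exact hadd _ _ (ha _ hc) (hb _ hc)
  simpa using key a 1 h1

lemma genEven_mul_comm (β : Module.Dual ℝ W) (a : Fib U W) :
    genEven U W β * a = a * genEven U W β := by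
  induction a using Fib.induction with
  | hC r => exact (Algebra.commutes r _).symm
  | hO α =>
    exact (Algebra.TensorProduct.tmul_mul_tmul (R := ℝ)
      (1 : ExteriorAlgebra ℝ (Module.Dual ℝ U)) (ExteriorAlgebra.ι ℝ α)
      (SymmetricAlgebra.ι ℝ _ β) 1).trans (Eq.trans (by simp)
        (Algebra.TensorProduct.tmul_mul_tmul (R := ℝ) (ExteriorAlgebra.ι ℝ α)
        (1 : ExteriorAlgebra ℝ (Module.Dual ℝ U)) 1 (SymmetricAlgebra.ι ℝ _ β)).symm)
  | hE β' =>
    simp only [genEven, LinearMap.comp_apply, AlgHom.toLinearMap_apply, ← map_mul]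
    rw [mul_comm]
  | hmul a b ha hb => rw [← mul_assoc, ha, mul_assoc, hb, mul_assoc]
  | hadd a b ha hb => rw [mul_add, add_mul, ha, hb]

section Lift

variable {C : Type*} [Ring C] [Algebra ℝ C]

lemma Fib.algHom_ext {f g : Fib U W →ₐ[ℝ] C} (hO : ∀ α, f (genOdd U W α) = g (genOdd U W α))
    (hE : ∀ β, f (genEven U W β) = g (genEven U W β)) : f = g := by
  ext a
  induction a using Fib.induction with
  | hC r => rw [AlgHom.commutes, AlgHom.commutes]
  | hO α => exact hO α
  | hE β => exact hE β
  | hmul a b ha hb => rw [map_mul, map_mul, ha, hb]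
  | hadd a b ha hb => rw [map_add, map_add, ha, hb]

/-- The universal property of the symmetric algebra asks for a commutative target, which `C` need
not be. The lift is therefore taken into the subalgebra generated by the values of `e`, which is
commutative because its generators commute. -/
lemma exists_symmetricAlgebra_lift (e : W →ₗ[ℝ] C) (he : ∀ β β', e β * e β' = e β' * e β) :
    ∃ φ : SymmetricAlgebra ℝ W →ₐ[ℝ] C, ∀ β, φ (SymmetricAlgebra.ι ℝ _ β) = e β := by
  have : IsMulCommutative (Algebra.adjoin ℝ (Set.range e)) :=
    Algebra.isMulCommutative_adjoin ℝ (by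
      rintro _ ⟨β, rfl⟩ _ ⟨β', rfl⟩
      exact he β β')
  let e' : W →ₗ[ℝ] Algebra.adjoin ℝ (Set.range e) :=
    LinearMap.codRestrict (Subalgebra.toSubmodule (Algebra.adjoin ℝ (Set.range e))) e
      (fun β => Algebra.subset_adjoin ⟨β, rfl⟩)
  let _ : CommSemiring (Algebra.adjoin ℝ (Set.range e)) :=
    { (inferInstance : Semiring (Algebra.adjoin ℝ (Set.range e))) with mul_comm := mul_comm' }
  refine ⟨(Algebra.adjoin ℝ (Set.range e)).val.comp (SymmetricAlgebra.lift e'), fun β => ?_⟩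
  rw [AlgHom.comp_apply, SymmetricAlgebra.lift_ι_apply]
  rfl

/-- Universal property of `Λ(U*) ⊗ S(W*)`. -/
lemma Fib.exists_lift (o : Module.Dual ℝ U →ₗ[ℝ] C) (e : Module.Dual ℝ W →ₗ[ℝ] C)
    (ho : ∀ α, o α * o α = 0) (he : ∀ β β', e β * e β' = e β' * e β)
    (hoe : ∀ α β, o α * e β = e β * o α) :
    ∃ φ : Fib U W →ₐ[ℝ] C, (∀ α, φ (genOdd U W α) = o α) ∧ ∀ β, φ (genEven U W β) = e β := by
  obtain ⟨ε, hε⟩ := exists_symmetricAlgebra_lift e he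
  let ω' := ExteriorAlgebra.lift ℝ ⟨o, ho⟩
  have hω (α : Module.Dual ℝ U) : ω' (ExteriorAlgebra.ι ℝ α) = o α :=
    ExteriorAlgebra.lift_ι_apply ℝ o ho α
  -- Since `S(W*)` is purely even, the ungraded tensor product of algebras is the right one, and the
  -- two factors only have to commute.
  have hc : ∀ x y, Commute (ω' x) (ε y) := fun x y => by
    induction x using ExteriorAlgebra.induction with
    | algebraMap r => rw [AlgHom.commutes]; exact Algebra.commutes r _
    | ι α =>
      rw [hω]
      induction y using SymmetricAlgebra.induction with
      | algebraMap r => rw [AlgHom.commutes]; exact (Algebra.commutes r _).symm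
      | ι β => rw [hε]; exact hoe α β
      | mul a b ha hb => rw [map_mul]; exact ha.mul_right hb
      | add a b ha hb => rw [map_add]; exact ha.add_right hb
    | mul a b ha hb => rw [map_mul]; exact ha.mul_left hb
    | add a b ha hb => rw [map_add]; exact ha.add_left hb
  refine ⟨(Algebra.TensorProduct.lift ω' ε hc : ExteriorAlgebra ℝ (Module.Dual ℝ U) ⊗[ℝ]
    SymmetricAlgebra ℝ (Module.Dual ℝ W) →ₐ[ℝ] C), fun α => ?_, fun β => ?_⟩
  · exact (Algebra.TensorProduct.lift_tmul _ _ _ _ _).trans (by rw [map_one, mul_one, hω])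
  · exact (Algebra.TensorProduct.lift_tmul _ _ _ _ _).trans (by rw [map_one, one_mul, hε])

/-- Existence of twisted derivations of `Λ(U*) ⊗ S(W*)` with prescribed values on generators. -/
lemma Fib.exists_derivation (f g : Fib U W →ₐ[ℝ] C) (o : Module.Dual ℝ U →ₗ[ℝ] C)
    (e : Module.Dual ℝ W →ₗ[ℝ] C)
    (ho : ∀ α, f (genOdd U W α) * o α + o α * g (genOdd U W α) = 0)
    (he : ∀ β β', f (genEven U W β) * e β' + e β * g (genEven U W β') =
      f (genEven U W β') * e β + e β' * g (genEven U W β))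
    (hoe : ∀ α β, f (genOdd U W α) * e β + o α * g (genEven U W β) =
      f (genEven U W β) * o α + e β * g (genOdd U W α)) :
    ∃ D : Fib U W →ₗ[ℝ] C, (∀ a b, D (a * b) = D a * g b + f a * D b) ∧
      (∀ α, D (genOdd U W α) = o α) ∧ ∀ β, D (genEven U W β) = e β := by
  -- The rule `D(ab) = D(a) g(b) + f(a) D(b)` holds exactly if `a ↦ !![f a, D a; 0, g a]` is
  -- multiplicative. So `D` comes from the universal property with values in triangular matrices,
  -- and `ho`, `he`, `hoe` are the relations in the upper right entry.
  have hmul (a b c a' b' c' : C) : (!![a, b; 0, c] * !![a', b'; 0, c'] : Matrix (Fin 2) (Fin 2) C) =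
      !![a * a', a * b' + b * c'; 0, c * c'] := by
    simp
  let tri : C × C × C →ₗ[ℝ] Matrix (Fin 2) (Fin 2) C :=
    { toFun := fun p => !![p.1, p.2.1; 0, p.2.2]
      map_add' := fun p q => by ext i j; fin_cases i <;> fin_cases j <;> simp
      map_smul' := fun r p => by ext i j; fin_cases i <;> fin_cases j <;> simp }
  have htri (p : C × C × C) : tri p = !![p.1, p.2.1; 0, p.2.2] := rfl
  let o' := tri ∘ₗ LinearMap.prod (f.toLinearMap ∘ₗ genOdd U W)
    (LinearMap.prod o (g.toLinearMap ∘ₗ genOdd U W))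
  let e' := tri ∘ₗ LinearMap.prod (f.toLinearMap ∘ₗ genEven U W)
    (LinearMap.prod e (g.toLinearMap ∘ₗ genEven U W))
  have ho' (α) : o' α = !![f (genOdd U W α), o α; 0, g (genOdd U W α)] := rfl
  have he' (β) : e' β = !![f (genEven U W β), e β; 0, g (genEven U W β)] := rfl
  obtain ⟨φ, hφO, hφE⟩ := Fib.exists_lift o' e'
    (fun α => by
      rw [ho', hmul, ho, ← map_mul f, ← map_mul g, genOdd_mul_self, map_zero, map_zero]
      ext i j; fin_cases i <;> fin_cases j <;> simp)
    (fun β β' => by simp only [he', hmul, he β β', ← map_mul, genEven_mul_comm β])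
    (fun α β => by simp only [ho', he', hmul, hoe α β, ← map_mul, genEven_mul_comm β])
  -- The three other entries are known on generators, hence everywhere; the upper right entry of a
  -- product is then the Leibniz rule.
  have hshape (a : Fib U W) : φ a 0 0 = f a ∧ φ a 1 0 = 0 ∧ φ a 1 1 = g a := by
    induction a using Fib.induction with
    | hC r => simp [Algebra.algebraMap_eq_smul_one]
    | hO α => rw [hφO]; simp [ho']
    | hE β => rw [hφE]; simp [he']
    | hmul a b ha hb =>
      simp [Matrix.mul_apply, Fin.sum_univ_two, ha.1, ha.2.1, ha.2.2, hb.1, hb.2.1, hb.2.2]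
    | hadd a b ha hb => simp [ha.1, ha.2.1, ha.2.2, hb.1, hb.2.1, hb.2.2]
  refine ⟨{ toFun := fun a => φ a 0 1, map_add' := fun a b => by simp,
            map_smul' := fun r a => by simp }, fun a b => ?_, fun α => ?_, fun β => ?_⟩
  · simp [Matrix.mul_apply, Fin.sum_univ_two, (hshape a).1, (hshape b).2.2, add_comm]
  · change φ _ 0 1 = _
    rw [hφO]; simp [ho']
  · change φ _ 0 1 = _
    rw [hφE]; simp [he']

end Lift

variable (U W) in
lemma exists_parity : ∃ φ : Fib U W →ₐ[ℝ] Fib U W,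
    (∀ α, φ (genOdd U W α) = -genOdd U W α) ∧ ∀ β, φ (genEven U W β) = genEven U W β :=
  Fib.exists_lift (-genOdd U W) (genEven U W) (fun α => by simp [genOdd_mul_self])
    (fun β β' => genEven_mul_comm β _) (fun α β => (genEven_mul_comm β _).symm)

variable (U W) in
/-- The parity automorphism: `-1` on odd elements, `1` on even elements. -/
def parity : Fib U W →ₐ[ℝ] Fib U W := (exists_parity U W).choose

@[simp]
lemma parity_genOdd (α : Module.Dual ℝ U) : parity U W (genOdd U W α) = -genOdd U W α :=
  (exists_parity U W).choose_spec.1 α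

@[simp]
lemma parity_genEven (β : Module.Dual ℝ W) : parity U W (genEven U W β) = genEven U W β :=
  (exists_parity U W).choose_spec.2 β

lemma parity_parity (a : Fib U W) : parity U W (parity U W a) = a := by
  have : (parity U W).comp (parity U W) = AlgHom.id ℝ _ :=
    Fib.algHom_ext (by simp) (by simp)
  exact DFunLike.congr_fun this a

lemma exists_contractOdd (u : U) : ∃ D : Fib U W →ₗ[ℝ] Fib U W,
    (∀ a b, D (a * b) = D a * b + parity U W a * D b) ∧
      (∀ α, D (genOdd U W α) = algebraMap ℝ _ (α u)) ∧ ∀ β, D (genEven U W β) = 0 :=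
  Fib.exists_derivation (parity U W) (AlgHom.id ℝ _)
    (Algebra.linearMap ℝ _ ∘ₗ Module.Dual.eval ℝ U u) 0
    (fun α => by simp [← Algebra.commutes]) (by simp) (fun α β => by simp [Algebra.commutes])

/-- Contraction of the odd generators with `u`. -/
def contractOdd (u : U) : Fib U W →ₗ[ℝ] Fib U W := (exists_contractOdd u).choose

lemma contractOdd_mul (u : U) (a b : Fib U W) :
    contractOdd u (a * b) = contractOdd u a * b + parity U W a * contractOdd u b :=
  (exists_contractOdd u).choose_spec.1 a b

@[simp]
lemma contractOdd_genOdd (u : U) (α : Module.Dual ℝ U) :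
    contractOdd u (genOdd U W α) = algebraMap ℝ _ (α u) :=
  (exists_contractOdd u).choose_spec.2.1 α

@[simp]
lemma contractOdd_genEven (u : U) (β : Module.Dual ℝ W) : contractOdd u (genEven U W β) = 0 :=
  (exists_contractOdd u).choose_spec.2.2 β

lemma exists_contractEven (w : W) : ∃ D : Fib U W →ₗ[ℝ] Fib U W,
    (∀ a b, D (a * b) = D a * b + a * D b) ∧
      (∀ α, D (genOdd U W α) = 0) ∧ ∀ β, D (genEven U W β) = algebraMap ℝ _ (β w) :=
  Fib.exists_derivation (AlgHom.id ℝ _) (AlgHom.id ℝ _) 0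
    (Algebra.linearMap ℝ _ ∘ₗ Module.Dual.eval ℝ W w)
    (by simp) (fun β β' => by simp [Algebra.commutes, add_comm])
    (fun α β => by simp [Algebra.commutes])

/-- The partial derivative with respect to the even generators in the direction `w`. -/
def contractEven (w : W) : Fib U W →ₗ[ℝ] Fib U W := (exists_contractEven w).choose

lemma contractEven_mul (w : W) (a b : Fib U W) :
    contractEven w (a * b) = contractEven w a * b + a * contractEven w b :=
  (exists_contractEven w).choose_spec.1 a b

@[simp]
lemma contractEven_genOdd (w : W) (α : Module.Dual ℝ U) : contractEven w (genOdd U W α) = 0 :=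
  (exists_contractEven w).choose_spec.2.1 α

@[simp]
lemma contractEven_genEven (w : W) (β : Module.Dual ℝ W) :
    contractEven w (genEven U W β) = algebraMap ℝ _ (β w) :=
  (exists_contractEven w).choose_spec.2.2 β

variable (U W) in
lemma exists_euler : ∃ D : Fib U W →ₗ[ℝ] Fib U W,
    (∀ a b, D (a * b) = D a * b + a * D b) ∧
      (∀ α, D (genOdd U W α) = genOdd U W α) ∧
      ∀ β, D (genEven U W β) = (2 : ℝ) • genEven U W β :=
  Fib.exists_derivation (AlgHom.id ℝ _) (AlgHom.id ℝ _) (genOdd U W) ((2 : ℝ) • genEven U W)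
    (fun α => by simp [genOdd_mul_self])
    (fun β β' => by simp [genEven_mul_comm β])
    (fun α β => by simp [genEven_mul_comm β, add_comm])

variable (U W) in
/-- The Euler derivation, which counts the degree. -/
def euler : Fib U W →ₗ[ℝ] Fib U W := (exists_euler U W).choose

lemma euler_mul (a b : Fib U W) : euler U W (a * b) = euler U W a * b + a * euler U W b :=
  (exists_euler U W).choose_spec.1 a b

@[simp]
lemma euler_genOdd (α : Module.Dual ℝ U) : euler U W (genOdd U W α) = genOdd U W α :=
  (exists_euler U W).choose_spec.2.1 α

@[simp]
lemma euler_genEven (β : Module.Dual ℝ W) :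
    euler U W (genEven U W β) = (2 : ℝ) • genEven U W β :=
  (exists_euler U W).choose_spec.2.2 β

section

variable {C : Type*} [Ring C] [Algebra ℝ C]

lemma map_one_of_leibniz {A : Type*} [Ring A] [Algebra ℝ A] {D : A →ₗ[ℝ] C} {f g : A →ₐ[ℝ] C}
    (h : ∀ a b, D (a * b) = D a * g b + f a * D b) : D 1 = 0 := by
  have := h 1 1
  simpa using this

end

@[simp]
lemma contractOdd_algebraMap (u : U) (r : ℝ) :
    contractOdd u (algebraMap ℝ (Fib U W) r) = 0 := by
  rw [Algebra.algebraMap_eq_smul_one, map_smul,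
    map_one_of_leibniz (g := AlgHom.id ℝ _) (contractOdd_mul u), smul_zero]

@[simp]
lemma contractEven_algebraMap (w : W) (r : ℝ) :
    contractEven w (algebraMap ℝ (Fib U W) r) = 0 := by
  rw [Algebra.algebraMap_eq_smul_one, map_smul,
    map_one_of_leibniz (g := AlgHom.id ℝ _) (f := AlgHom.id ℝ _) (contractEven_mul w), smul_zero]

@[simp]
lemma euler_algebraMap (r : ℝ) : euler U W (algebraMap ℝ (Fib U W) r) = 0 := by
  rw [Algebra.algebraMap_eq_smul_one, map_smul,
    map_one_of_leibniz (g := AlgHom.id ℝ _) (f := AlgHom.id ℝ _) euler_mul, smul_zero]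

@[simp] lemma contractOdd_one (u : U) : contractOdd u (1 : Fib U W) = 0 := by
  simpa using contractOdd_algebraMap (W := W) u 1

@[simp] lemma contractEven_one (w : W) : contractEven w (1 : Fib U W) = 0 := by
  simpa using contractEven_algebraMap (U := U) w 1

@[simp] lemma euler_one : euler U W 1 = 0 := by
  simpa using euler_algebraMap (U := U) (W := W) 1

/-! ### The grading -/

lemma genOdd_mem (α : Module.Dual ℝ U) : genOdd U W α ∈ fibDegree U W 1 := by
  refine Submodule.mem_iSup_of_mem 1 (Submodule.mem_iSup_of_mem 0
    (Submodule.mem_iSup_of_mem rfl ?_))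
  rw [pow_one, pow_zero, mul_one]
  exact ⟨α, rfl⟩

lemma genEven_mem (β : Module.Dual ℝ W) : genEven U W β ∈ fibDegree U W 2 := by
  refine Submodule.mem_iSup_of_mem 0 (Submodule.mem_iSup_of_mem 1
    (Submodule.mem_iSup_of_mem rfl ?_))
  rw [pow_one, pow_zero, one_mul]
  exact ⟨β, rfl⟩

lemma range_genOdd_mul_fibDegree (k : ℕ) :
    LinearMap.range (genOdd U W) * fibDegree U W k ≤ fibDegree U W (k + 1) := by
  simp only [fibDegree, Submodule.mul_iSup]
  refine iSup_le fun p => iSup_le fun q => iSup_le fun h => ?_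
  refine le_iSup_of_le (p + 1) (le_iSup_of_le q (le_iSup_of_le (by omega) ?_))
  rw [pow_succ', mul_assoc]

lemma range_genEven_mul_comm (N : Submodule ℝ (Fib U W)) :
    LinearMap.range (genEven U W) * N = N * LinearMap.range (genEven U W) := by
  apply le_antisymm
  · refine Submodule.mul_le.2 ?_
    rintro _ ⟨β, rfl⟩ a ha
    rw [genEven_mul_comm]
    exact Submodule.mul_mem_mul ha ⟨β, rfl⟩
  · refine Submodule.mul_le.2 ?_
    rintro a ha _ ⟨β, rfl⟩
    rw [← genEven_mul_comm]
    exact Submodule.mul_mem_mul ⟨β, rfl⟩ ha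

lemma range_genEven_mul_fibDegree (k : ℕ) :
    LinearMap.range (genEven U W) * fibDegree U W k ≤ fibDegree U W (k + 2) := by
  simp only [fibDegree, Submodule.mul_iSup]
  refine iSup_le fun p => iSup_le fun q => iSup_le fun h => ?_
  refine le_iSup_of_le p (le_iSup_of_le (q + 1) (le_iSup_of_le (by omega) ?_))
  rw [pow_succ', ← mul_assoc, range_genEven_mul_comm, mul_assoc]

lemma genOdd_mul_mem (α : Module.Dual ℝ U) {k : ℕ} {a : Fib U W} (ha : a ∈ fibDegree U W k) :
    genOdd U W α * a ∈ fibDegree U W (k + 1) :=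
  range_genOdd_mul_fibDegree k (Submodule.mul_mem_mul ⟨α, rfl⟩ ha)

lemma genEven_mul_mem (β : Module.Dual ℝ W) {k : ℕ} {a : Fib U W} (ha : a ∈ fibDegree U W k) :
    genEven U W β * a ∈ fibDegree U W (k + 2) :=
  range_genEven_mul_fibDegree k (Submodule.mul_mem_mul ⟨β, rfl⟩ ha)

/-- Minimality of the grading: it is the smallest family of submodules that contains `1` in degree 0
and is stable under left multiplication by generators. Statements about homogeneous elements are
proved by this induction, without a basis of the fibre algebra. -/
lemma fibDegree_le {N : ℕ → Submodule ℝ (Fib U W)} (h1 : 1 ∈ N 0)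
    (hO : ∀ k α a, a ∈ N k → genOdd U W α * a ∈ N (k + 1))
    (hE : ∀ k β a, a ∈ N k → genEven U W β * a ∈ N (k + 2)) (k : ℕ) : fibDegree U W k ≤ N k := by
  have hq (q : ℕ) : LinearMap.range (genEven U W) ^ q ≤ N (2 * q) := by
    induction q with
    | zero => rw [pow_zero, Submodule.one_le]; exact h1
    | succ q ih =>
      rw [pow_succ']
      refine Submodule.mul_le.2 ?_
      rintro _ ⟨β, rfl⟩ a ha
      exact hE _ β a (ih ha)
  have hp (p q : ℕ) : LinearMap.range (genOdd U W) ^ p * LinearMap.range (genEven U W) ^ q ≤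
      N (p + 2 * q) := by
    induction p with
    | zero => rw [pow_zero, one_mul, zero_add]; exact hq q
    | succ p ih =>
      rw [pow_succ', mul_assoc]
      refine Submodule.mul_le.2 ?_
      rintro _ ⟨α, rfl⟩ a ha
      have := hO _ α a (ih ha)
      rwa [show p + 1 + 2 * q = p + 2 * q + 1 by omega]
  exact iSup_le fun p => iSup_le fun q => iSup_le fun h => h ▸ hp p q

lemma one_mem_fibDegree : (1 : Fib U W) ∈ fibDegree U W 0 := by
  refine Submodule.mem_iSup_of_mem 0 (Submodule.mem_iSup_of_mem 0
    (Submodule.mem_iSup_of_mem rfl ?_))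
  rw [pow_zero, pow_zero, mul_one]
  exact Submodule.one_le.1 le_rfl

lemma algebraMap_mem_fibDegree (r : ℝ) : algebraMap ℝ (Fib U W) r ∈ fibDegree U W 0 := by
  rw [Algebra.algebraMap_eq_smul_one]
  exact Submodule.smul_mem _ _ one_mem_fibDegree

lemma mul_mem_fibDegree {k l : ℕ} {a b : Fib U W} (ha : a ∈ fibDegree U W k)
    (hb : b ∈ fibDegree U W l) : a * b ∈ fibDegree U W (k + l) := by
  let N : ℕ → Submodule ℝ (Fib U W) := fun k =>
    { carrier := {a | a * b ∈ fibDegree U W (k + l)}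
      add_mem' := fun {a a'} h h' => by
        simp only [Set.mem_ofPred_eq, add_mul] at *
        exact add_mem h h'
      zero_mem' := by simp
      smul_mem' := fun r a h => by
        simp only [Set.mem_ofPred_eq, smul_mul_assoc] at *
        exact Submodule.smul_mem _ _ h }
  refine fibDegree_le (N := N) ?_ (fun k α a h => ?_) (fun k β a h => ?_) k ha
  · change 1 * b ∈ fibDegree U W (0 + l)
    rwa [one_mul, zero_add]
  · change genOdd U W α * a * b ∈ fibDegree U W (k + 1 + l)
    rw [mul_assoc, show k + 1 + l = k + l + 1 by omega]
    exact genOdd_mul_mem α h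
  · change genEven U W β * a * b ∈ fibDegree U W (k + 2 + l)
    rw [mul_assoc, show k + 2 + l = k + l + 2 by omega]
    exact genEven_mul_mem β h

/-- A linear map that commutes with multiplication by generators in a suitable sense is determined
on each homogeneous part. -/
lemma eqOn_fibDegree {C : Type*} [AddCommGroup C] [Module ℝ C] {D D' : ℕ → Fib U W →ₗ[ℝ] C}
    (h1 : D 0 1 = D' 0 1)
    (hO : ∀ k α a, D k a = D' k a → D (k + 1) (genOdd U W α * a) = D' (k + 1) (genOdd U W α * a))
    (hE : ∀ k β a, D k a = D' k a → D (k + 2) (genEven U W β * a) = D' (k + 2) (genEven U W β * a))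
    {k : ℕ} {a : Fib U W} (ha : a ∈ fibDegree U W k) : D k a = D' k a :=
  fibDegree_le (N := fun k => LinearMap.eqLocus (D k) (D' k)) h1 hO hE k ha

lemma euler_eq_smul {k : ℕ} {a : Fib U W} (ha : a ∈ fibDegree U W k) :
    euler U W a = (k : ℝ) • a := by
  refine eqOn_fibDegree (D := fun _ => euler U W) (D' := fun k => (k : ℝ) • LinearMap.id)
    (by simp) (fun k α a h => ?_) (fun k β a h => ?_) ha
  · simp only [LinearMap.smul_apply, LinearMap.id_apply] at h ⊢
    rw [euler_mul, euler_genOdd, h, mul_smul_comm]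
    push_cast
    module
  · simp only [LinearMap.smul_apply, LinearMap.id_apply] at h ⊢
    rw [euler_mul, euler_genEven, h, mul_smul_comm, smul_mul_assoc]
    push_cast
    module

lemma parity_eq_smul {k : ℕ} {a : Fib U W} (ha : a ∈ fibDegree U W k) :
    parity U W a = (-1 : ℝ) ^ k • a := by
  refine eqOn_fibDegree (D := fun _ => (parity U W).toLinearMap)
    (D' := fun k => (-1 : ℝ) ^ k • LinearMap.id)
    (by simp) (fun k α a h => ?_) (fun k β a h => ?_) ha
  · simp only [LinearMap.smul_apply, LinearMap.id_apply, AlgHom.toLinearMap_apply] at h ⊢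
    rw [map_mul, parity_genOdd, h, mul_smul_comm, pow_succ]
    simp
  · simp only [LinearMap.smul_apply, LinearMap.id_apply, AlgHom.toLinearMap_apply] at h ⊢
    rw [map_mul, parity_genEven, h, mul_smul_comm, pow_add]
    simp

lemma mem_iSup_fibDegree (a : Fib U W) : a ∈ ⨆ k, fibDegree U W k := by
  induction a using Fib.induction_left with
  | h1 => exact Submodule.mem_iSup_of_mem 0 one_mem_fibDegree
  | hsmul r a ha => exact Submodule.smul_mem _ r ha
  | hO α a ha =>
    refine Submodule.iSup_induction _ (motive := fun a => genOdd U W α * a ∈ _) ha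
      (fun k a ha => Submodule.mem_iSup_of_mem _ (genOdd_mul_mem α ha)) (by simp)
      (fun a b ha hb => by rw [mul_add]; exact add_mem ha hb)
  | hE α a ha =>
    refine Submodule.iSup_induction _ (motive := fun a => genEven U W α * a ∈ _) ha
      (fun k a ha => Submodule.mem_iSup_of_mem _ (genEven_mul_mem α ha)) (by simp)
      (fun a b ha hb => by rw [mul_add]; exact add_mem ha hb)
  | hadd a b ha hb => exact add_mem ha hb

/-- The parts of degree `j` lie in the eigenspaces of the Euler derivation for `j` and together span
the algebra. Eigenspaces for distinct eigenvalues are independent, so the component of `a` outside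
degree `k` vanishes. Degrees can thus be found from commutators with the Euler derivation. -/
lemma mem_fibDegree_of_euler {k : ℕ} {a : Fib U W} (ha : euler U W a = (k : ℝ) • a) :
    a ∈ fibDegree U W k := by
  have hle (j : ℕ) : fibDegree U W j ≤ Module.End.eigenspace (euler U W) (j : ℝ) := fun b hb =>
    Module.End.mem_eigenspace_iff.2 (euler_eq_smul hb)
  have hind := (Module.End.eigenspaces_iSupIndep (euler U W)).comp
    (f := fun j : ℕ => (j : ℝ)) Nat.cast_injective
  have hk := mem_iSup_fibDegree a
  rw [iSup_split_single _ k] at hk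
  obtain ⟨b, hb, c, hc, rfl⟩ := Submodule.mem_sup.1 hk
  have hb' := hle k hb
  have ha' : b + c ∈ Module.End.eigenspace (euler U W) (k : ℝ) :=
    Module.End.mem_eigenspace_iff.2 ha
  have hc1 : c ∈ Module.End.eigenspace (euler U W) (k : ℝ) := by
    simpa using sub_mem ha' hb'
  have hc2 : c ∈ ⨆ (j : ℕ) (_ : j ≠ k), Module.End.eigenspace (euler U W) (j : ℝ) :=
    (iSup₂_mono fun j _ => hle j) hc
  have : c = 0 := by
    have h := hind k
    rw [Function.comp_def] at h
    exact Submodule.disjoint_def.1 h c hc1 hc2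
  rwa [this, add_zero]

lemma mem_fibDegree_zero_iff {a : Fib U W} :
    a ∈ fibDegree U W 0 ↔ ∃ r, a = algebraMap ℝ _ r := by
  refine ⟨fun h => ?_, ?_⟩
  -- Generators have positive degree, so only degree 0 matters: the family consists of the scalars
  -- there and of everything in the other degrees.
  · have := fibDegree_le (N := fun k => if k = 0 then LinearMap.range (Algebra.linearMap ℝ _)
      else ⊤) (U := U) (W := W) (by simpa using ⟨1, by simp⟩) (by simp) (by simp) 0 h
    simp only [if_true] at this
    obtain ⟨r, rfl⟩ := this
    exact ⟨r, rfl⟩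
  · rintro ⟨r, rfl⟩
    exact algebraMap_mem_fibDegree r

end FibreAlgebra

/-! ### Contractions and evaluation on the fibre algebra -/

section FibreContraction

variable {U W : Type*} [AddCommGroup U] [Module ℝ U] [AddCommGroup W] [Module ℝ W]

/-! ### Contractions -/

@[simp]
lemma contractOdd_genOdd_mul (u : U) (α : Module.Dual ℝ U) (a : Fib U W) :
    contractOdd u (genOdd U W α * a) = α u • a - genOdd U W α * contractOdd u a := by
  rw [contractOdd_mul, contractOdd_genOdd, parity_genOdd, ← Algebra.smul_def, neg_mul,
    sub_eq_add_neg]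

@[simp]
lemma contractOdd_genEven_mul (u : U) (β : Module.Dual ℝ W) (a : Fib U W) :
    contractOdd u (genEven U W β * a) = genEven U W β * contractOdd u a := by
  rw [contractOdd_mul, contractOdd_genEven, parity_genEven, zero_mul, zero_add]

@[simp]
lemma contractEven_genOdd_mul (w : W) (α : Module.Dual ℝ U) (a : Fib U W) :
    contractEven w (genOdd U W α * a) = genOdd U W α * contractEven w a := by
  rw [contractEven_mul, contractEven_genOdd, zero_mul, zero_add]

@[simp]
lemma contractEven_genEven_mul (w : W) (β : Module.Dual ℝ W) (a : Fib U W) :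
    contractEven w (genEven U W β * a) = β w • a + genEven U W β * contractEven w a := by
  rw [contractEven_mul, contractEven_genEven, ← Algebra.smul_def]

/-- Two linear maps on `Λ(U*) ⊗ S(W*)` agree if they agree at `1` and agreement is preserved by
left multiplication with generators. -/
lemma Fib.linearMap_ext {C : Type*} [AddCommGroup C] [Module ℝ C] {D D' : Fib U W →ₗ[ℝ] C}
    (h1 : D 1 = D' 1)
    (hO : ∀ α a, D a = D' a → D (genOdd U W α * a) = D' (genOdd U W α * a))
    (hE : ∀ β a, D a = D' a → D (genEven U W β * a) = D' (genEven U W β * a)) : D = D' := by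
  ext a
  induction a using Fib.induction_left with
  | h1 => exact h1
  | hsmul r a ha => rw [map_smul, map_smul, ha]
  | hO α a ha => exact hO α a ha
  | hE β a ha => exact hE β a ha
  | hadd a b ha hb => rw [map_add, map_add, ha, hb]

lemma contractOdd_add (u u' : U) :
    (contractOdd (u + u') : Fib U W →ₗ[ℝ] Fib U W) = contractOdd u + contractOdd u' := by
  refine Fib.linearMap_ext (by simp) (fun α a h => ?_) (fun β a h => ?_)
  · simp only [LinearMap.add_apply] at h ⊢
    simp only [contractOdd_genOdd_mul, h, mul_add, map_add, add_smul]
    abel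
  · simp only [LinearMap.add_apply] at h ⊢
    simp only [contractOdd_genEven_mul, h, mul_add]

lemma contractOdd_smul (r : ℝ) (u : U) :
    (contractOdd (r • u) : Fib U W →ₗ[ℝ] Fib U W) = r • contractOdd u := by
  refine Fib.linearMap_ext (by simp) (fun α a h => ?_) (fun β a h => ?_)
  · simp only [LinearMap.smul_apply] at h ⊢
    simp only [contractOdd_genOdd_mul, h, map_smul, smul_eq_mul, smul_sub, mul_smul, mul_smul_comm]
  · simp only [LinearMap.smul_apply] at h ⊢
    simp only [contractOdd_genEven_mul, h, mul_smul_comm]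

lemma contractEven_add (w w' : W) :
    (contractEven (w + w') : Fib U W →ₗ[ℝ] Fib U W) = contractEven w + contractEven w' := by
  refine Fib.linearMap_ext (by simp) (fun α a h => ?_) (fun β a h => ?_)
  · simp only [LinearMap.add_apply] at h ⊢
    simp only [contractEven_genOdd_mul, h, mul_add]
  · simp only [LinearMap.add_apply] at h ⊢
    simp only [contractEven_genEven_mul, h, mul_add, map_add, add_smul]
    abel

lemma contractEven_smul (r : ℝ) (w : W) :
    (contractEven (r • w) : Fib U W →ₗ[ℝ] Fib U W) = r • contractEven w := by
  refine Fib.linearMap_ext (by simp) (fun α a h => ?_) (fun β a h => ?_)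
  · simp only [LinearMap.smul_apply] at h ⊢
    simp only [contractEven_genOdd_mul, h, mul_smul_comm]
  · simp only [LinearMap.smul_apply] at h ⊢
    simp only [contractEven_genEven_mul, h, map_smul, smul_eq_mul, smul_add, mul_smul,
      mul_smul_comm]

lemma contractOdd_comm (u u' : U) (a : Fib U W) :
    contractOdd u (contractOdd u' a) = -contractOdd u' (contractOdd u a) := by
  have : contractOdd u ∘ₗ contractOdd u' =
      -(contractOdd u' ∘ₗ contractOdd u : Fib U W →ₗ[ℝ] Fib U W) := by
    refine Fib.linearMap_ext (by simp) (fun α a h => ?_) (fun β a h => ?_)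
    · simp only [LinearMap.neg_apply, LinearMap.comp_apply] at h ⊢
      simp only [contractOdd_genOdd_mul, map_sub, map_smul, h, mul_neg]
      abel
    · simp only [LinearMap.neg_apply, LinearMap.comp_apply] at h ⊢
      simp only [contractOdd_genEven_mul, h, mul_neg]
  exact DFunLike.congr_fun this a

lemma contractOdd_self (u : U) (a : Fib U W) : contractOdd u (contractOdd u a) = 0 := by
  have h := contractOdd_comm u u a
  have h2 : (2 : ℝ) • contractOdd u (contractOdd u a) = 0 := by
    rw [two_smul]
    exact add_eq_zero_iff_eq_neg.2 h
  exact (smul_eq_zero.1 h2).resolve_left two_ne_zero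

lemma contractEven_contractOdd (u : U) (w : W) (a : Fib U W) :
    contractEven w (contractOdd u a) = contractOdd u (contractEven w a) := by
  have : contractEven w ∘ₗ contractOdd u =
      (contractOdd u ∘ₗ contractEven w : Fib U W →ₗ[ℝ] Fib U W) := by
    refine Fib.linearMap_ext (by simp) (fun α a h => ?_) (fun β a h => ?_)
    · simp only [LinearMap.comp_apply] at h ⊢
      simp only [contractOdd_genOdd_mul, contractEven_genOdd_mul, map_sub, map_smul, h]
    · simp only [LinearMap.comp_apply] at h ⊢
      simp only [contractOdd_genEven_mul, contractEven_genEven_mul, map_add, map_smul, h]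
  exact DFunLike.congr_fun this a

lemma parity_contractOdd (u : U) (a : Fib U W) :
    parity U W (contractOdd u a) = -contractOdd u (parity U W a) := by
  have : (parity U W).toLinearMap ∘ₗ contractOdd u =
      -(contractOdd u ∘ₗ (parity U W).toLinearMap) := by
    refine Fib.linearMap_ext (by simp) (fun α a h => ?_) (fun β a h => ?_)
    · simp only [LinearMap.neg_apply, LinearMap.comp_apply, AlgHom.toLinearMap_apply] at h ⊢
      simp only [contractOdd_genOdd_mul, map_sub, map_smul, map_mul, h, parity_genOdd, neg_mul,
        map_neg, mul_neg]
      abel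
    · simp only [LinearMap.neg_apply, LinearMap.comp_apply, AlgHom.toLinearMap_apply] at h ⊢
      simp only [contractOdd_genEven_mul, map_mul, h, parity_genEven, mul_neg]
  exact DFunLike.congr_fun this a

lemma parity_contractEven (w : W) (a : Fib U W) :
    parity U W (contractEven w a) = contractEven w (parity U W a) := by
  have : (parity U W).toLinearMap ∘ₗ contractEven w =
      contractEven w ∘ₗ (parity U W).toLinearMap := by
    refine Fib.linearMap_ext (by simp) (fun α a h => ?_) (fun β a h => ?_)
    · simp only [LinearMap.comp_apply, AlgHom.toLinearMap_apply] at h ⊢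
      simp only [contractEven_genOdd_mul, map_mul, h, parity_genOdd, neg_mul, map_neg]
    · simp only [LinearMap.comp_apply, AlgHom.toLinearMap_apply] at h ⊢
      simp only [contractEven_genEven_mul, map_add, map_smul, map_mul, h, parity_genEven]
  exact DFunLike.congr_fun this a

lemma parity_euler (a : Fib U W) :
    parity U W (euler U W a) = euler U W (parity U W a) := by
  have : (parity U W).toLinearMap ∘ₗ euler U W = euler U W ∘ₗ (parity U W).toLinearMap := by
    refine Fib.linearMap_ext (by simp) (fun α a h => ?_) (fun β a h => ?_)
    · simp only [LinearMap.comp_apply, AlgHom.toLinearMap_apply] at h ⊢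
      simp only [euler_mul, map_add, map_mul, h, euler_genOdd, parity_genOdd, map_neg]
    · simp only [LinearMap.comp_apply, AlgHom.toLinearMap_apply] at h ⊢
      simp only [euler_mul, map_add, map_mul, h, euler_genEven, parity_genEven, map_smul]
  exact DFunLike.congr_fun this a

lemma euler_contractOdd (u : U) (a : Fib U W) :
    euler U W (contractOdd u a) = contractOdd u (euler U W a) - contractOdd u a := by
  have : euler U W ∘ₗ contractOdd u = contractOdd u ∘ₗ euler U W - contractOdd u := by
    refine Fib.linearMap_ext (by simp) (fun α a h => ?_) (fun β a h => ?_)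
    · simp only [LinearMap.comp_apply, LinearMap.sub_apply] at h ⊢
      simp only [contractOdd_genOdd_mul, euler_mul, map_sub, map_smul, map_add, h, euler_genOdd,
        mul_sub]
      abel
    · simp only [LinearMap.comp_apply, LinearMap.sub_apply] at h ⊢
      simp only [contractOdd_genEven_mul, euler_mul, map_add, map_smul, h, euler_genEven, mul_sub,
        smul_mul_assoc]
      abel
  exact DFunLike.congr_fun this a

lemma euler_contractEven (w : W) (a : Fib U W) :
    euler U W (contractEven w a) =
      contractEven w (euler U W a) - (2 : ℝ) • contractEven w a := by
  have : euler U W ∘ₗ contractEven w =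
      contractEven w ∘ₗ euler U W - (2 : ℝ) • contractEven w := by
    refine Fib.linearMap_ext (by simp) (fun α a h => ?_) (fun β a h => ?_)
    · simp only [LinearMap.comp_apply, LinearMap.sub_apply, LinearMap.smul_apply] at h ⊢
      simp only [contractEven_genOdd_mul, euler_mul, map_add, h, euler_genOdd, mul_sub,
        mul_smul_comm]
      abel
    · simp only [LinearMap.comp_apply, LinearMap.sub_apply, LinearMap.smul_apply] at h ⊢
      simp only [contractEven_genEven_mul, euler_mul, map_add, map_smul, h, euler_genEven, mul_sub,
        smul_mul_assoc, mul_smul_comm]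
      module
  exact DFunLike.congr_fun this a

/-- The commutator with the Euler derivation is `-contractOdd u`, which lowers the eigenvalue by
one. -/
lemma contractOdd_mem (u : U) {k : ℕ} {a : Fib U W} (ha : a ∈ fibDegree U W (k + 1)) :
    contractOdd u a ∈ fibDegree U W k := by
  refine mem_fibDegree_of_euler ?_
  rw [euler_contractOdd, euler_eq_smul ha, map_smul]
  push_cast
  module

lemma contractEven_mem (w : W) {k : ℕ} {a : Fib U W} (ha : a ∈ fibDegree U W (k + 2)) :
    contractEven w a ∈ fibDegree U W k := by
  refine mem_fibDegree_of_euler ?_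
  rw [euler_contractEven, euler_eq_smul ha, map_smul]
  push_cast
  module

lemma contractOdd_eq_zero (u : U) {a : Fib U W} (ha : a ∈ fibDegree U W 0) :
    contractOdd u a = 0 := by
  obtain ⟨r, rfl⟩ := mem_fibDegree_zero_iff.1 ha
  simp

lemma exists_eq_genOdd {a : Fib U W} (ha : a ∈ fibDegree U W 1) : ∃ α, a = genOdd U W α := by
  -- Degree 1 is reached from degree 0 by odd generators only, so everything above degree 1 may be
  -- left unconstrained.
  have := fibDegree_le (N := fun k => match k with
      | 0 => LinearMap.range (Algebra.linearMap ℝ (Fib U W))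
      | 1 => LinearMap.range (genOdd U W)
      | _ => ⊤) ⟨1, by simp⟩ (fun k α a h => ?_) (fun k β a h => trivial) 1 ha
  · obtain ⟨α, rfl⟩ := this
    exact ⟨α, rfl⟩
  · match k with
    | 0 =>
      obtain ⟨r, rfl⟩ := h
      refine ⟨r • α, ?_⟩
      rw [map_smul, Algebra.smul_def, Algebra.linearMap_apply, Algebra.commutes]
    | k + 1 => trivial

lemma contractEven_eq_zero_of_mem_one (w : W) {a : Fib U W} (ha : a ∈ fibDegree U W 1) :
    contractEven w a = 0 := by
  obtain ⟨α, rfl⟩ := exists_eq_genOdd ha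
  simp

/-- The Euler derivation in terms of contractions. -/
lemma euler_eq_sum {ι κ : Type*} [Fintype ι] [Fintype κ] {e : ι → U} {ξ : ι → Module.Dual ℝ U}
    {b : κ → W} {η : κ → Module.Dual ℝ W} (he : ∀ u, ∑ i, ξ i u • e i = u)
    (hb : ∀ w, ∑ j, η j w • b j = w) (a : Fib U W) :
    euler U W a = ∑ i, genOdd U W (ξ i) * contractOdd (e i) a +
      (2 : ℝ) • ∑ j, genEven U W (η j) * contractEven (b j) a := by
  have he' (α : Module.Dual ℝ U) : ∑ i, α (e i) • ξ i = α := by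
    ext u
    conv_rhs => rw [← he u]
    simp [mul_comm]
  have hb' (β : Module.Dual ℝ W) : ∑ j, β (b j) • η j = β := by
    ext w
    conv_rhs => rw [← hb w]
    simp [mul_comm]
  induction a using Fib.induction_left with
  | h1 => simp
  | hsmul r a ha =>
    rw [map_smul, ha]
    simp only [map_smul, mul_smul_comm, ← Finset.smul_sum, smul_add]
    rw [smul_comm]
  | hadd a b ha hb =>
    rw [map_add, ha, hb]
    simp only [map_add, mul_add, Finset.sum_add_distrib, smul_add]
    abel
  | hO α a ha =>
    rw [euler_mul, ha, euler_genOdd]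
    -- Only the `α` of the first summand is expanded in the dual family: on the other side,
    -- contracting `α` with `e i` produces precisely the terms `α(e i) ξ i`.
    conv_lhs => enter [1]; rw [← he' α]
    simp only [contractOdd_genOdd_mul, contractEven_genOdd_mul, mul_sub, mul_smul_comm,
      Finset.sum_sub_distrib, map_sum, map_smul, Finset.sum_mul, smul_mul_assoc, mul_add,
      Finset.mul_sum]
    have h1 (i : ι) : genOdd U W (ξ i) * (genOdd U W α * contractOdd (e i) a) =
        -(genOdd U W α * (genOdd U W (ξ i) * contractOdd (e i) a)) := by
      rw [← mul_assoc, genOdd_mul_genOdd, neg_mul, mul_assoc]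
    have h2 (j : κ) : genEven U W (η j) * (genOdd U W α * contractEven (b j) a) =
        genOdd U W α * (genEven U W (η j) * contractEven (b j) a) := by
      rw [← mul_assoc, genEven_mul_comm, mul_assoc]
    simp only [h1, h2, Finset.sum_neg_distrib]
    abel
  | hE β a ha =>
    rw [euler_mul, ha, euler_genEven]
    conv_lhs => enter [1]; rw [← hb' β]
    simp only [contractOdd_genEven_mul, contractEven_genEven_mul, mul_smul_comm,
      Finset.sum_add_distrib, map_sum, map_smul, Finset.sum_mul, smul_mul_assoc, mul_add,
      Finset.mul_sum, smul_add]
    have h1 (i : ι) : genOdd U W (ξ i) * (genEven U W β * contractOdd (e i) a) =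
        genEven U W β * (genOdd U W (ξ i) * contractOdd (e i) a) := by
      rw [← mul_assoc, ← genEven_mul_comm, mul_assoc]
    have h2 (j : κ) : genEven U W (η j) * (genEven U W β * contractEven (b j) a) =
        genEven U W β * (genEven U W (η j) * contractEven (b j) a) := by
      rw [← mul_assoc, ← genEven_mul_comm, mul_assoc]
    simp only [h1, h2]
    abel

lemma exists_dual_family (U : Type*) [AddCommGroup U] [Module ℝ U] [FiniteDimensional ℝ U] :
    ∃ (n : ℕ) (e : Fin n → U) (ξ : Fin n → Module.Dual ℝ U), ∀ u, ∑ i, ξ i u • e i = u :=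
  ⟨_, Module.finBasis ℝ U, (Module.finBasis ℝ U).coord, fun u => (Module.finBasis ℝ U).sum_repr u⟩

section Finite

variable [FiniteDimensional ℝ U] [FiniteDimensional ℝ W]

/-- A function of positive degree vanishes if all its contractions vanish. -/
lemma eq_zero_of_contract {k : ℕ} (hk : k ≠ 0) {a : Fib U W} (ha : a ∈ fibDegree U W k)
    (hO : ∀ u, contractOdd u a = 0) (hE : ∀ w, contractEven w a = 0) : a = 0 := by
  obtain ⟨n, e, ξ, he⟩ := exists_dual_family U
  obtain ⟨m, b, η, hb⟩ := exists_dual_family W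
  have h := euler_eq_sum he hb a
  rw [euler_eq_smul ha] at h
  simp only [hO, hE, mul_zero, Finset.sum_const_zero, smul_zero, add_zero] at h
  exact (smul_eq_zero.1 h).resolve_left (Nat.cast_ne_zero.2 hk)

end Finite

/-! ### Evaluation -/

@[simp]
lemma evalEven_genOdd (w : W) (α : Module.Dual ℝ U) :
    evalEven w (genOdd U W α) = ExteriorAlgebra.ι ℝ α := by
  refine (congrArg (Algebra.TensorProduct.rid ℝ ℝ _)
    (Algebra.TensorProduct.map_tmul _ _ _ _)).trans ?_
  rw [map_one]
  exact (Algebra.TensorProduct.rid_tmul ℝ _ _).trans (one_smul _ _)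

@[simp]
lemma evalEven_genEven (w : W) (β : Module.Dual ℝ W) :
    evalEven w (genEven U W β) = algebraMap ℝ _ (β w) := by
  refine (congrArg (Algebra.TensorProduct.rid ℝ ℝ _)
    (Algebra.TensorProduct.map_tmul _ _ _ _)).trans ?_
  rw [map_one, SymmetricAlgebra.lift_ι_apply]
  exact (Algebra.TensorProduct.rid_tmul ℝ _ _).trans (Algebra.algebraMap_eq_smul_one _).symm

lemma interiorProd_ι_mul (u : U) (α : Module.Dual ℝ U)
    (x : ExteriorAlgebra ℝ (Module.Dual ℝ U)) :
    interiorProd u (ExteriorAlgebra.ι ℝ α * x) =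
      α u • x - ExteriorAlgebra.ι ℝ α * interiorProd u x :=
  CliffordAlgebra.contractLeft_ι_mul _ _ _

lemma interiorProd_evalEven (u : U) (w : W) (a : Fib U W) :
    interiorProd u (evalEven w a) = evalEven w (contractOdd u a) := by
  have : interiorProd u ∘ₗ (evalEven w).toLinearMap =
      (evalEven w).toLinearMap ∘ₗ (contractOdd u : Fib U W →ₗ[ℝ] Fib U W) := by
    refine Fib.linearMap_ext ?_ (fun α a h => ?_) (fun β a h => ?_)
    · simp only [LinearMap.comp_apply, AlgHom.toLinearMap_apply, contractOdd_one, map_one, map_zero]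
      exact CliffordAlgebra.contractLeft_one (Q := (0 : QuadraticForm ℝ (Module.Dual ℝ U))) _
    · simp only [LinearMap.comp_apply, AlgHom.toLinearMap_apply] at h ⊢
      simp only [contractOdd_genOdd_mul, map_mul, evalEven_genOdd, interiorProd_ι_mul, h, map_sub,
        map_smul]
    · simp only [LinearMap.comp_apply, AlgHom.toLinearMap_apply] at h ⊢
      simp only [contractOdd_genEven_mul, map_mul, evalEven_genEven, h, ← Algebra.smul_def,
        map_smul]
  exact DFunLike.congr_fun this a

@[simp]
lemma body_ι (α : Module.Dual ℝ U) : body (ExteriorAlgebra.ι ℝ α) = 0 := by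
  have : body (ExteriorAlgebra.ι ℝ α) = (0 : Module.Dual ℝ (Module.Dual ℝ U)) α :=
    ExteriorAlgebra.lift_ι_apply ℝ (0 : Module.Dual ℝ U →ₗ[ℝ] ℝ) (by simp) α
  simpa using this

variable (U W) in
/-- The component in `Λ⁰ ⊗ S⁰ = ℝ`. -/
def scalarPart : Fib U W →ₐ[ℝ] ℝ := body.comp (evalEven 0)

@[simp]
lemma scalarPart_genOdd (α : Module.Dual ℝ U) : scalarPart U W (genOdd U W α) = 0 := by
  simp [scalarPart]

@[simp]
lemma scalarPart_genEven (β : Module.Dual ℝ W) : scalarPart U W (genEven U W β) = 0 := by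
  simp [scalarPart]

lemma algebraMap_scalarPart {a : Fib U W} (ha : a ∈ fibDegree U W 0) :
    algebraMap ℝ _ (scalarPart U W a) = a := by
  obtain ⟨r, rfl⟩ := mem_fibDegree_zero_iff.1 ha
  simp

lemma body_evalEven_of_mem_zero (w : W) {a : Fib U W} (ha : a ∈ fibDegree U W 0) :
    body (evalEven w a) = scalarPart U W a := by
  obtain ⟨r, rfl⟩ := mem_fibDegree_zero_iff.1 ha
  simp

lemma body_interiorProd_evalEven (u : U) (w : W) {a : Fib U W} (ha : a ∈ fibDegree U W 1) :
    body (interiorProd u (evalEven w a)) = scalarPart U W (contractOdd u a) := by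
  rw [interiorProd_evalEven, body_evalEven_of_mem_zero _ (contractOdd_mem u ha)]

lemma body_interiorProd_interiorProd_evalEven (u u' : U) (w : W) {a : Fib U W}
    (ha : a ∈ fibDegree U W 2) :
    body (interiorProd u (interiorProd u' (evalEven w a))) =
      scalarPart U W (contractOdd u (contractOdd u' a)) := by
  rw [interiorProd_evalEven,
    body_interiorProd_evalEven _ _ (contractOdd_mem u' ha)]

/-- An element of degree 2 is quadratic in the odd and linear in the even generators. The body kills
the first part, and on a linear part the value at `w` is the derivative in the direction `w`. From
degree 4 on this fails, because higher powers of even generators occur. -/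
lemma body_evalEven_of_mem_two (w : W) {a : Fib U W} (ha : a ∈ fibDegree U W 2) :
    body (evalEven w a) = scalarPart U W (contractEven w a) := by
  have h := fibDegree_le (U := U) (W := W) (N := fun k => match k with
      | 0 => LinearMap.range (Algebra.linearMap ℝ (Fib U W))
      | 1 => LinearMap.range (genOdd U W)
      | 2 => LinearMap.eqLocus (body.toLinearMap ∘ₗ (evalEven w).toLinearMap)
        ((scalarPart U W).toLinearMap ∘ₗ contractEven w)
      | _ => ⊤) ⟨1, by simp⟩ (fun k α a h => ?_) (fun k β a h => ?_) 2 ha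
  · exact h
  · match k with
    | 0 =>
      obtain ⟨r, rfl⟩ := h
      refine ⟨r • α, ?_⟩
      rw [map_smul, Algebra.smul_def, Algebra.linearMap_apply, Algebra.commutes]
    | 1 =>
      obtain ⟨α', rfl⟩ := h
      change body (evalEven w _) = scalarPart U W (contractEven w _)
      simp
    | k + 2 => trivial
  · match k with
    | 0 =>
      obtain ⟨r, rfl⟩ := h
      change body (evalEven w _) = scalarPart U W (contractEven w _)
      simp [mul_comm]
    | k + 1 => trivial

lemma body_interiorProd_evalEven_of_mem_three (u : U) (w : W) {a : Fib U W}
    (ha : a ∈ fibDegree U W 3) : body (interiorProd u (evalEven w a)) =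
      scalarPart U W (contractEven w (contractOdd u a)) := by
  rw [interiorProd_evalEven, body_evalEven_of_mem_two w (contractOdd_mem u ha)]

/-- Degree 3 consists of `Λ³` and `Λ¹ ⊗ S¹`. Evaluation at 0 kills the second summand, and so do two
odd contractions, while both are faithful on `Λ³`. This gives the anomaly in terms of contractions.
-/
lemma evalEven_zero_eq_zero_iff [FiniteDimensional ℝ U] [FiniteDimensional ℝ W] {a : Fib U W}
    (ha : a ∈ fibDegree U W 3) :
    evalEven (0 : W) a = 0 ↔ ∀ u u', contractOdd u (contractOdd u' a) = 0 := by
  constructor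
  · intro h u u'
    have hm := contractOdd_mem u (contractOdd_mem u' ha)
    refine eq_zero_of_contract one_ne_zero hm (fun v => ?_)
      (fun w => contractEven_eq_zero_of_mem_one w hm)
    rw [← algebraMap_scalarPart (contractOdd_mem v hm), ← body_interiorProd_evalEven v 0 hm,
      ← interiorProd_evalEven, ← interiorProd_evalEven, h]
    simp
  · intro h
    obtain ⟨n, e, ξ, he⟩ := exists_dual_family U
    obtain ⟨m, b, η, hb⟩ := exists_dual_family W
    -- At `w = 0` the even terms of the Euler formula drop out, so the evaluation is recovered from
    -- the odd contractions alone.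
    have key {k : ℕ} (hk : k ≠ 0) {a : Fib U W} (ha : a ∈ fibDegree U W k)
        (h : ∀ u, evalEven (0 : W) (contractOdd u a) = 0) : evalEven (0 : W) a = 0 := by
      have h' := congrArg (evalEven (0 : W)) (euler_eq_sum he hb a)
      rw [euler_eq_smul ha] at h'
      simp only [map_smul, map_add, map_sum, map_mul, h, evalEven_genEven, map_zero, mul_zero,
        zero_mul, Finset.sum_const_zero, smul_zero, add_zero] at h'
      exact (smul_eq_zero.1 h').resolve_left (Nat.cast_ne_zero.2 hk)
    refine key three_ne_zero ha fun u' => key two_ne_zero (contractOdd_mem u' ha) fun u => ?_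
    rw [h, map_zero]

end FibreContraction

/-! ### Sections, bump functions, dual frames and tensoriality -/

section Geometry

variable {B : Type*} [NormedAddCommGroup B] [NormedSpace ℝ B]
  {M : Type*} [TopologicalSpace M] [ChartedSpace B M]
  {F : Type*} [NormedAddCommGroup F] [NormedSpace ℝ F]
  {E : M → Type*} [TopologicalSpace (TotalSpace F E)] [∀ x, TopologicalSpace (E x)]
  [∀ x, AddCommGroup (E x)] [∀ x, Module ℝ (E x)] [FiberBundle F E]

/-! ### Sections of the dual bundle -/

@[ext]
lemma DualSec.ext {α α' : DualSec B F E} (h : ∀ x, α.toFun x = α'.toFun x) : α = α' := by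
  cases α
  cases α'
  congr
  exact funext h

@[simp]
lemma DualSec.pair_apply (α : DualSec B F E) (ψ : Sec B F E) (x : M) :
    α.pair ψ x = α.toFun x (ψ x) := rfl

@[simp]
lemma smulSec_apply [VectorBundle ℝ F E] (f : Fn B M) (ψ : Sec B F E) (x : M) :
    smulSec f ψ x = f x • ψ x := rfl

instance : Zero (DualSec B F E) := ⟨⟨fun _ => 0, contMDiff_const⟩⟩

instance : Add (DualSec B F E) :=
  ⟨fun α α' => ⟨fun x => α.toFun x + α'.toFun x, α.smooth.add α'.smooth⟩⟩

@[simp]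
lemma DualSec.zero_toFun (x : M) : (0 : DualSec B F E).toFun x = 0 := rfl

@[simp]
lemma DualSec.add_toFun (α α' : DualSec B F E) (x : M) :
    (α + α').toFun x = α.toFun x + α'.toFun x := rfl

instance : AddCommMonoid (DualSec B F E) where
  add_assoc _ _ _ := DualSec.ext fun _ => add_assoc _ _ _
  zero_add _ := DualSec.ext fun _ => zero_add _
  add_zero _ := DualSec.ext fun _ => add_zero _
  add_comm _ _ := DualSec.ext fun _ => add_comm _ _
  nsmul := nsmulRec

@[simp]
lemma DualSec.sum_toFun {ι : Type*} (s : Finset ι) (α : ι → DualSec B F E) (x : M) :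
    (∑ i ∈ s, α i).toFun x = ∑ i ∈ s, (α i).toFun x := by
  classical
  induction s using Finset.induction_on with
  | empty => simp
  | insert a s ha ih => rw [Finset.sum_insert ha, Finset.sum_insert ha, DualSec.add_toFun, ih]

/-- The product of a function and a section of the dual bundle. -/
def DualSec.smul (f : Fn B M) (α : DualSec B F E) : DualSec B F E :=
  ⟨fun x => f x • α.toFun x, (f.contMDiff.comp (contMDiff_proj E)).mul α.smooth⟩

@[simp]
lemma DualSec.smul_toFun (f : Fn B M) (α : DualSec B F E) (x : M) :
    (DualSec.smul f α).toFun x = f x • α.toFun x := rfl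

@[simp]
lemma Sec.sum_apply [VectorBundle ℝ F E] {ι : Type*} (s : Finset ι) (ψ : ι → Sec B F E) (x : M) :
    (∑ i ∈ s, ψ i) x = ∑ i ∈ s, ψ i x := by
  classical
  induction s using Finset.induction_on with
  | empty => simp
  | insert a s ha ih =>
    rw [Finset.sum_insert ha, Finset.sum_insert ha, ContMDiffSection.coe_add, Pi.add_apply, ih]

section Sum

variable {F' : Type*} [NormedAddCommGroup F'] [NormedSpace ℝ F']
  {E' : M → Type*} [TopologicalSpace (TotalSpace F' E')] [∀ x, TopologicalSpace (E' x)]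
  [∀ x, AddCommGroup (E' x)] [∀ x, Module ℝ (E' x)] [FiberBundle F' E'] [VectorBundle ℝ F' E']
  [IsManifold 𝓘(ℝ, B) ∞ M] [ContMDiffVectorBundle ∞ F' E' 𝓘(ℝ, B)]

/-- This is the local form of a bundle map: `α i` is the dual frame of the source and `s i` are the
images of the frame. -/
lemma contMDiffAt_sum_smul {ι : Type*} [Fintype ι] (α : ι → DualSec B F E) (s : ι → Sec B F' E')
    (p : TotalSpace F E) : ContMDiffAt (𝓘(ℝ, B).prod 𝓘(ℝ, F)) (𝓘(ℝ, B).prod 𝓘(ℝ, F')) ∞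
      (fun p : TotalSpace F E =>
        (⟨p.1, ∑ i, (α i).toFun p.1 p.2 • s i p.1⟩ : TotalSpace F' E')) p := by
  let t := trivializationAt F' E' p.1
  refine contMDiffAt_totalSpace.2 ⟨contMDiffAt_proj E, ?_⟩
  have h (i) : ContMDiffAt (𝓘(ℝ, B).prod 𝓘(ℝ, F)) 𝓘(ℝ, F') ∞
      (fun q : TotalSpace F E => (α i).toFun q.1 q.2 • (t ⟨q.1, s i q.1⟩).2) p := by
    refine (α i).smooth.contMDiffAt.smul ?_
    exact ((contMDiffAt_section p.1).1 ((s i).contMDiff p.1)).comp p (contMDiffAt_proj E)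
  have h' := ContMDiffAt.sum (t := Finset.univ) fun i _ => h i
  refine h'.congr_of_eventuallyEq ?_
  have hb : ∀ᶠ q in 𝓝 p, q.1 ∈ t.baseSet :=
    (FiberBundle.continuous_proj F E).continuousAt.preimage_mem_nhds
      (t.open_baseSet.mem_nhds (FiberBundle.mem_baseSet_trivializationAt' p.1))
  filter_upwards [hb] with q hq
  have hl (v : E' q.1) : (t ⟨q.1, v⟩).2 = t.linearMapAt ℝ q.1 v :=
    (congrFun (t.coe_linearMapAt_of_mem hq) v).symm
  simp only [hl]
  refine (hl _).trans ?_
  rw [map_sum]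
  simp only [map_smul]

end Sum

section Bump

variable [FiniteDimensional ℝ B] [T2Space M] [IsManifold 𝓘(ℝ, B) ∞ M]

variable (B) in
lemma exists_bump {x₀ : M} {s : Set M} (hs : s ∈ 𝓝 x₀) :
    ∃ χ : Fn B M, (∀ᶠ x in 𝓝 x₀, χ x = 1) ∧ tsupport χ ⊆ s := by
  obtain ⟨f, -, hf⟩ := (SmoothBumpFunction.nhds_basis_tsupport
    (I := 𝓘(ℝ, B)) x₀).mem_iff.1 hs
  exact ⟨⟨f, f.contMDiff⟩, f.eventuallyEq_one, hf⟩

lemma exists_sec_eventuallyEq [VectorBundle ℝ F E] {s : ∀ x, E x} {u : Set M} (hu : IsOpen u)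
    (hs : ContMDiffOn 𝓘(ℝ, B) (𝓘(ℝ, B).prod 𝓘(ℝ, F)) ∞
      (fun x => (⟨x, s x⟩ : TotalSpace F E)) u) {x₀ : M} (hx : x₀ ∈ u) :
    ∃ ψ : Sec B F E, ∀ᶠ x in 𝓝 x₀, ψ x = s x := by
  obtain ⟨χ, h1, h2⟩ := exists_bump B (hu.mem_nhds hx)
  refine ⟨⟨fun x => χ x • s x,
    ContMDiffOn.smul_section_of_tsupport χ.contMDiff.contMDiffOn hu h2 hs⟩, ?_⟩
  filter_upwards [h1] with x hx
  change χ x • s x = s x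
  rw [hx, one_smul]

lemma exists_dualSec_eventuallyEq {s : ∀ x, Module.Dual ℝ (E x)} {u : Set M} (hu : IsOpen u)
    (hs : ContMDiffOn (𝓘(ℝ, B).prod 𝓘(ℝ, F)) 𝓘(ℝ, ℝ) ∞
      (fun p : TotalSpace F E => s p.1 p.2) (π F E ⁻¹' u)) {x₀ : M} (hx : x₀ ∈ u) :
    ∃ α : DualSec B F E, ∀ᶠ x in 𝓝 x₀, α.toFun x = s x := by
  obtain ⟨χ, h1, h2⟩ := exists_bump B (hu.mem_nhds hx)
  have hc : Continuous (π F E) := FiberBundle.continuous_proj F E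
  refine ⟨⟨fun x => χ x • s x, fun p => ?_⟩, ?_⟩
  · by_cases hp : p.1 ∈ u
    · exact ((χ.contMDiff.comp (contMDiff_proj E)).contMDiffAt).mul
        (hs.contMDiffAt ((hu.preimage hc).mem_nhds hp))
    · have : ∀ᶠ q in 𝓝 p, χ (π F E q) • s q.1 q.2 = 0 := by
        have : (tsupport χ)ᶜ ∈ 𝓝 p.1 :=
          (isClosed_tsupport _).isOpen_compl.mem_nhds fun h => hp (h2 h)
        filter_upwards [hc.continuousAt.preimage_mem_nhds this] with q hq
        rw [image_eq_zero_of_notMem_tsupport hq, zero_smul]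
      exact (contMDiffAt_const (c := (0 : ℝ))).congr_of_eventuallyEq this
  · filter_upwards [h1] with x hx
    rw [hx, one_smul]

end Bump

section Frame

/-- The sections `e i` of `E` and `ξ i` of `E*` form a dual frame at `x`. -/
def IsDualFrameAt {ι : Type*} [Fintype ι] (e : ι → Sec B F E) (ξ : ι → DualSec B F E) (x : M) :
    Prop :=
  ∀ v : E x, ∑ i, (ξ i).toFun x v • e i x = v

lemma IsDualFrameAt.sum_dual {ι : Type*} [Fintype ι] {e : ι → Sec B F E} {ξ : ι → DualSec B F E}
    {x : M} (h : IsDualFrameAt e ξ x) (α : Module.Dual ℝ (E x)) :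
    ∑ i, α (e i x) • (ξ i).toFun x = α := by
  ext v
  conv_rhs => rw [← h v]
  simp [mul_comm]

lemma finiteDimensional_fibre (F : Type*) [NormedAddCommGroup F] [NormedSpace ℝ F]
    (E : M → Type*) [TopologicalSpace (TotalSpace F E)] [∀ x, TopologicalSpace (E x)]
    [∀ x, AddCommGroup (E x)] [∀ x, Module ℝ (E x)] [FiberBundle F E] [VectorBundle ℝ F E]
    [FiniteDimensional ℝ F] (x : M) : FiniteDimensional ℝ (E x) :=
  ((trivializationAt F E x).linearEquivAt ℝ x
    (FiberBundle.mem_baseSet_trivializationAt' x)).symm.finiteDimensional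

variable [FiniteDimensional ℝ B] [T2Space M] [IsManifold 𝓘(ℝ, B) ∞ M]

/-- For a bump function `χ` at `x` supported where the two sections agree, `χ α = χ α'` holds
globally, and `T` sees the factor `χ` only through `χ x = 1`. -/
lemma dual_eq_zero_of_eventually_eq_zero {C : Type*} [AddCommGroup C] [Module ℝ C] {x : M}
    {T : DualSec B F E →+ C} (hT : ∀ f α, T (DualSec.smul f α) = f x • T α) {α α' : DualSec B F E}
    (hα : ∀ᶠ y in 𝓝 x, α.toFun y = α'.toFun y) : T α = T α' := by
  obtain ⟨χ, h1, h2⟩ := exists_bump B hα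
  have h : DualSec.smul χ α = DualSec.smul χ α' := by
    ext1 y
    rw [DualSec.smul_toFun, DualSec.smul_toFun]
    by_cases hy : y ∈ tsupport χ
    · rw [show α.toFun y = α'.toFun y from h2 hy]
    · rw [image_eq_zero_of_notMem_tsupport hy, zero_smul, zero_smul]
  rw [← one_smul ℝ (T α), ← one_smul ℝ (T α'), ← h1.self_of_nhds, ← hT, h, hT]

/-- The frame expansion of `α` holds only near `x`, but its right-hand side is a global section, and
`T` does not distinguish sections that agree near `x`. In particular `T α` depends on the value of
`α` at `x` only. -/
lemma dual_tensorial_eq_sum {C : Type*} [AddCommGroup C] [Module ℝ C] {x : M}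
    {T : DualSec B F E →+ C} (hT : ∀ f α, T (DualSec.smul f α) = f x • T α)
    {ι : Type*} [Fintype ι] {e : ι → Sec B F E}
    {ξ : ι → DualSec B F E} (h : ∀ᶠ y in 𝓝 x, IsDualFrameAt e ξ y) (α : DualSec B F E) :
    T α = ∑ i, α.toFun x (e i x) • T (ξ i) := by
  have h0 := dual_eq_zero_of_eventually_eq_zero hT
    (α := α) (α' := ∑ i, DualSec.smul (α.pair (e i)) (ξ i)) (by
      filter_upwards [h] with y hy
      rw [DualSec.sum_toFun]
      exact (hy.sum_dual _).symm)
  rw [map_sum] at h0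
  simp only [hT] at h0
  exact h0

variable [VectorBundle ℝ F E]

lemma eq_zero_of_eventually_eq_zero {C : Type*} [AddCommGroup C] [Module ℝ C] {x : M}
    {T : Sec B F E →+ C} (hT : ∀ f ψ, T (smulSec f ψ) = f x • T ψ) {ψ : Sec B F E}
    (hψ : ∀ᶠ y in 𝓝 x, ψ y = 0) : T ψ = 0 := by
  obtain ⟨χ, h1, h2⟩ := exists_bump B hψ
  have h : smulSec χ ψ = 0 := by
    ext y
    rw [smulSec_apply]
    by_cases hy : y ∈ tsupport χ
    · have : ψ y = 0 := h2 hy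
      rw [this, smul_zero]
      rfl
    · rw [image_eq_zero_of_notMem_tsupport hy, zero_smul]
      rfl
  rw [← one_smul ℝ (T ψ), ← h1.self_of_nhds, ← hT, h, map_zero]

lemma tensorial_eq_sum {C : Type*} [AddCommGroup C] [Module ℝ C] {x : M} {T : Sec B F E →+ C}
    (hT : ∀ f ψ, T (smulSec f ψ) = f x • T ψ) {ι : Type*} [Fintype ι] {e : ι → Sec B F E}
    {ξ : ι → DualSec B F E} (h : ∀ᶠ y in 𝓝 x, IsDualFrameAt e ξ y) (ψ : Sec B F E) :
    T ψ = ∑ i, (ξ i).toFun x (ψ x) • T (e i) := by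
  have h0 := eq_zero_of_eventually_eq_zero hT
    (ψ := ψ - ∑ i, smulSec ((ξ i).pair ψ) (e i)) (by
      filter_upwards [h] with y hy
      rw [ContMDiffSection.coe_sub, Pi.sub_apply, Sec.sum_apply]
      simp only [smulSec_apply, DualSec.pair_apply]
      rw [hy, sub_self])
  rw [map_sub, sub_eq_zero, map_sum] at h0
  simp only [hT] at h0
  exact h0

variable [FiniteDimensional ℝ F] [ContMDiffVectorBundle ∞ F E 𝓘(ℝ, B)]

-- A trivialization provides a frame and its coordinate functionals. Both are cut off to global
-- sections, which remain dual to each other near `x₀`.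
variable (B F E) in
lemma exists_dualFrame (x₀ : M) : ∃ (n : ℕ) (e : Fin n → Sec B F E) (ξ : Fin n → DualSec B F E),
    ∀ᶠ x in 𝓝 x₀, IsDualFrameAt e ξ x := by
  let t := trivializationAt F E x₀
  let b := Module.finBasis ℝ F
  have hx₀ : x₀ ∈ t.baseSet := FiberBundle.mem_baseSet_trivializationAt' x₀
  have h1 (i) : ∃ ψ : Sec B F E, ∀ᶠ x in 𝓝 x₀, ψ x = t.localFrame b i x :=
    exists_sec_eventuallyEq t.open_baseSet (t.contMDiffOn_localFrame_baseSet ∞ b i) hx₀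
  have h2 (i) : ∃ α : DualSec B F E, ∀ᶠ x in 𝓝 x₀, α.toFun x = b.coord i ∘ₗ t.linearMapAt ℝ x := by
    refine exists_dualSec_eventuallyEq t.open_baseSet ?_ hx₀
    have h3 : ContMDiffOn (𝓘(ℝ, B).prod 𝓘(ℝ, F)) 𝓘(ℝ, F) ∞
        (fun p : TotalSpace F E => (t p).2) t.source :=
      ((t.contMDiffOn_iff (Set.mapsTo_id _)).1 contMDiffOn_id).2
    have h4 := ((LinearMap.toContinuousLinearMap (b.coord i)).contMDiff (n := ∞)).comp_contMDiffOn h3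
    rw [t.source_eq] at h4
    refine h4.congr fun p hp => ?_
    simp only [LinearMap.comp_apply, Function.comp_apply]
    rw [t.coe_linearMapAt_of_mem hp]
    rfl
  choose e he using h1
  choose ξ hξ using h2
  refine ⟨_, e, ξ, ?_⟩
  filter_upwards [eventually_all.2 he, eventually_all.2 hξ, t.open_baseSet.mem_nhds hx₀]
    with x h1 h2 hx v
  have h3 (i) : (ξ i).toFun x v • e i x = (t.linearEquivAt ℝ x hx).symm
      (b.coord i (t.linearMapAt ℝ x v) • b i) := by
    rw [h1, h2, map_smul, t.localFrame_apply_of_mem_baseSet b hx]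
    simp only [LinearMap.comp_apply, Trivialization.basisAt, Module.Basis.map_apply]
  simp only [h3, ← map_sum]
  simp only [Module.Basis.coord_apply, b.sum_repr]
  rw [t.linearMapAt_def_of_mem hx]
  exact LinearEquiv.symm_apply_apply _ v

variable (B F) in
/-- A linear choice of a section through each vector of a fibre. -/
lemma exists_extend (x : M) : ∃ ext : E x →ₗ[ℝ] Sec B F E, ∀ v, ext v x = v := by
  obtain ⟨n, e, ξ, h⟩ := exists_dualFrame B F E x
  refine ⟨∑ i, (LinearMap.toSpanSingleton ℝ (Sec B F E) (e i)).comp ((ξ i).toFun x), fun v => ?_⟩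
  rw [LinearMap.sum_apply, Sec.sum_apply]
  exact h.self_of_nhds v

variable (B F) in
lemma exists_sec_apply_eq (x : M) (v : E x) : ∃ ψ : Sec B F E, ψ x = v := by
  obtain ⟨ext, h⟩ := exists_extend B F (E := E) x
  exact ⟨ext v, h v⟩

variable (B F) in
lemma exists_dualSec_apply_eq (x : M) (α₀ : Module.Dual ℝ (E x)) :
    ∃ α : DualSec B F E, α.toFun x = α₀ := by
  obtain ⟨n, e, ξ, h⟩ := exists_dualFrame B F E x
  refine ⟨∑ i, DualSec.smul (ContMDiffMap.const (α₀ (e i x))) (ξ i), ?_⟩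
  rw [DualSec.sum_toFun]
  exact h.self_of_nhds.sum_dual α₀

lemma Sec.ext_pair {ψ ψ' : Sec B F E} (h : ∀ α : DualSec B F E, α.pair ψ = α.pair ψ') :
    ψ = ψ' := by
  ext x
  have := finiteDimensional_fibre F E x
  refine sub_eq_zero.1 ((Module.forall_dual_apply_eq_zero_iff ℝ _).1 fun α₀ => ?_)
  obtain ⟨α, rfl⟩ := exists_dualSec_apply_eq B F x α₀
  rw [map_sub, sub_eq_zero]
  exact DFunLike.congr_fun (h α) x

lemma tensorial_congr {C : Type*} [AddCommGroup C] [Module ℝ C] {x : M} {T : Sec B F E →+ C}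
    (hT : ∀ f ψ, T (smulSec f ψ) = f x • T ψ) {ψ ψ' : Sec B F E} (h : ψ x = ψ' x) :
    T ψ = T ψ' := by
  obtain ⟨n, e, ξ, he⟩ := exists_dualFrame B F E x
  rw [tensorial_eq_sum hT he, tensorial_eq_sum hT he, h]

/-- A `C^∞(M)`-linear functional on the sections of `E*` is a section of `E`. -/
lemma exists_sec_of_dual (T : DualSec B F E → Fn B M) (hadd : ∀ α α', T (α + α') = T α + T α')
    (hT : ∀ f α, T (DualSec.smul f α) = f * T α) : ∃ ψ : Sec B F E, ∀ α, α.pair ψ = T α := by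
  let Tx (x : M) : DualSec B F E →+ ℝ :=
    AddMonoidHom.mk' (fun α => T α x) (fun α α' => by rw [hadd]; rfl)
  have hTx (x : M) (f : Fn B M) (α) : Tx x (DualSec.smul f α) = f x • Tx x α := by
    change T _ x = f x * T α x
    rw [hT]
    rfl
  choose n e ξ he using exists_dualFrame B F E
  -- The value at `x` is defined with the frame chosen for `x` itself. By `hs` it does not depend on
  -- that choice, so near `x₀` the frame of the single point `x₀` can be used, which shows
  -- smoothness.
  let s (x : M) : E x := ∑ i, T (ξ x i) x • e x i x
  have hs (x : M) (α : DualSec B F E) : α.toFun x (s x) = T α x := by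
    have h := dual_tensorial_eq_sum (hTx x) (he x) α
    refine Eq.trans ?_ h.symm
    simp only [s, map_sum, map_smul, smul_eq_mul]
    exact Finset.sum_congr rfl fun i _ => mul_comm _ _
  have hloc (x₀ : M) : ∀ᶠ x in 𝓝 x₀, s x = (∑ i, smulSec (T (ξ x₀ i)) (e x₀ i) : Sec B F E) x := by
    filter_upwards [he x₀] with x hx
    rw [← hx (s x), Sec.sum_apply]
    simp only [hs, smulSec_apply]
  refine ⟨⟨s, fun x₀ => ?_⟩, fun α => ?_⟩
  · refine (ContMDiffSection.contMDiff (∑ i, smulSec (T (ξ x₀ i)) (e x₀ i)) x₀).congr_of_eventuallyEq ?_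
    filter_upwards [hloc x₀] with x hx
    rw [hx]
  · ext x
    exact hs x α

section BundleMap

variable {F' : Type*} [NormedAddCommGroup F'] [NormedSpace ℝ F']
  {E' : M → Type*} [TopologicalSpace (TotalSpace F' E')] [∀ x, TopologicalSpace (E' x)]
  [∀ x, AddCommGroup (E' x)] [∀ x, Module ℝ (E' x)] [FiberBundle F' E'] [VectorBundle ℝ F' E']

lemma BundleMap.ext {φ φ' : BundleMap B F E F' E'} (h : ∀ x, φ.toFun x = φ'.toFun x) :
    φ = φ' := by
  cases φ
  cases φ'
  congr
  exact funext h

lemma BundleMap.ext_onSec {φ φ' : BundleMap B F E F' E'} (h : ∀ ψ, φ.onSec ψ = φ'.onSec ψ) :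
    φ = φ' := by
  refine BundleMap.ext fun x => LinearMap.ext fun v => ?_
  obtain ⟨ψ, rfl⟩ := exists_sec_apply_eq B F x v
  exact DFunLike.congr_fun (h ψ) x

variable [ContMDiffVectorBundle ∞ F' E' 𝓘(ℝ, B)]

/-- A `C^∞(M)`-linear map between sections is a bundle map. -/
lemma exists_bundleMap (T : Sec B F E → Sec B F' E') (hadd : ∀ ψ ψ', T (ψ + ψ') = T ψ + T ψ')
    (hT : ∀ f ψ, T (smulSec f ψ) = smulSec f (T ψ)) :
    ∃ φ : BundleMap B F E F' E', ∀ ψ, φ.onSec ψ = T ψ := by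
  let Tx (x : M) : Sec B F E →+ E' x :=
    AddMonoidHom.mk' (fun ψ => T ψ x) (fun ψ ψ' => by rw [hadd]; rfl)
  have hTx (x : M) (f : Fn B M) (ψ) : Tx x (smulSec f ψ) = f x • Tx x ψ := by
    change T _ x = f x • T ψ x
    rw [hT]
    rfl
  choose n e ξ he using exists_dualFrame B F E
  let φ (x : M) : E x →ₗ[ℝ] E' x :=
    ∑ i, (LinearMap.toSpanSingleton ℝ (E' x) (T (e x i) x)).comp ((ξ x i).toFun x)
  have hφ (x : M) (ψ : Sec B F E) : φ x (ψ x) = T ψ x := by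
    refine Eq.trans ?_ (tensorial_eq_sum (hTx x) (he x) ψ).symm
    rw [LinearMap.sum_apply]
    rfl
  refine ⟨⟨φ, fun p => ?_⟩, fun ψ => ?_⟩
  · refine (contMDiffAt_sum_smul (ξ p.1) (fun i => T (e p.1 i)) p).congr_of_eventuallyEq ?_
    have := (FiberBundle.continuous_proj F E).continuousAt.eventually
      (eventually_eventually_nhds.2 (he p.1))
    filter_upwards [this] with q hq
    obtain ⟨ψ, hψ⟩ := exists_sec_apply_eq B F q.1 q.2
    have h := tensorial_eq_sum (hTx q.1) hq ψ
    rw [← hψ, hφ]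
    congr 1
  · ext x
    exact hφ x ψ

end BundleMap

end Frame

end Geometry

/-! ### Vector fields as derivations of the algebra of functions -/

section VectorFields

variable {B : Type*} [NormedAddCommGroup B] [NormedSpace ℝ B]
  {M : Type*} [TopologicalSpace M] [ChartedSpace B M]

lemma Fn.mdifferentiableAt (f : Fn B M) (x : M) : MDifferentiableAt 𝓘(ℝ, B) 𝓘(ℝ, ℝ) f x :=
  f.contMDiff.mdifferentiable (by simp) x

lemma dirDeriv_add (f g : Fn B M) (x : M) (X : TangentSpace 𝓘(ℝ, B) x) :
    dirDeriv (f + g) x X = dirDeriv f x X + dirDeriv g x X := by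
  have := mvfderiv_add (Fn.mdifferentiableAt f x) (Fn.mdifferentiableAt g x)
  exact DFunLike.congr_fun this X

lemma dirDeriv_mul (f g : Fn B M) (x : M) (X : TangentSpace 𝓘(ℝ, B) x) :
    dirDeriv (f * g) x X = f x * dirDeriv g x X + g x * dirDeriv f x X := by
  have := mvfderiv_mul (Fn.mdifferentiableAt f x) (Fn.mdifferentiableAt g x)
  exact DFunLike.congr_fun this X

lemma dirDeriv_congr {f g : Fn B M} {x : M} (h : ∀ᶠ y in 𝓝 x, f y = g y)
    (X : TangentSpace 𝓘(ℝ, B) x) : dirDeriv f x X = dirDeriv g x X := by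
  simp only [dirDeriv, mvfderiv]
  have h' : (f : M → ℝ) =ᶠ[𝓝 x] g := h
  simp only [ContinuousLinearMap.comp_apply, h'.mfderiv_eq]
  rfl

lemma dirDeriv_const_smul (r : ℝ) (f : Fn B M) (x : M) (X : TangentSpace 𝓘(ℝ, B) x) :
    dirDeriv (r • f) x X = r * dirDeriv f x X := by
  have h : r • f = ContMDiffMap.const r * f := by
    ext y
    rfl
  have h0 : dirDeriv (ContMDiffMap.const r : Fn B M) x X = 0 :=
    DFunLike.congr_fun (mvfderiv_const (I := 𝓘(ℝ, B)) r) X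
  rw [h, dirDeriv_mul, h0, mul_zero, add_zero]
  rfl

@[simp]
lemma dirDeriv_vadd (f : Fn B M) (x : M) (X Y : TangentSpace 𝓘(ℝ, B) x) :
    dirDeriv f x (X + Y) = dirDeriv f x X + dirDeriv f x Y := map_add _ _ _

@[simp]
lemma dirDeriv_vsmul (f : Fn B M) (x : M) (r : ℝ) (X : TangentSpace 𝓘(ℝ, B) x) :
    dirDeriv f x (r • X) = r * dirDeriv f x X := map_smul _ _ _

@[simp]
lemma dirDeriv_vzero (f : Fn B M) (x : M) : dirDeriv f x 0 = 0 := map_zero _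

variable [IsManifold 𝓘(ℝ, B) ∞ M]

/-- The differential of a function. -/
def differential (f : Fn B M) : DualSec B B (TangentSpace 𝓘(ℝ, B) : M → Type _) where
  toFun x := { toFun := dirDeriv f x, map_add' := dirDeriv_vadd f x, map_smul' := dirDeriv_vsmul f x }
  smooth := by
    have h := f.contMDiff.contMDiff_tangentMap (m := ∞) (by simp)
    have h2 := (contMDiff_snd_tangentBundle_modelSpace ℝ 𝓘(ℝ, ℝ) (n := ∞)).comp h
    exact h2

variable [FiniteDimensional ℝ B]

lemma exists_fn_eventuallyEq [T2Space M] {g : M → ℝ} {u : Set M} (hu : IsOpen u)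
    (hg : ContMDiffOn 𝓘(ℝ, B) 𝓘(ℝ, ℝ) ∞ g u) {x₀ : M} (hx : x₀ ∈ u) :
    ∃ f : Fn B M, ∀ᶠ x in 𝓝 x₀, f x = g x := by
  obtain ⟨χ, h1, h2⟩ := exists_bump B (hu.mem_nhds hx)
  refine ⟨⟨fun x => χ x * g x, fun p => ?_⟩, ?_⟩
  · by_cases hp : p ∈ u
    · exact χ.contMDiff.contMDiffAt.mul (hg.contMDiffAt (hu.mem_nhds hp))
    · have : ∀ᶠ q in 𝓝 p, χ q * g q = 0 := by
        filter_upwards [(isClosed_tsupport χ).isOpen_compl.mem_nhds fun h => hp (h2 h)] with q hq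
        rw [image_eq_zero_of_notMem_tsupport hq, zero_mul]
      exact (contMDiffAt_const (c := (0 : ℝ))).congr_of_eventuallyEq this
  · filter_upwards [h1] with x hx
    change χ x * g x = g x
    rw [hx, one_mul]

/-! ### The Lie bracket of vector fields as a commutator -/

/-- The derivative of a function in the direction of a vector field. -/
def lieDeriv (X : Sec B B (TangentSpace 𝓘(ℝ, B) : M → Type _)) (f : Fn B M) : Fn B M :=
  (differential f).pair X

lemma contDiffOn_comp_extChartAt_symm (f : Fn B M) (x₀ : M) :
    ContDiffOn ℝ ∞ (f ∘ (extChartAt 𝓘(ℝ, B) x₀).symm) (extChartAt 𝓘(ℝ, B) x₀).target :=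
  contMDiffOn_iff_contDiffOn.1
    (f.contMDiff.comp_contMDiffOn (contMDiffOn_extChartAt_symm x₀))

/-- The direction is expressed through the inverse of the derivative of the inverse chart, because
this is how `mpullbackWithin` transports vector fields to the chart, and the Lie bracket on the
manifold is defined in that way. -/
lemma dirDeriv_extChartAt_symm (f : Fn B M) (x₀ : M) {z : B}
    (hz : z ∈ (extChartAt 𝓘(ℝ, B) x₀).target)
    (X : TangentSpace 𝓘(ℝ, B) ((extChartAt 𝓘(ℝ, B) x₀).symm z)) :
    dirDeriv f ((extChartAt 𝓘(ℝ, B) x₀).symm z) X =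
      fderiv ℝ (f ∘ (extChartAt 𝓘(ℝ, B) x₀).symm) z
        ((mfderivWithin 𝓘(ℝ, B) 𝓘(ℝ, B) (extChartAt 𝓘(ℝ, B) x₀).symm
          (Set.range 𝓘(ℝ, B)) z).inverse X) := by
  have hi := isInvertible_mfderivWithin_extChartAt_symm (I := 𝓘(ℝ, B)) hz
  have hopen : (extChartAt 𝓘(ℝ, B) x₀).target ∈ 𝓝 z := (isOpen_extChartAt_target x₀).mem_nhds hz
  have hd : MDifferentiableAt 𝓘(ℝ, B) 𝓘(ℝ, B) (extChartAt 𝓘(ℝ, B) x₀).symm z :=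
    ((contMDiffOn_extChartAt_symm (n := ∞) x₀).contMDiffAt hopen).mdifferentiableAt (by simp)
  have hc := mvfderiv_comp z (Fn.mdifferentiableAt f _) hd
  obtain ⟨Y, rfl⟩ : ∃ Y, X = mfderivWithin 𝓘(ℝ, B) 𝓘(ℝ, B) (extChartAt 𝓘(ℝ, B) x₀).symm
      (Set.range 𝓘(ℝ, B)) z Y := ⟨_, (hi.self_apply_inverse X).symm⟩
  rw [hi.inverse_apply_self]
  have h1 := DFunLike.congr_fun hc Y
  rw [ModelWithCorners.range_eq_univ, mfderivWithin_univ]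
  refine Eq.trans h1.symm ?_
  simp only [mvfderiv, mfderiv_eq_fderiv]
  rfl

lemma dirDeriv_eq_fderiv (f : Fn B M) {x₀ x : M} (hx : x ∈ (extChartAt 𝓘(ℝ, B) x₀).source)
    (X : TangentSpace 𝓘(ℝ, B) x) :
    dirDeriv f x X = fderiv ℝ (f ∘ (extChartAt 𝓘(ℝ, B) x₀).symm) (extChartAt 𝓘(ℝ, B) x₀ x)
        (mfderiv 𝓘(ℝ, B) 𝓘(ℝ, B) (extChartAt 𝓘(ℝ, B) x₀) x X) := by
  set φ := extChartAt 𝓘(ℝ, B) x₀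
  have hz : φ x ∈ φ.target := φ.map_source hx
  have h1 : (f : M → ℝ) =ᶠ[𝓝 x] (f ∘ φ.symm) ∘ φ := by
    filter_upwards [(isOpen_extChartAt_source x₀).mem_nhds hx] with y hy
    exact congrArg f (φ.left_inv hy).symm
  have hd : MDifferentiableAt 𝓘(ℝ, B) 𝓘(ℝ, B) φ x := mdifferentiableAt_extChartAt (by
    rwa [extChartAt_source] at hx)
  have hf : MDifferentiableAt 𝓘(ℝ, B) 𝓘(ℝ, ℝ) (f ∘ φ.symm) (φ x) :=
    (((contDiffOn_comp_extChartAt_symm f x₀).contDiffAt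
      ((isOpen_extChartAt_target x₀).mem_nhds hz)).differentiableAt (by simp)).mdifferentiableAt
  have hc := DFunLike.congr_fun (mvfderiv_comp x hf hd) X
  refine Eq.trans ?_ (hc.trans ?_)
  · simp only [dirDeriv, mvfderiv, ContinuousLinearMap.comp_apply, h1.mfderiv_eq]
    rfl
  · simp only [mvfderiv, mfderiv_eq_fderiv]
    rfl

/-- In the chart at `x₀` this becomes the identity between the Lie bracket and the commutator of
directional derivatives on a vector space, which rests on the symmetry of the second derivative of
`f`. -/
lemma dirDeriv_mlieBracket (X Y : Sec B B (TangentSpace 𝓘(ℝ, B) : M → Type _)) (f : Fn B M)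
    (x₀ : M) : dirDeriv f x₀ (VectorField.mlieBracket 𝓘(ℝ, B) X Y x₀) =
      lieDeriv X (lieDeriv Y f) x₀ - lieDeriv Y (lieDeriv X f) x₀ := by
  have : CompleteSpace B := FiniteDimensional.complete ℝ B
  have : IsManifold 𝓘(ℝ, B) 2 M := IsManifold.of_le (m := 2) (n := ∞) (by
    exact ENat.LEInfty.out)
  set φ := extChartAt 𝓘(ℝ, B) x₀ with hφ
  have hx : x₀ ∈ φ.source := mem_extChartAt_source x₀
  have hz : φ x₀ ∈ φ.target := φ.map_source hx
  have ht : φ.target ∈ 𝓝 (φ x₀) := (isOpen_extChartAt_target x₀).mem_nhds hz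
  let pull (Z : Sec B B (TangentSpace 𝓘(ℝ, B) : M → Type _)) : B → B :=
    VectorField.mpullbackWithin 𝓘(ℝ, B) 𝓘(ℝ, B) φ.symm Z (Set.range 𝓘(ℝ, B))
  have hder (g : Fn B M) (Z : Sec B B (TangentSpace 𝓘(ℝ, B) : M → Type _)) {z : B}
      (hz : z ∈ φ.target) : lieDeriv Z g (φ.symm z) = fderiv ℝ (g ∘ φ.symm) z (pull Z z) :=
    dirDeriv_extChartAt_symm g x₀ hz _
  have hder0 (g : Fn B M) (Z : Sec B B (TangentSpace 𝓘(ℝ, B) : M → Type _)) :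
      lieDeriv Z g x₀ = fderiv ℝ (g ∘ φ.symm) (φ x₀) (pull Z (φ x₀)) := by
    rw [← hder g Z hz, φ.left_inv hx]
  have hpull (Z : Sec B B (TangentSpace 𝓘(ℝ, B) : M → Type _)) :
      DifferentiableAt ℝ (pull Z) (φ x₀) := by
    have := MDifferentiableWithinAt.differentiableWithinAt_mpullbackWithin_vectorField
      (s := Set.univ) (V := Z) (x := x₀) (I := 𝓘(ℝ, B))
      (Z.mdifferentiableAt.mdifferentiableWithinAt)
    rw [ModelWithCorners.range_eq_univ, Set.preimage_univ, Set.univ_inter] at this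
    have e : pull Z = VectorField.mpullbackWithin 𝓘(ℝ, B) 𝓘(ℝ, B) φ.symm Z Set.univ := by
      simp only [pull, ModelWithCorners.range_eq_univ]
      rfl
    refine differentiableWithinAt_univ.1 ?_
    rw [e]
    exact this
  have hit (Z Z' : Sec B B (TangentSpace 𝓘(ℝ, B) : M → Type _)) :
      lieDeriv Z (lieDeriv Z' f) x₀ =
        fderiv ℝ (fun z => fderiv ℝ (f ∘ φ.symm) z (pull Z' z)) (φ x₀) (pull Z (φ x₀)) := by
    rw [hder0]
    congr 1
    refine Filter.EventuallyEq.fderiv_eq ?_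
    filter_upwards [ht] with z hz
    exact hder f Z' hz
  have hf2 : ContDiffAt ℝ 2 (f ∘ φ.symm) (φ x₀) :=
    ((contDiffOn_comp_extChartAt_symm f x₀).contDiffAt ht).of_le (by exact ENat.LEInfty.out)
  have key := VectorField.fderiv_apply_lieBracket_of_isSymmSndFDerivAt hf2
    (hf2.isSymmSndFDerivAt (by simp)) (hpull Y) (hpull X)
  rw [hit X Y, hit Y X, ← key, dirDeriv_eq_fderiv f hx]
  congr 1
  have hi := isInvertible_mfderiv_extChartAt (I := 𝓘(ℝ, B)) hx
  rw [← VectorField.mlieBracketWithin_univ, VectorField.mlieBracketWithin_apply]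
  refine (hi.self_apply_inverse _).trans ?_
  rw [Set.preimage_univ, Set.univ_inter, ← VectorField.lieBracketWithin_univ,
    ModelWithCorners.range_eq_univ]
  simp only [pull, ModelWithCorners.range_eq_univ]
  rfl

/-! ### Derivations of the algebra of functions -/

/-- Hadamard's lemma. -/
lemma exists_hadamard {f : B → ℝ} (hf : ContDiff ℝ ∞ f) (z₀ : B) :
    ∃ g : B → (B →L[ℝ] ℝ), ContDiff ℝ ∞ g ∧ ∀ z, f z = f z₀ + g z (z - z₀) := by
  -- The function is `g z = ∫₀¹ Df(z₀ + t (z - z₀)) dt`. For smoothness in `z` the integral is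
  -- written as the convolution at 0 of the indicator of `(0, 1]` with `h z`, where `χ` provides
  -- compact support and equals 1 for `|s| ≤ 1`. The minus sign in `h` accounts for the reflection
  -- in the convolution.
  let χ : ContDiffBump (0 : ℝ) := ⟨1, 2, one_pos, one_lt_two⟩
  let h : B → ℝ → (B →L[ℝ] ℝ) := fun z s => χ s • fderiv ℝ f (z₀ - s • (z - z₀))
  have hf' : ContDiff ℝ ∞ (fderiv ℝ f) := hf.fderiv_right (by simp)
  let ind : ℝ → ℝ := Set.indicator (Set.Ioc 0 1) 1
  have hind : MeasureTheory.LocallyIntegrable ind MeasureTheory.volume :=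
    (MeasureTheory.locallyIntegrable_const (1 : ℝ)).indicator measurableSet_Ioc
  let L := ContinuousLinearMap.lsmul ℝ ℝ (E := B →L[ℝ] ℝ)
  have hsm : ContDiffOn ℝ ∞ (fun z => MeasureTheory.convolution ind (h z) L
      MeasureTheory.volume (0 : ℝ)) Set.univ := by
    refine MeasureTheory.contDiffOn_convolution_right_with_param_comp (n := ⊤) L
      (v := fun _ => (0 : ℝ)) contDiffOn_const isOpen_univ χ.hasCompactSupport.isCompact
      (fun p x _ hx => ?_) hind ?_
    · simp only [h]
      rw [image_eq_zero_of_notMem_tsupport hx, zero_smul]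
    · refine ContDiff.contDiffOn ?_
      refine (χ.contDiff.comp contDiff_snd).smul (hf'.comp ?_)
      fun_prop
  refine ⟨_, contDiffOn_univ.1 hsm, fun z => ?_⟩
  have hconv : MeasureTheory.convolution ind (h z) L MeasureTheory.volume (0 : ℝ) =
      ∫ t in (0 : ℝ)..1, fderiv ℝ f (z₀ + t • (z - z₀)) := by
    rw [MeasureTheory.convolution_def, intervalIntegral.integral_of_le zero_le_one,
      ← MeasureTheory.integral_indicator measurableSet_Ioc]
    congr 1
    ext1 t
    by_cases ht : t ∈ Set.Ioc (0 : ℝ) 1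
    · have hχ : χ (-t) = 1 := χ.one_of_mem_closedBall (by
        simp only [Metric.mem_closedBall, dist_zero_right, norm_neg, Real.norm_eq_abs]
        rw [abs_of_pos ht.1]
        exact ht.2)
      simp [ind, ht, L, h, hχ]
    · simp [ind, ht, L]
  rw [hconv]
  have hcont : Continuous fun t : ℝ => fderiv ℝ f (z₀ + t • (z - z₀)) :=
    hf'.continuous.comp (by fun_prop)
  have happ : (∫ t in (0 : ℝ)..1, fderiv ℝ f (z₀ + t • (z - z₀))) (z - z₀) =
      ∫ t in (0 : ℝ)..1, fderiv ℝ f (z₀ + t • (z - z₀)) (z - z₀) :=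
    (ContinuousLinearMap.intervalIntegral_apply (hcont.intervalIntegrable _ _) _)
  rw [happ]
  have hderiv : ∀ t ∈ Set.uIcc (0 : ℝ) 1, HasDerivAt (fun t : ℝ => f (z₀ + t • (z - z₀)))
      (fderiv ℝ f (z₀ + t • (z - z₀)) (z - z₀)) t := fun t _ => by
    have h1 : HasDerivAt (fun t : ℝ => z₀ + t • (z - z₀)) (z - z₀) t := by
      simpa using ((hasDerivAt_id t).smul_const (z - z₀)).const_add z₀
    exact ((hf.differentiable (by simp)) _).hasFDerivAt.comp_hasDerivAt t h1
  rw [intervalIntegral.integral_eq_sub_of_hasDerivAt hderiv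
    ((hcont.clm_apply continuous_const).intervalIntegrable _ _)]
  simp

section Derivation

variable [T2Space M]

/-- A derivation of `C^∞(M)` at the point `x`. -/
def IsDerivationAt (x : M) (D : Fn B M →ₗ[ℝ] ℝ) : Prop :=
  ∀ f g, D (f * g) = f x * D g + g x * D f

lemma IsDerivationAt.const {x : M} {D : Fn B M →ₗ[ℝ] ℝ} (hD : IsDerivationAt x D) (r : ℝ) :
    D (ContMDiffMap.const r) = 0 := by
  have h1 : D 1 = 0 := by
    have := hD 1 1
    rw [mul_one] at this
    change D 1 = 1 * D 1 + 1 * D 1 at this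
    linarith
  have h2 : (ContMDiffMap.const r : Fn B M) = r • 1 := by
    ext y
    change r = r * 1
    rw [mul_one]
  rw [h2, map_smul, h1, smul_zero]

/-- Apply `D` to `χ (f - g) = 0`: since `f - g` vanishes at `x` and `χ x = 1`, the Leibniz rule
leaves `D (f - g) = 0`. -/
lemma IsDerivationAt.congr {x : M} {D : Fn B M →ₗ[ℝ] ℝ} (hD : IsDerivationAt x D) {f g : Fn B M}
    (h : ∀ᶠ y in 𝓝 x, f y = g y) : D f = D g := by
  obtain ⟨χ, h1, h2⟩ := exists_bump B h
  have h0 : χ * (f - g) = 0 := by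
    ext y
    change χ y * (f y - g y) = 0
    by_cases hy : y ∈ tsupport χ
    · rw [show f y = g y from h2 hy, sub_self, mul_zero]
    · rw [image_eq_zero_of_notMem_tsupport hy, zero_mul]
  have h3 := hD χ (f - g)
  have h4 : (f - g) x = 0 := sub_eq_zero.2 h.self_of_nhds
  rw [h0, map_zero, h1.self_of_nhds, h4, zero_mul, add_zero, one_mul, map_sub] at h3
  exact (sub_eq_zero.1 h3.symm)

lemma isDerivationAt_dirDeriv (x : M) (X : TangentSpace 𝓘(ℝ, B) x) :
    IsDerivationAt x { toFun := fun f => dirDeriv f x X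
                       map_add' := fun f g => dirDeriv_add f g x X
                       map_smul' := fun r f => dirDeriv_const_smul r f x X } :=
  fun f g => dirDeriv_mul f g x X

/-- Cut-off coordinate functions. -/
lemma exists_coordinates (x₀ : M) : ∃ h : Fin (Module.finrank ℝ B) → Fn B M, ∀ᶠ x in 𝓝 x₀, ∀ i,
    h i x = (Module.finBasis ℝ B).coord i (extChartAt 𝓘(ℝ, B) x₀ x) := by
  have hex (i) : ∃ h : Fn B M, ∀ᶠ x in 𝓝 x₀,
      h x = (Module.finBasis ℝ B).coord i (extChartAt 𝓘(ℝ, B) x₀ x) := by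
    refine exists_fn_eventuallyEq (isOpen_extChartAt_source (I := 𝓘(ℝ, B)) x₀) ?_
      (mem_extChartAt_source x₀)
    have h1 := contMDiffOn_extChartAt (I := 𝓘(ℝ, B)) (n := ∞) (x := x₀)
    rw [← extChartAt_source 𝓘(ℝ, B)] at h1
    exact ((LinearMap.toContinuousLinearMap
      ((Module.finBasis ℝ B).coord i)).contMDiff (n := ∞)).comp_contMDiffOn h1
  choose h hh using hex
  exact ⟨h, eventually_all.2 hh⟩

lemma dirDeriv_coordinate {x₀ x : M} (hx : x ∈ (extChartAt 𝓘(ℝ, B) x₀).source)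
    {h : Fn B M} {l : Module.Dual ℝ B} (hh : ∀ᶠ y in 𝓝 x, h y = l (extChartAt 𝓘(ℝ, B) x₀ y))
    (X : TangentSpace 𝓘(ℝ, B) x) :
    dirDeriv h x X = l (mfderiv 𝓘(ℝ, B) 𝓘(ℝ, B) (extChartAt 𝓘(ℝ, B) x₀) x X) := by
  rw [dirDeriv_eq_fderiv h hx]
  set φ := extChartAt 𝓘(ℝ, B) x₀
  have ht : φ.target ∈ 𝓝 (φ x) := (isOpen_extChartAt_target x₀).mem_nhds (φ.map_source hx)
  have hs : ContinuousAt φ.symm (φ x) := (continuousOn_extChartAt_symm x₀).continuousAt ht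
  have : h ∘ φ.symm =ᶠ[𝓝 (φ x)] LinearMap.toContinuousLinearMap l := by
    have h' := hs.eventually (p := fun y => h y = l (φ y)) (by rwa [φ.left_inv hx])
    filter_upwards [h', ht] with z hz hz'
    rw [Function.comp_apply, hz, φ.right_inv hz']
    rfl
  rw [this.fderiv_eq, ContinuousLinearMap.fderiv]
  rfl

/-- Hadamard's lemma in the chart at `x₀`, applied to `f` multiplied by a bump function and extended
by zero to the model space; the coefficients are cut off again to become global functions. -/
lemma exists_taylor (x₀ : M) {h : Fin (Module.finrank ℝ B) → Fn B M} (hh : ∀ᶠ x in 𝓝 x₀, ∀ i,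
    h i x = (Module.finBasis ℝ B).coord i (extChartAt 𝓘(ℝ, B) x₀ x)) (f : Fn B M) :
    ∃ k : Fin (Module.finrank ℝ B) → Fn B M, ∀ᶠ x in 𝓝 x₀,
      f x = f x₀ + ∑ i, (h i x - h i x₀) * k i x := by
  set φ := extChartAt 𝓘(ℝ, B) x₀
  have hx : x₀ ∈ φ.source := mem_extChartAt_source x₀
  have ht : φ.target ∈ 𝓝 (φ x₀) :=
    (isOpen_extChartAt_target x₀).mem_nhds (φ.map_source hx)
  obtain ⟨r, hr, hrt⟩ := Metric.nhds_basis_closedBall.mem_iff.1 ht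
  -- The support of `ρ` is the closed ball of radius `r`, which lies in the target of the chart.
  let ρ : ContDiffBump (φ x₀) := ⟨r / 2, r, by positivity, by linarith⟩
  let f' : B → ℝ := fun z => ρ z * f (φ.symm z)
  have hf' : ContDiff ℝ ∞ f' := by
    refine contDiff_iff_contDiffAt.2 fun z => ?_
    by_cases hz : z ∈ φ.target
    · exact ρ.contDiff.contDiffAt.mul ((contDiffOn_comp_extChartAt_symm f x₀).contDiffAt
        ((isOpen_extChartAt_target x₀).mem_nhds hz))
    · have hz' : z ∉ tsupport ρ := fun h => hz (hrt (by rwa [ρ.tsupport_eq] at h))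
      refine (contDiffAt_const (c := (0 : ℝ))).congr_of_eventuallyEq ?_
      filter_upwards [(isClosed_tsupport ρ).isOpen_compl.mem_nhds hz'] with y hy
      simp only [f']
      rw [image_eq_zero_of_notMem_tsupport hy, zero_mul]
  have hf'φ : ∀ᶠ x in 𝓝 x₀, f' (φ x) = f x := by
    have h1 : ∀ᶠ x in 𝓝 x₀, ρ (φ x) = 1 :=
      (continuousAt_extChartAt (I := 𝓘(ℝ, B)) x₀).eventually ρ.eventuallyEq_one
    filter_upwards [h1, (isOpen_extChartAt_source x₀).mem_nhds hx] with x hx hxs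
    simp only [f']
    rw [hx, φ.left_inv hxs, one_mul]
  obtain ⟨g, hg, hgf⟩ := exists_hadamard hf' (φ x₀)
  have hk (i) : ∃ k : Fn B M, ∀ᶠ x in 𝓝 x₀, k x = g (φ x) (Module.finBasis ℝ B i) := by
    refine exists_fn_eventuallyEq (isOpen_extChartAt_source (I := 𝓘(ℝ, B)) x₀) ?_ hx
    have h1 := contMDiffOn_extChartAt (I := 𝓘(ℝ, B)) (n := ∞) (x := x₀)
    rw [← extChartAt_source 𝓘(ℝ, B)] at h1
    have h2 : ContDiff ℝ ∞ fun z => g z (Module.finBasis ℝ B i) := hg.clm_apply contDiff_const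
    exact h2.contMDiff.comp_contMDiffOn h1
  choose k hk using hk
  refine ⟨k, ?_⟩
  filter_upwards [hf'φ, hh, eventually_all.2 hk] with x h1 h2 h3
  rw [← h1, hgf, hf'φ.self_of_nhds]
  congr 1
  conv_lhs => rw [← (Module.finBasis ℝ B).sum_repr (φ x - φ x₀), map_sum]
  refine Finset.sum_congr rfl fun i _ => ?_
  rw [map_smul, h3, h2, hh.self_of_nhds, ← map_sub]
  rfl

lemma IsDerivationAt.eq_sum {x₀ : M} {D : Fn B M →ₗ[ℝ] ℝ} (hD : IsDerivationAt x₀ D)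
    {f : Fn B M} {ι : Type*} [Fintype ι] {h k : ι → Fn B M}
    (hf : ∀ᶠ x in 𝓝 x₀, f x = f x₀ + ∑ i, (h i x - h i x₀) * k i x) :
    D f = ∑ i, k i x₀ * D (h i) := by
  have h1 : D f = D (ContMDiffMap.const (f x₀) +
      ∑ i, (h i - ContMDiffMap.const (h i x₀)) * k i) := by
    refine hD.congr ?_
    filter_upwards [hf] with x hx
    rw [hx]
    change _ = f x₀ + (∑ i, (h i - ContMDiffMap.const (h i x₀)) * k i : Fn B M) x
    congr 1
    have := map_sum (ContMDiffMap.coeFnAddMonoidHom :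
      Fn B M →+ (M → ℝ)) (fun i => (h i - ContMDiffMap.const (h i x₀)) * k i) Finset.univ
    refine Eq.trans ?_ (congrFun this x).symm
    rw [Finset.sum_apply]
    rfl
  rw [h1, map_add, hD.const, zero_add, map_sum]
  refine Finset.sum_congr rfl fun i _ => ?_
  rw [hD, map_sub, hD.const, sub_zero]
  change (h i x₀ - h i x₀) * _ + _ = _
  ring

/-- By the Taylor formula, a derivation at `x₀` is determined by its values on the coordinates. So
`D` agrees with the tangent vector whose components are the `D (h i)`. -/
lemma exists_tangent_of_isDerivationAt {x₀ : M} {D : Fn B M →ₗ[ℝ] ℝ} (hD : IsDerivationAt x₀ D) :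
    ∃ X : TangentSpace 𝓘(ℝ, B) x₀, ∀ f, D f = dirDeriv f x₀ X := by
  obtain ⟨h, hh⟩ := exists_coordinates (B := B) x₀
  have hx : x₀ ∈ (extChartAt 𝓘(ℝ, B) x₀).source := mem_extChartAt_source x₀
  have hi := isInvertible_mfderiv_extChartAt (I := 𝓘(ℝ, B)) hx
  let v : B := ∑ i, D (h i) • Module.finBasis ℝ B i
  refine ⟨(mfderiv 𝓘(ℝ, B) 𝓘(ℝ, B) (extChartAt 𝓘(ℝ, B) x₀) x₀).inverse v, fun f => ?_⟩
  obtain ⟨k, hk⟩ := exists_taylor x₀ hh f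
  rw [hD.eq_sum hk]
  refine Eq.trans ?_ ((isDerivationAt_dirDeriv x₀ _).eq_sum hk).symm
  refine Finset.sum_congr rfl fun i _ => ?_
  congr 1
  refine Eq.trans ?_ (dirDeriv_coordinate hx (eventually_all.1 hh i) _).symm
  have : mfderiv 𝓘(ℝ, B) 𝓘(ℝ, B) (extChartAt 𝓘(ℝ, B) x₀) x₀
    ((mfderiv 𝓘(ℝ, B) 𝓘(ℝ, B) (extChartAt 𝓘(ℝ, B) x₀) x₀).inverse v) = v :=
    hi.self_apply_inverse v
  rw [this]
  exact (congrFun ((Module.finBasis ℝ B).repr_sum_self fun i => D (h i)) i).symm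

lemma eq_of_dirDeriv_eq {x : M} {X Y : TangentSpace 𝓘(ℝ, B) x}
    (h : ∀ f : Fn B M, dirDeriv f x X = dirDeriv f x Y) : X = Y := by
  obtain ⟨c, hc⟩ := exists_coordinates (B := B) x
  have hx : x ∈ (extChartAt 𝓘(ℝ, B) x).source := mem_extChartAt_source x
  have hi := isInvertible_mfderiv_extChartAt (I := 𝓘(ℝ, B)) hx
  refine hi.injective ?_
  refine (Module.finBasis ℝ B).ext_elem fun i => ?_
  have hX := dirDeriv_coordinate hx (eventually_all.1 hc i) X
  have hY := dirDeriv_coordinate hx (eventually_all.1 hc i) Y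
  exact hX.symm.trans ((h (c i)).trans hY)

/-- A derivation of `C^∞(M)` is a smooth vector field. -/
lemma exists_vectorField {δ : Fn B M →ₗ[ℝ] Fn B M} (hδ : ∀ f g, δ (f * g) = f * δ g + g * δ f) :
    ∃ X : Sec B B (TangentSpace 𝓘(ℝ, B) : M → Type _), ∀ f, δ f = lieDeriv X f := by
  have hx (x : M) : ∃ X : TangentSpace 𝓘(ℝ, B) x, ∀ f, δ f x = dirDeriv f x X := by
    let D : Fn B M →ₗ[ℝ] ℝ :=
      { toFun := fun f => δ f x
        map_add' := fun f g => by rw [map_add]; rfl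
        map_smul' := fun r f => by rw [map_smul]; rfl }
    refine exists_tangent_of_isDerivationAt (D := D) fun f g => ?_
    exact DFunLike.congr_fun (hδ f g) x
  choose X hX using hx
  refine ⟨⟨X, fun x₀ => ?_⟩, fun f => ?_⟩
  · refine (contMDiffAt_section x₀).2 ?_
    obtain ⟨h, hh⟩ := exists_coordinates (B := B) x₀
    -- In the trivialization of the tangent bundle at `x₀` the components of `X` are the smooth
    -- functions `δ (h i)`.
    have hsm : ContMDiffAt 𝓘(ℝ, B) 𝓘(ℝ, B) ∞
        (fun x => ∑ i, δ (h i) x • Module.finBasis ℝ B i) x₀ :=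
      ContMDiffAt.sum fun i _ => (δ (h i)).contMDiff.contMDiffAt.smul contMDiffAt_const
    refine hsm.congr_of_eventuallyEq ?_
    filter_upwards [eventually_eventually_nhds.2 hh,
      (isOpen_extChartAt_source (I := 𝓘(ℝ, B)) x₀).mem_nhds (mem_extChartAt_source x₀)]
      with x hx hxs
    have h1 (i) : δ (h i) x = (Module.finBasis ℝ B).coord i
        (mfderiv 𝓘(ℝ, B) 𝓘(ℝ, B) (extChartAt 𝓘(ℝ, B) x₀) x (X x)) := by
      rw [hX]
      exact dirDeriv_coordinate hxs (eventually_all.1 hx i) _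
    simp only [h1]
    refine Eq.trans ?_ ((Module.finBasis ℝ B).sum_repr _).symm
    rw [extChartAt_source] at hxs
    have h2 := TangentBundle.continuousLinearMapAt_trivializationAt (I := 𝓘(ℝ, B)) hxs
    have h3 := DFunLike.congr_fun h2 (X x)
    refine Eq.trans ?_ h3
    rw [Trivialization.continuousLinearMapAt_apply, Trivialization.coe_linearMapAt_of_mem]
    exact hxs
  · ext x
    exact hX x f

end Derivation

end VectorFields

/-! ### Even and odd derivations of a superalgebra -/

section SuperDerivation

variable {A : Type*} [Ring A] [Algebra ℝ A]

/-- Even derivations of the superalgebra `A` with parity automorphism `σ`. -/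
structure IsEvenDer (σ : A →ₐ[ℝ] A) (D : Module.End ℝ A) : Prop where
  leibniz : ∀ a b, D (a * b) = D a * b + a * D b
  map_parity : ∀ a, D (σ a) = σ (D a)

/-- Odd derivations of the superalgebra `A` with parity automorphism `σ`. -/
structure IsOddDer (σ : A →ₐ[ℝ] A) (D : Module.End ℝ A) : Prop where
  leibniz : ∀ a b, D (a * b) = D a * b + σ a * D b
  map_parity : ∀ a, D (σ a) = -σ (D a)

variable {σ : A →ₐ[ℝ] A} {D D' : Module.End ℝ A}

lemma IsEvenDer.sub (h : IsEvenDer σ D) (h' : IsEvenDer σ D') : IsEvenDer σ (D - D') where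
  leibniz a b := by
    simp only [LinearMap.sub_apply, h.leibniz, h'.leibniz]
    noncomm_ring
  map_parity a := by
    simp only [LinearMap.sub_apply, h.map_parity, h'.map_parity, map_sub]

lemma IsOddDer.sub (h : IsOddDer σ D) (h' : IsOddDer σ D') : IsOddDer σ (D - D') where
  leibniz a b := by
    simp only [LinearMap.sub_apply, h.leibniz, h'.leibniz]
    noncomm_ring
  map_parity a := by
    simp only [LinearMap.sub_apply, h.map_parity, h'.map_parity, map_sub]
    abel

lemma IsEvenDer.commutator (h : IsEvenDer σ D) (h' : IsEvenDer σ D') :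
    IsEvenDer σ (D * D' - D' * D) where
  leibniz a b := by
    simp only [LinearMap.sub_apply, Module.End.mul_apply, h.leibniz, h'.leibniz, map_add]
    noncomm_ring
  map_parity a := by
    simp only [LinearMap.sub_apply, Module.End.mul_apply, h.map_parity, h'.map_parity, map_sub]

/-- The mixed terms cancel because the even derivation commutes with `σ`. Graded commutators of
derivations being derivations, identities between operators need to be checked on generators only.
-/
lemma IsEvenDer.commutator_odd (h : IsEvenDer σ D) (h' : IsOddDer σ D') :
    IsOddDer σ (D * D' - D' * D) where
  leibniz a b := by
    simp only [LinearMap.sub_apply, Module.End.mul_apply, h.leibniz, h'.leibniz, map_add,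
      h.map_parity, map_sub]
    noncomm_ring
  map_parity a := by
    simp only [LinearMap.sub_apply, Module.End.mul_apply, h.map_parity, h'.map_parity, map_sub,
      map_neg]
    abel

lemma IsOddDer.anticommutator (hσ : ∀ a, σ (σ a) = a) (h : IsOddDer σ D) (h' : IsOddDer σ D') :
    IsEvenDer σ (D * D' + D' * D) where
  leibniz a b := by
    simp only [LinearMap.add_apply, Module.End.mul_apply, h.leibniz, h'.leibniz, map_add,
      h.map_parity, h'.map_parity, hσ]
    noncomm_ring
  map_parity a := by
    simp only [LinearMap.add_apply, Module.End.mul_apply, h.map_parity, h'.map_parity, map_add,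
      map_neg, neg_neg]

lemma IsOddDer.square (hσ : ∀ a, σ (σ a) = a) (h : IsOddDer σ D) : IsEvenDer σ (D * D) where
  leibniz a b := by
    simp only [Module.End.mul_apply, h.leibniz, map_add, h.map_parity, hσ]
    noncomm_ring
  map_parity a := by
    simp only [Module.End.mul_apply, h.map_parity, map_neg, neg_neg]

end SuperDerivation

/-! ### Operators on the algebra of functions: contractions, degree, locality -/

section SuperFunctions

variable {B : Type*} [NormedAddCommGroup B] [NormedSpace ℝ B]
  {M : Type*} [TopologicalSpace M] [ChartedSpace B M]
  {F : Type*} [NormedAddCommGroup F] [NormedSpace ℝ F]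
  {E : M → Type*} [TopologicalSpace (TotalSpace F E)] [∀ x, TopologicalSpace (E x)]
  [∀ x, AddCommGroup (E x)] [∀ x, Module ℝ (E x)] [FiberBundle F E]
  {G : Type*} [NormedAddCommGroup G] [NormedSpace ℝ G]
  {V : M → Type*} [TopologicalSpace (TotalSpace G V)] [∀ x, TopologicalSpace (V x)]
  [∀ x, AddCommGroup (V x)] [∀ x, Module ℝ (V x)] [FiberBundle G V]

local notation "𝒮" => superFun B F E G V

instance : Ring 𝒮 := Subalgebra.toRing _

instance : AddCommGroup 𝒮 := Ring.toAddCommGroup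

instance : Neg 𝒮 := Ring.toNeg

instance : Sub 𝒮 := Ring.toSub

lemma superFun_ext {s s' : 𝒮} (h : ∀ x, s.1 x = s'.1 x) : s = s' :=
  Subtype.ext (funext h)

variable (B F E G V) in
/-- Global polynomials, as functions on `E[1] ⊕ V[2]`. -/
def polySuperFun : Subalgebra ℝ 𝒮 :=
  Algebra.adjoin ℝ (Set.range (ofFn F E G V) ∪ Set.range (ofDualE G V) ∪ Set.range (ofDualV F E))

/-- The local polynomial is produced as an element of `𝒮` itself, so that operators on `𝒮` can be
applied to it. -/
lemma exists_polySuperFun (s : 𝒮) (x₀ : M) :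
    ∃ g ∈ polySuperFun B F E G V, ∀ᶠ x in 𝓝 x₀, s.1 x = g.1 x := by
  obtain ⟨g, hg, h⟩ := s.2 x₀
  have h1 : (polySuperFun B F E G V).map (superFun B F E G V).val = polyFun B F E G V := by
    rw [polySuperFun, AlgHom.map_adjoin, Set.image_union, Set.image_union, ← Set.range_comp,
      ← Set.range_comp, ← Set.range_comp]
    rfl
  rw [← h1] at hg
  obtain ⟨g', hg', rfl⟩ := hg
  exact ⟨g', hg', h⟩

lemma mem_superFun_of_eventually {t : ∀ x, Fib (E x) (V x)}
    (h : ∀ x₀, ∃ g : 𝒮, ∀ᶠ x in 𝓝 x₀, t x = g.1 x) : t ∈ 𝒮 := fun x₀ => by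
  obtain ⟨g, hg⟩ := h x₀
  obtain ⟨g', hg', h'⟩ := g.2 x₀
  refine ⟨g', hg', ?_⟩
  filter_upwards [hg, h'] with x h1 h2
  rw [h1, h2]

@[elab_as_elim]
lemma polySuperFun_induction {p : (s : 𝒮) → s ∈ polySuperFun B F E G V → Prop}
    (hC : ∀ r, p (algebraMap ℝ _ r) (algebraMap_mem _ r))
    (hf : ∀ f, p (ofFn F E G V f) (Algebra.subset_adjoin (Or.inl (Or.inl ⟨f, rfl⟩))))
    (hE : ∀ α, p (ofDualE G V α) (Algebra.subset_adjoin (Or.inl (Or.inr ⟨α, rfl⟩))))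
    (hV : ∀ β, p (ofDualV F E β) (Algebra.subset_adjoin (Or.inr ⟨β, rfl⟩)))
    (hadd : ∀ a b ha hb, p a ha → p b hb → p (a + b) (add_mem ha hb))
    (hmul : ∀ a b ha hb, p a ha → p b hb → p (a * b) (mul_mem ha hb))
    {s : 𝒮} (hs : s ∈ polySuperFun B F E G V) : p s hs := by
  induction hs using Algebra.adjoin_induction with
  | mem a ha =>
    rcases ha with (⟨f, rfl⟩ | ⟨α, rfl⟩) | ⟨β, rfl⟩
    exacts [hf f, hE α, hV β]
  | algebraMap r => exact hC r
  | add a b _ _ ha hb => exact hadd a b _ _ ha hb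
  | mul a b _ _ ha hb => exact hmul a b _ _ ha hb

variable (B F E G V) in
/-- The parity automorphism of the algebra of functions. -/
def superParity : 𝒮 →ₐ[ℝ] 𝒮 where
  toFun s := ⟨fun x => parity (E x) (V x) (s.1 x), mem_superFun_of_eventually fun x₀ => by
    obtain ⟨g, hg, h⟩ := exists_polySuperFun s x₀
    have key : ∃ g' : 𝒮, ∀ x, parity (E x) (V x) (g.1 x) = g'.1 x := by
      clear h
      induction hg using polySuperFun_induction with
      | hC r => exact ⟨algebraMap ℝ _ r, fun x => AlgHom.commutes _ r⟩
      | hf f => exact ⟨ofFn F E G V f, fun x => AlgHom.commutes _ _⟩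
      | hE α => exact ⟨-ofDualE G V α, fun x => parity_genOdd _⟩
      | hV β => exact ⟨ofDualV F E β, fun x => parity_genEven _⟩
      | hadd a b _ _ ha hb =>
        obtain ⟨a', ha⟩ := ha
        obtain ⟨b', hb⟩ := hb
        exact ⟨a' + b', fun x => (map_add _ _ _).trans (congrArg₂ _ (ha x) (hb x))⟩
      | hmul a b _ _ ha hb =>
        obtain ⟨a', ha⟩ := ha
        obtain ⟨b', hb⟩ := hb
        exact ⟨a' * b', fun x => (map_mul _ _ _).trans (congrArg₂ _ (ha x) (hb x))⟩
    obtain ⟨g', hg'⟩ := key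
    refine ⟨g', ?_⟩
    filter_upwards [h] with x hx
    rw [hx, hg']⟩
  map_one' := superFun_ext fun x => map_one _
  map_mul' s s' := superFun_ext fun x => map_mul _ _ _
  map_zero' := superFun_ext fun x => map_zero _
  map_add' s s' := superFun_ext fun x => map_add _ _ _
  commutes' r := superFun_ext fun x => AlgHom.commutes _ _

lemma superParity_apply (s : 𝒮) (x : M) :
    (superParity B F E G V s).1 x = parity (E x) (V x) (s.1 x) := rfl

lemma superParity_superParity (s : 𝒮) :
    superParity B F E G V (superParity B F E G V s) = s :=
  superFun_ext fun _ => parity_parity _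

@[simp]
lemma superParity_ofFn (f : Fn B M) :
    superParity B F E G V (ofFn F E G V f) = ofFn F E G V f :=
  superFun_ext fun _ => AlgHom.commutes _ _

@[simp]
lemma superParity_ofDualE (α : DualSec B F E) :
    superParity B F E G V (ofDualE G V α) = -ofDualE G V α :=
  superFun_ext fun _ => parity_genOdd _

@[simp]
lemma superParity_ofDualV (β : DualSec B G V) :
    superParity B F E G V (ofDualV F E β) = ofDualV F E β :=
  superFun_ext fun _ => parity_genEven _

/-- A local operator that satisfies a twisted Leibniz rule and maps the generators to functions
maps all functions to functions. -/
lemma mem_superFun_of_leibniz {D : 𝒮 →ₗ[ℝ] (∀ x, Fib (E x) (V x))} {τ : 𝒮 →ₐ[ℝ] 𝒮}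
    (hD : ∀ s s' x, D (s * s') x = D s x * s'.1 x + (τ s).1 x * D s' x)
    (hloc : ∀ s s' : 𝒮, ∀ x, (∀ᶠ y in 𝓝 x, s.1 y = s'.1 y) → D s x = D s' x)
    (hf : ∀ f, D (ofFn F E G V f) ∈ 𝒮) (hE : ∀ α, D (ofDualE G V α) ∈ 𝒮)
    (hV : ∀ β, D (ofDualV F E β) ∈ 𝒮) (s : 𝒮) : D s ∈ 𝒮 := by
  refine mem_superFun_of_eventually fun x₀ => ?_
  obtain ⟨g, hg, h⟩ := exists_polySuperFun s x₀
  have key : D g ∈ 𝒮 := by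
    clear h
    have h1 : D 1 = 0 := by
      ext x
      have := hD 1 1 x
      simpa using this
    induction hg using polySuperFun_induction with
    | hC r =>
      rw [Algebra.algebraMap_eq_smul_one, map_smul, h1, smul_zero]
      exact zero_mem _
    | hf f => exact hf f
    | hE α => exact hE α
    | hV β => exact hV β
    | hadd a b _ _ ha hb => rw [map_add]; exact add_mem ha hb
    | hmul a b _ _ ha hb =>
      have : D (a * b) = D a * b.1 + (τ a).1 * D b := funext fun x => hD a b x
      rw [this]
      exact add_mem (mul_mem ha b.2) (mul_mem (τ a).2 hb)
  refine ⟨⟨D g, key⟩, ?_⟩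
  filter_upwards [eventually_eventually_nhds.2 h] with x hx
  exact hloc s g x hx

/-- The operator on functions given by a family of twisted derivations of the fibres. -/
def fibrewise (D : ∀ x, Fib (E x) (V x) →ₗ[ℝ] Fib (E x) (V x)) (τ : 𝒮 →ₐ[ℝ] 𝒮)
    (hD : ∀ (s s' : 𝒮) x, D x (s.1 x * s'.1 x) = D x (s.1 x) * s'.1 x + (τ s).1 x * D x (s'.1 x))
    (hf : ∀ f : Fn B M, (fun x => D x ((ofFn F E G V f).1 x)) ∈ 𝒮)
    (hE : ∀ α : DualSec B F E, (fun x => D x ((ofDualE G V α).1 x)) ∈ 𝒮)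
    (hV : ∀ β : DualSec B G V, (fun x => D x ((ofDualV F E β).1 x)) ∈ 𝒮) : Module.End ℝ 𝒮 where
  toFun s := ⟨fun x => D x (s.1 x),
    let T : 𝒮 →ₗ[ℝ] (∀ x, Fib (E x) (V x)) :=
      { toFun := fun s x => D x (s.1 x)
        map_add' := fun s s' => funext fun x => map_add (D x) _ _
        map_smul' := fun r s => funext fun x => map_smul (D x) _ _ }
    mem_superFun_of_leibniz (D := T) (τ := τ) hD (fun s s' x h => congrArg (D x) h.self_of_nhds)
      hf hE hV s⟩
  map_add' s s' := superFun_ext fun x => map_add (D x) _ _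
  map_smul' r s := superFun_ext fun x => map_smul (D x) _ _

/-- The contraction `i_ψ` with a section of `E`, an odd derivation of degree `-1`. -/
def contractE (ψ : Sec B F E) : Module.End ℝ 𝒮 :=
  fibrewise (fun x => contractOdd (ψ x)) (superParity B F E G V) (fun s s' x => contractOdd_mul _ _ _)
    (fun f => by
      convert zero_mem 𝒮
      exact contractOdd_algebraMap _ _)
    (fun α => by
      convert (ofFn F E G V (α.pair ψ)).2
      exact contractOdd_genOdd _ _)
    (fun β => by
      convert zero_mem 𝒮
      exact contractOdd_genEven _ _)

lemma contractE_apply (ψ : Sec B F E) (s : 𝒮) (x : M) :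
    (contractE ψ s).1 x = contractOdd (ψ x) (s.1 x) := rfl

@[simp]
lemma contractE_ofFn (ψ : Sec B F E) (f : Fn B M) : contractE ψ (ofFn F E G V f) = 0 :=
  superFun_ext fun _ => contractOdd_algebraMap _ _

@[simp]
lemma contractE_ofDualE (ψ : Sec B F E) (α : DualSec B F E) :
    contractE ψ (ofDualE G V α) = ofFn F E G V (α.pair ψ) :=
  superFun_ext fun _ => contractOdd_genOdd _ _

@[simp]
lemma contractE_ofDualV (ψ : Sec B F E) (β : DualSec B G V) :
    contractE ψ (ofDualV F E β) = 0 :=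
  superFun_ext fun _ => contractOdd_genEven _ _

lemma isOddDer_contractE (ψ : Sec B F E) :
    IsOddDer (superParity B F E G V) (contractE ψ) where
  leibniz s s' := superFun_ext fun x => contractOdd_mul _ _ _
  map_parity s := superFun_ext fun x => by
    rw [contractE_apply, superParity_apply, ← neg_neg (contractOdd _ _), ← parity_contractOdd]
    rfl

/-- The contraction `i_v` with a section of `V`, an even derivation of degree `-2`. -/
def contractV (v : Sec B G V) : Module.End ℝ 𝒮 :=
  fibrewise (fun x => contractEven (v x)) (AlgHom.id ℝ _) (fun s s' x => contractEven_mul _ _ _)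
    (fun f => by
      convert zero_mem 𝒮
      exact contractEven_algebraMap _ _)
    (fun α => by
      convert zero_mem 𝒮
      exact contractEven_genOdd _ _)
    (fun β => by
      convert (ofFn F E G V (β.pair v)).2
      exact contractEven_genEven _ _)

@[simp]
lemma contractV_ofFn (v : Sec B G V) (f : Fn B M) : contractV v (ofFn F E G V f) = 0 :=
  superFun_ext fun _ => contractEven_algebraMap _ _

@[simp]
lemma contractV_ofDualE (v : Sec B G V) (α : DualSec B F E) :
    contractV v (ofDualE G V α) = 0 :=
  superFun_ext fun _ => contractEven_genOdd _ _

@[simp]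
lemma contractV_ofDualV (v : Sec B G V) (β : DualSec B G V) :
    contractV v (ofDualV F E β) = ofFn F E G V (β.pair v) :=
  superFun_ext fun _ => contractEven_genEven _ _

lemma isEvenDer_contractV (v : Sec B G V) :
    IsEvenDer (superParity B F E G V) (contractV v) where
  leibniz s s' := superFun_ext fun x => contractEven_mul _ _ _
  map_parity s := superFun_ext fun x => (parity_contractEven _ _).symm

variable (B F E G V) in
/-- The Euler derivation, which counts the degree. -/
def superEuler : Module.End ℝ 𝒮 :=
  fibrewise (fun x => euler (E x) (V x)) (AlgHom.id ℝ _) (fun s s' x => euler_mul _ _)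
    (fun f => by
      convert zero_mem 𝒮
      exact euler_algebraMap _)
    (fun α => by
      convert (ofDualE G V α).2
      exact euler_genOdd _)
    (fun β => by
      convert ((2 : ℝ) • ofDualV F E β).2
      exact euler_genEven _)

lemma isEvenDer_superEuler :
    IsEvenDer (superParity B F E G V) (superEuler B F E G V) where
  leibniz s s' := superFun_ext fun x => euler_mul _ _
  map_parity s := superFun_ext fun x => (parity_euler _).symm

/-! ### Homogeneous functions -/

lemma isHomogeneous_ofFn (f : Fn B M) : IsHomogeneous 0 (ofFn F E G V f) :=
  fun _ => algebraMap_mem_fibDegree _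

lemma isHomogeneous_ofDualE (α : DualSec B F E) : IsHomogeneous 1 (ofDualE G V α) :=
  fun _ => genOdd_mem _

lemma isHomogeneous_ofDualV (β : DualSec B G V) : IsHomogeneous 2 (ofDualV F E β) :=
  fun _ => genEven_mem _

lemma IsHomogeneous.contractE {k : ℕ} {s : 𝒮} (hs : IsHomogeneous (k + 1) s) (ψ : Sec B F E) :
    IsHomogeneous k (contractE ψ s) := fun x => contractOdd_mem _ (hs x)

lemma IsHomogeneous.contractV {k : ℕ} {s : 𝒮} (hs : IsHomogeneous (k + 2) s) (v : Sec B G V) :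
    IsHomogeneous k (contractV v s) := fun x => contractEven_mem _ (hs x)

lemma IsHomogeneous.contractE_eq_zero {s : 𝒮} (hs : IsHomogeneous 0 s) (ψ : Sec B F E) :
    Q2.contractE ψ s = 0 := superFun_ext fun x => contractOdd_eq_zero _ (hs x)

lemma IsHomogeneous.contractV_eq_zero_of_one {s : 𝒮} (hs : IsHomogeneous 1 s) (v : Sec B G V) :
    Q2.contractV v s = 0 := superFun_ext fun x => contractEven_eq_zero_of_mem_one _ (hs x)

lemma IsHomogeneous.add {k : ℕ} {s s' : 𝒮} (hs : IsHomogeneous k s) (hs' : IsHomogeneous k s') :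
    IsHomogeneous k (s + s') := fun x => add_mem (hs x) (hs' x)

lemma IsHomogeneous.sub {k : ℕ} {s s' : 𝒮} (hs : IsHomogeneous k s) (hs' : IsHomogeneous k s') :
    IsHomogeneous k (s - s') := fun x => sub_mem (hs x) (hs' x)

lemma IsHomogeneous.superParity {k : ℕ} {s : 𝒮} (hs : IsHomogeneous k s) :
    superParity B F E G V s = (-1 : ℝ) ^ k • s := superFun_ext fun x => parity_eq_smul (hs x)

lemma IsHomogeneous.superEuler {k : ℕ} {s : 𝒮} (hs : IsHomogeneous k s) :
    superEuler B F E G V s = (k : ℝ) • s := superFun_ext fun x => euler_eq_smul (hs x)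

lemma isHomogeneous_of_superEuler {k : ℕ} {s : 𝒮} (hs : superEuler B F E G V s = (k : ℝ) • s) :
    IsHomogeneous k s := fun x => mem_fibDegree_of_euler (congrFun (congrArg Subtype.val hs) x)

lemma contractE_self (ψ : Sec B F E) (s : 𝒮) : contractE ψ (contractE ψ s) = 0 :=
  superFun_ext fun _ => contractOdd_self _ _

lemma contractV_contractE (ψ : Sec B F E) (v : Sec B G V) (s : 𝒮) :
    contractV v (contractE ψ s) = contractE ψ (contractV v s) :=
  superFun_ext fun _ => contractEven_contractOdd _ _ _

variable (B F E G V) in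
/-- The component of degree `0` of a function. -/
def bodyFn : 𝒮 →ₐ[ℝ] Fn B M where
  toFun s := ⟨fun x => scalarPart (E x) (V x) (s.1 x), fun x₀ => by
    obtain ⟨g, hg, h⟩ := exists_polySuperFun s x₀
    have key : ContMDiff 𝓘(ℝ, B) 𝓘(ℝ, ℝ) ∞ fun x => scalarPart (E x) (V x) (g.1 x) := by
      clear h
      induction hg using polySuperFun_induction with
      | hC r =>
        have : (fun x => scalarPart (E x) (V x) ((algebraMap ℝ 𝒮 r).1 x)) = fun _ => r :=
          funext fun x => AlgHom.commutes _ r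
        rw [this]
        exact contMDiff_const
      | hf f =>
        have : (fun x => scalarPart (E x) (V x) ((ofFn F E G V f).1 x)) = f :=
          funext fun x => AlgHom.commutes _ (f x)
        rw [this]
        exact f.contMDiff
      | hE α =>
        have : (fun x => scalarPart (E x) (V x) ((ofDualE G V α).1 x)) = fun _ => 0 :=
          funext fun x => scalarPart_genOdd _
        rw [this]
        exact contMDiff_const
      | hV β =>
        have : (fun x => scalarPart (E x) (V x) ((ofDualV F E β).1 x)) = fun _ => 0 :=
          funext fun x => scalarPart_genEven _
        rw [this]
        exact contMDiff_const
      | hadd a b _ _ ha hb =>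
        have : (fun x => scalarPart (E x) (V x) ((a + b).1 x)) = fun x =>
            scalarPart (E x) (V x) (a.1 x) + scalarPart (E x) (V x) (b.1 x) :=
          funext fun x => map_add _ _ _
        rw [this]
        exact ha.add hb
      | hmul a b _ _ ha hb =>
        have : (fun x => scalarPart (E x) (V x) ((a * b).1 x)) = fun x =>
            scalarPart (E x) (V x) (a.1 x) * scalarPart (E x) (V x) (b.1 x) :=
          funext fun x => map_mul _ _ _
        rw [this]
        exact ha.mul hb
    refine (key x₀).congr_of_eventuallyEq ?_
    filter_upwards [h] with x hx
    rw [hx]⟩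
  map_one' := by ext x; exact map_one (scalarPart (E x) (V x))
  map_mul' s s' := by ext x; exact map_mul (scalarPart (E x) (V x)) _ _
  map_zero' := by ext x; exact map_zero (scalarPart (E x) (V x))
  map_add' s s' := by ext x; exact map_add (scalarPart (E x) (V x)) _ _
  commutes' r := by ext x; exact AlgHom.commutes (scalarPart (E x) (V x)) r

lemma bodyFn_apply (s : 𝒮) (x : M) :
    bodyFn B F E G V s x = scalarPart (E x) (V x) (s.1 x) := rfl

@[simp]
lemma bodyFn_ofFn (f : Fn B M) : bodyFn B F E G V (ofFn F E G V f) = f := by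
  ext x
  exact AlgHom.commutes (scalarPart (E x) (V x)) _

lemma IsHomogeneous.ofFn_bodyFn {s : 𝒮} (hs : IsHomogeneous 0 s) :
    ofFn F E G V (bodyFn B F E G V s) = s :=
  superFun_ext fun x => algebraMap_scalarPart (hs x)

lemma ofFn_injective : Function.Injective (ofFn F E G V : Fn B M → 𝒮) :=
  Function.LeftInverse.injective (g := bodyFn B F E G V) bodyFn_ofFn

lemma ofFn_add (f g : Fn B M) : ofFn F E G V (f + g) = ofFn F E G V f + ofFn F E G V g :=
  superFun_ext fun _ => map_add _ _ _

lemma ofFn_sub (f g : Fn B M) : ofFn F E G V (f - g) = ofFn F E G V f - ofFn F E G V g :=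
  superFun_ext fun _ => map_sub _ _ _

lemma ofFn_mul (f g : Fn B M) : ofFn F E G V (f * g) = ofFn F E G V f * ofFn F E G V g :=
  superFun_ext fun _ => map_mul _ _ _

lemma ofFn_smul (r : ℝ) (f : Fn B M) : ofFn F E G V (r • f) = r • ofFn F E G V f :=
  superFun_ext fun _ => by
    exact (map_mul _ _ _).trans (Algebra.smul_def _ _).symm

lemma ofDualE_add (α α' : DualSec B F E) :
    ofDualE G V (α + α') = ofDualE G V α + ofDualE G V α' :=
  superFun_ext fun _ => map_add _ _ _

lemma ofDualE_smul (f : Fn B M) (α : DualSec B F E) :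
    ofDualE G V (DualSec.smul f α) = ofFn F E G V f * ofDualE G V α :=
  superFun_ext fun x => (map_smul (genOdd (E x) (V x)) _ _).trans (Algebra.smul_def _ _)

lemma ofDualV_add (β β' : DualSec B G V) :
    ofDualV F E (β + β') = ofDualV F E β + ofDualV F E β' :=
  superFun_ext fun _ => map_add _ _ _

lemma ofDualV_smul (f : Fn B M) (β : DualSec B G V) :
    ofDualV F E (DualSec.smul f β) = ofFn F E G V f * ofDualV F E β :=
  superFun_ext fun x => (map_smul (genEven (E x) (V x)) _ _).trans (Algebra.smul_def _ _)

lemma contractE_add (ψ φ : Sec B F E) [VectorBundle ℝ F E] :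
    (contractE (ψ + φ) : Module.End ℝ 𝒮) = contractE ψ + contractE φ :=
  LinearMap.ext fun _ => superFun_ext fun x => DFunLike.congr_fun (contractOdd_add (ψ x) (φ x)) _

lemma contractE_smul (f : Fn B M) (ψ : Sec B F E) [VectorBundle ℝ F E] (s : 𝒮) :
    contractE (smulSec f ψ) s = ofFn F E G V f * contractE ψ s :=
  superFun_ext fun x =>
    (DFunLike.congr_fun (contractOdd_smul (f x) (ψ x)) _).trans
      (Algebra.smul_def (f x) (contractOdd (ψ x) (s.1 x)))

lemma contractV_add (v w : Sec B G V) [VectorBundle ℝ G V] :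
    (contractV (v + w) : Module.End ℝ 𝒮) = contractV v + contractV w :=
  LinearMap.ext fun _ => superFun_ext fun x => DFunLike.congr_fun (contractEven_add (v x) (w x)) _

lemma contractV_smul (f : Fn B M) (v : Sec B G V) [VectorBundle ℝ G V] (s : 𝒮) :
    contractV (smulSec f v) s = ofFn F E G V f * contractV v s :=
  superFun_ext fun x =>
    (DFunLike.congr_fun (contractEven_smul (f x) (v x)) _).trans
      (Algebra.smul_def (f x) (contractEven (v x) (s.1 x)))

lemma ofFn_mul_comm (f : Fn B M) (s : 𝒮) : ofFn F E G V f * s = s * ofFn F E G V f :=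
  superFun_ext fun _ => Algebra.commutes _ _

/-! ### Locality -/

/-- The operator `D` is local. -/
def IsLocalOp (D : Module.End ℝ 𝒮) : Prop :=
  ∀ s x, (∀ᶠ y in 𝓝 x, s.1 y = 0) → (D s).1 x = 0

lemma IsLocalOp.congr {D : Module.End ℝ 𝒮} (hD : IsLocalOp D) {s s' : 𝒮} {x : M}
    (h : ∀ᶠ y in 𝓝 x, s.1 y = s'.1 y) : (D s).1 x = (D s').1 x := by
  have := hD (s - s') x (by
    filter_upwards [h] with y hy
    exact sub_eq_zero.2 hy)
  rw [map_sub] at this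
  exact sub_eq_zero.1 this

lemma IsLocalOp.eventually {D : Module.End ℝ 𝒮} (hD : IsLocalOp D) {s : 𝒮} {x : M}
    (h : ∀ᶠ y in 𝓝 x, s.1 y = 0) : ∀ᶠ y in 𝓝 x, (D s).1 y = 0 := by
  filter_upwards [eventually_eventually_nhds.2 h] with y hy
  exact hD s y hy

lemma IsLocalOp.mul {D D' : Module.End ℝ 𝒮} (hD : IsLocalOp D) (hD' : IsLocalOp D') :
    IsLocalOp (D * D') := fun _ x h => hD _ x (hD'.eventually h)

lemma IsLocalOp.add {D D' : Module.End ℝ 𝒮} (hD : IsLocalOp D) (hD' : IsLocalOp D') :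
    IsLocalOp (D + D') := fun s x h => by
  change (D s).1 x + (D' s).1 x = 0
  rw [hD s x h, hD' s x h, add_zero]

lemma isLocalOp_superParity : IsLocalOp (superParity B F E G V).toLinearMap := fun s x h => by
  change parity _ _ (s.1 x) = 0
  rw [h.self_of_nhds, map_zero]

lemma IsLocalOp.eq_zero {D : Module.End ℝ 𝒮} (hD : IsLocalOp D)
    (h : ∀ s ∈ polySuperFun B F E G V, D s = 0) : D = 0 := by
  refine LinearMap.ext fun s => superFun_ext fun x => ?_
  obtain ⟨g, hg, hs⟩ := exists_polySuperFun s x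
  rw [hD.congr hs, h g hg]
  rfl

section

variable [FiniteDimensional ℝ B] [T2Space M] [IsManifold 𝓘(ℝ, B) ∞ M]

/-- If `s` vanishes near `x`, then `χ s = 0` for a bump function `χ` at `x` supported there; the
Leibniz rule at `x` then reduces to `(D s)(x) = 0`. -/
lemma isLocalOp_of_leibniz {D : Module.End ℝ 𝒮}
    (hD : ∀ f s, D (ofFn F E G V f * s) = D (ofFn F E G V f) * s + ofFn F E G V f * D s) :
    IsLocalOp D := fun s x h => by
  obtain ⟨χ, h1, h2⟩ := exists_bump B h
  have h0 : ofFn F E G V χ * s = 0 := superFun_ext fun y => by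
    change algebraMap ℝ _ (χ y) * s.1 y = 0
    by_cases hy : y ∈ tsupport χ
    · rw [show s.1 y = 0 from h2 hy, mul_zero]
    · rw [image_eq_zero_of_notMem_tsupport hy, map_zero, zero_mul]
  have h3 := congrFun (congrArg Subtype.val (hD χ s)) x
  rw [h0, map_zero] at h3
  change 0 = (D (ofFn F E G V χ)).1 x * s.1 x + algebraMap ℝ _ (χ x) * (D s).1 x at h3
  rwa [h.self_of_nhds, mul_zero, zero_add, h1.self_of_nhds, map_one, one_mul, eq_comm] at h3

/-- Locality reduces the claim to polynomials in the generators. The twist `τ` is the identity for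
even derivations and the parity for odd ones. -/
lemma eq_zero_of_generators {D : Module.End ℝ 𝒮} {τ : 𝒮 →ₐ[ℝ] 𝒮}
    (hD : ∀ s s', D (s * s') = D s * s' + τ s * D s') (hτ : ∀ f, τ (ofFn F E G V f) = ofFn F E G V f)
    (hf : ∀ f, D (ofFn F E G V f) = 0) (hE : ∀ α, D (ofDualE G V α) = 0)
    (hV : ∀ β, D (ofDualV F E β) = 0) : D = 0 := by
  refine (isLocalOp_of_leibniz fun f s => by rw [hD, hτ]).eq_zero fun s hs => ?_
  induction hs using polySuperFun_induction with
  | hC r => exact hf (ContMDiffMap.const r)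
  | hf f => exact hf f
  | hE α => exact hE α
  | hV β => exact hV β
  | hadd a b _ _ ha hb => rw [map_add, ha, hb, add_zero]
  | hmul a b _ _ ha hb => rw [hD, ha, hb, zero_mul, mul_zero, add_zero]

lemma IsEvenDer.eq_zero {D : Module.End ℝ 𝒮} (hD : IsEvenDer (superParity B F E G V) D)
    (hf : ∀ f, D (ofFn F E G V f) = 0) (hE : ∀ α, D (ofDualE G V α) = 0)
    (hV : ∀ β, D (ofDualV F E β) = 0) : D = 0 :=
  eq_zero_of_generators (τ := AlgHom.id ℝ _) hD.leibniz (fun _ => rfl) hf hE hV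

lemma IsOddDer.eq_zero {D : Module.End ℝ 𝒮} (hD : IsOddDer (superParity B F E G V) D)
    (hf : ∀ f, D (ofFn F E G V f) = 0) (hE : ∀ α, D (ofDualE G V α) = 0)
    (hV : ∀ β, D (ofDualV F E β) = 0) : D = 0 :=
  eq_zero_of_generators hD.leibniz superParity_ofFn hf hE hV

/-- An odd derivation that maps the generators to functions of the right degree has degree `1`. -/
lemma IsOddDer.degree_one {D : Module.End ℝ 𝒮} (hD : IsOddDer (superParity B F E G V) D)
    (hf : ∀ f, IsHomogeneous 1 (D (ofFn F E G V f)))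
    (hE : ∀ α, IsHomogeneous 2 (D (ofDualE G V α)))
    (hV : ∀ β, IsHomogeneous 3 (D (ofDualV F E β))) {k : ℕ} {s : 𝒮} (hs : IsHomogeneous k s) :
    IsHomogeneous (k + 1) (D s) := by
  -- The relation `[ε, D] = D` with the Euler derivation `ε` says that `D` raises degrees by one. As
  -- both sides are odd derivations, generators suffice.
  have key : superEuler B F E G V * D - D * superEuler B F E G V - D = 0 := by
    refine ((isEvenDer_superEuler.commutator_odd hD).sub hD).eq_zero (fun f => ?_) (fun α => ?_)
      fun β => ?_
    · simp only [LinearMap.sub_apply, Module.End.mul_apply, (hf f).superEuler,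
        (isHomogeneous_ofFn f).superEuler]
      simp
    · simp only [LinearMap.sub_apply, Module.End.mul_apply, (hE α).superEuler,
        (isHomogeneous_ofDualE α).superEuler, map_smul, ← sub_smul]
      norm_num
    · simp only [LinearMap.sub_apply, Module.End.mul_apply, (hV β).superEuler,
        (isHomogeneous_ofDualV β).superEuler, map_smul, ← sub_smul]
      norm_num
  have := LinearMap.congr_fun key s
  simp only [LinearMap.sub_apply, Module.End.mul_apply, hs.superEuler, map_smul,
    LinearMap.zero_apply, sub_eq_zero] at this
  refine isHomogeneous_of_superEuler ?_
  rw [sub_eq_iff_eq_add.1 this, Nat.cast_add, Nat.cast_one, add_smul, one_smul, add_comm]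

/-- The graded Leibniz rule is given for a homogeneous first factor only, and a general function
need not be a global polynomial in homogeneous ones. The rule with parity is proved on polynomials
by induction and extended by locality. -/
lemma QStructure.isOddDer (q : QStructure B F E G V) : IsOddDer (superParity B F E G V) q.Q := by
  have hloc : IsLocalOp q.Q := isLocalOp_of_leibniz fun f s => by
    rw [q.graded_leibniz 0 _ _ (isHomogeneous_ofFn f), pow_zero, one_smul]
  have hom {k : ℕ} {s : 𝒮} (hs : IsHomogeneous k s) (s' : 𝒮) :
      q.Q (s * s') = q.Q s * s' + superParity B F E G V s * q.Q s' := by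
    rw [q.graded_leibniz k _ _ hs, hs.superParity, smul_mul_assoc]
  have hom' {k : ℕ} {s : 𝒮} (hs : IsHomogeneous k s) :
      q.Q (superParity B F E G V s) = -superParity B F E G V (q.Q s) := by
    rw [hs.superParity, (q.degree_one k s hs).superParity, map_smul, pow_succ, mul_neg_one,
      neg_smul, neg_neg]
  have hpoly {s : 𝒮} (hs : s ∈ polySuperFun B F E G V) (s' : 𝒮) : q.Q (s * s') =
      q.Q s * s' + superParity B F E G V s * q.Q s' := by
    induction hs using polySuperFun_induction generalizing s' with
    | hC r => exact hom (isHomogeneous_ofFn (ContMDiffMap.const r)) s'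
    | hf f => exact hom (isHomogeneous_ofFn f) s'
    | hE α => exact hom (isHomogeneous_ofDualE α) s'
    | hV β => exact hom (isHomogeneous_ofDualV β) s'
    | hadd a b _ _ ha hb =>
      rw [add_mul, map_add, ha, hb, map_add, map_add]
      noncomm_ring
    | hmul a b _ _ ha hb =>
      rw [mul_assoc, ha, hb, ha, map_mul]
      noncomm_ring
  have leib (s s' : 𝒮) : q.Q (s * s') = q.Q s * s' + superParity B F E G V s * q.Q s' := by
    refine superFun_ext fun x => ?_
    obtain ⟨g, hg, h⟩ := exists_polySuperFun s x
    have h1 : (q.Q (s * s')).1 x = (q.Q (g * s')).1 x := hloc.congr (by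
      filter_upwards [h] with y hy
      exact congrArg (· * s'.1 y) hy)
    rw [h1, hpoly hg]
    change (q.Q g).1 x * s'.1 x + parity _ _ (g.1 x) * (q.Q s').1 x =
      (q.Q s).1 x * s'.1 x + parity _ _ (s.1 x) * (q.Q s').1 x
    rw [← hloc.congr h, h.self_of_nhds]
  have key := ((hloc.mul isLocalOp_superParity).add (isLocalOp_superParity.mul hloc)).eq_zero ?_
  · exact ⟨leib, fun s => eq_neg_of_add_eq_zero_left (LinearMap.congr_fun key s)⟩
  intro s hs
  refine (add_eq_zero_iff_eq_neg (G := 𝒮)).2 ?_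
  change q.Q (superParity B F E G V s) = -superParity B F E G V (q.Q s)
  induction hs using polySuperFun_induction with
  | hC r => exact hom' (isHomogeneous_ofFn (ContMDiffMap.const r))
  | hf f => exact hom' (isHomogeneous_ofFn f)
  | hE α => exact hom' (isHomogeneous_ofDualE α)
  | hV β => exact hom' (isHomogeneous_ofDualV β)
  | hadd a b _ _ ha hb => rw [map_add, map_add, ha, hb, map_add, map_add, neg_add]
  | hmul a b _ _ ha hb =>
    rw [map_mul, leib, leib, ha, hb, map_add, map_mul, map_mul, neg_mul, mul_neg, neg_add]

end

/-! ### Construction of functions -/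

section

variable [FiniteDimensional ℝ B] [T2Space M] [IsManifold 𝓘(ℝ, B) ∞ M]
  [VectorBundle ℝ F E] [FiniteDimensional ℝ F] [ContMDiffVectorBundle ∞ F E 𝓘(ℝ, B)]

/-- Pointwise this is `exists_eq_genOdd`. Smoothness holds because the coefficients in a dual frame
are the contractions of `s` with the frame. -/
lemma IsHomogeneous.exists_ofDualE {s : 𝒮} (hs : IsHomogeneous 1 s) :
    ∃ α : DualSec B F E, ofDualE G V α = s := by
  choose α hα using fun x => exists_eq_genOdd (hs x)
  refine ⟨⟨α, fun p => ?_⟩, superFun_ext fun x => (hα x).symm⟩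
  obtain ⟨n, e, ξ, h⟩ := exists_dualFrame B F E p.1
  have hsm : ContMDiffAt (𝓘(ℝ, B).prod 𝓘(ℝ, F)) 𝓘(ℝ, ℝ) ∞ (fun p : TotalSpace F E =>
      ∑ i, bodyFn B F E G V (Q2.contractE (e i) s) p.1 * (ξ i).toFun p.1 p.2) p := by
    refine ContMDiffAt.sum fun i _ => ContMDiffAt.mul ?_ (ξ i).smooth.contMDiffAt
    exact (bodyFn B F E G V (Q2.contractE (e i) s)).contMDiff.contMDiffAt.comp p
      (contMDiff_proj E).contMDiffAt
  refine hsm.congr_of_eventuallyEq ?_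
  filter_upwards [(FiberBundle.continuous_proj F E).continuousAt.eventually h] with p hp
  conv_lhs => rw [← hp p.2, map_sum]
  refine Finset.sum_congr rfl fun i _ => ?_
  rw [map_smul, smul_eq_mul, mul_comm, bodyFn_apply, contractE_apply, hα, contractOdd_genOdd,
    AlgHom.commutes]
  rfl

variable [VectorBundle ℝ G V] [FiniteDimensional ℝ G] [ContMDiffVectorBundle ∞ G V 𝓘(ℝ, B)]

/-- The Euler formula in dual frames near `x₀` writes `k t` as a combination of generators with the
contractions of `t` as coefficients. Iterated, this reduces the smoothness of a homogeneous field to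
that of scalar functions. -/
lemma mem_superFun_of_contract {k : ℕ} (hk : k ≠ 0) {t : ∀ x, Fib (E x) (V x)}
    (ht : ∀ x, t x ∈ fibDegree (E x) (V x) k)
    (hE : ∀ ψ : Sec B F E, (fun x => contractOdd (ψ x) (t x)) ∈ 𝒮)
    (hV : ∀ v : Sec B G V, (fun x => contractEven (v x) (t x)) ∈ 𝒮) : t ∈ 𝒮 := by
  refine mem_superFun_of_eventually fun x₀ => ?_
  obtain ⟨n, e, ξ, h⟩ := exists_dualFrame B F E x₀
  obtain ⟨m, b, η, h'⟩ := exists_dualFrame B G V x₀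
  refine ⟨(k : ℝ)⁻¹ • (∑ i, ofDualE G V (ξ i) * ⟨_, hE (e i)⟩ +
    (2 : ℝ) • ∑ j, ofDualV F E (η j) * ⟨_, hV (b j)⟩), ?_⟩
  filter_upwards [h, h'] with x hx hx'
  have h1 := euler_eq_sum hx hx' (t x)
  rw [euler_eq_smul (ht x)] at h1
  rw [← inv_smul_smul₀ (Nat.cast_ne_zero.2 hk : (k : ℝ) ≠ 0) (t x), h1]
  simp only [SetLike.val_smul, AddMemClass.coe_add, AddSubmonoidClass.coe_finsetSum,
    Pi.smul_apply, Pi.add_apply, Finset.sum_apply]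
  rfl

lemma eq_zero_of_contract_superFun {k : ℕ} (hk : k ≠ 0) {s : 𝒮} (hs : IsHomogeneous k s)
    (hE : ∀ ψ : Sec B F E, contractE ψ s = 0) (hV : ∀ v : Sec B G V, contractV v s = 0) :
    s = 0 := by
  refine superFun_ext fun x => ?_
  have := finiteDimensional_fibre F E x
  have := finiteDimensional_fibre G V x
  refine eq_zero_of_contract hk (hs x) (fun u => ?_) fun w => ?_
  · obtain ⟨ψ, rfl⟩ := exists_sec_apply_eq B F x u
    exact congrFun (congrArg Subtype.val (hE ψ)) x
  · obtain ⟨v, rfl⟩ := exists_sec_apply_eq B G x w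
    exact congrFun (congrArg Subtype.val (hV v)) x

end

end SuperFunctions

/-! ### Graded Jacobi identities used when `Q² = 0` -/

section Commutators

variable {R : Type*} [Ring R]

/-- Both sides equal `Q i Q`. For `i = i_ψ` this says that `L_ψ` commutes with `Q`. -/
lemma commute_anticommutator {Q i : R} (hQ : Q * Q = 0) :
    (Q * i + i * Q) * Q = Q * (Q * i + i * Q) := by
  rw [add_mul, mul_add, mul_assoc i, hQ, mul_zero, add_zero, ← mul_assoc Q Q, hQ, zero_mul,
    zero_add, mul_assoc]

/-- The case `[L, [Q, j]] = [Q, [L, j]]` of the graded Jacobi identity for odd `j`; with `L = L_ψ`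
and `j = i_φ` it yields `[L_ψ, L_φ] = L_{[ψ,φ]}`. -/
lemma commutator_anticommutator {Q L j k : R} (h : L * Q = Q * L) (hk : L * j - j * L = k) :
    L * (Q * j + j * Q) - (Q * j + j * Q) * L = Q * k + k * Q := by
  have h1 : L * (Q * j + j * Q) - (Q * j + j * Q) * L =
      (L * Q) * j + L * j * Q - Q * j * L - j * (Q * L) := by noncomm_ring
  have e1 : L * Q * j = Q * (L * j) := by rw [h, mul_assoc]
  have e2 : j * (Q * L) = j * L * Q := by rw [← h, mul_assoc]
  rw [h1, e1, e2, ← hk]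
  noncomm_ring

/-- The same for even `j`; with `j = i_v` it yields `[L_ψ, L_v] = L_{∇_ψ v}`. -/
lemma commutator_commutator {Q L j k : R} (h : L * Q = Q * L) (hk : L * j - j * L = k) :
    L * (Q * j - j * Q) - (Q * j - j * Q) * L = Q * k - k * Q := by
  have h1 : L * (Q * j - j * Q) - (Q * j - j * Q) * L =
      (L * Q) * j - L * j * Q - Q * j * L + j * (Q * L) := by noncomm_ring
  have e1 : L * Q * j = Q * (L * j) := by rw [h, mul_assoc]
  have e2 : j * (Q * L) = j * L * Q := by rw [← h, mul_assoc]
  rw [h1, e1, e2, ← hk]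
  noncomm_ring

lemma jacobi_commutator {L L' j k k' l l' : R} (h : L * j - j * L = k)
    (h' : L' * j - j * L' = k') (hl : L * k' - k' * L = l) (hl' : L' * k - k * L' = l') :
    (L * L' - L' * L) * j - j * (L * L' - L' * L) = l - l' := by
  rw [← hl, ← hl', ← h, ← h']
  noncomm_ring

/-- `[Q, i]` anticommutes with `Q` because `Q² = 0`, and it commutes with `j`; so its anticommutator
with `[Q, j]` vanishes by the graded Jacobi identity. With `i = i_v` and `j = i_w` it yields `[L_v,
L_w] = 0`. -/
lemma anticommutator_commutator {Q i j : R} (hQ : Q * Q = 0)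
    (h : j * (Q * i - i * Q) = (Q * i - i * Q) * j) :
    (Q * i - i * Q) * (Q * j - j * Q) + (Q * j - j * Q) * (Q * i - i * Q) = 0 := by
  have h1 : (Q * i - i * Q) * Q = -(Q * (Q * i - i * Q)) := by
    rw [sub_mul, mul_assoc i, hQ, mul_zero, mul_sub, ← mul_assoc Q Q, hQ, zero_mul, mul_assoc]
    abel
  generalize Q * i - i * Q = L at h h1
  have h2 : L * (Q * j - j * Q) + (Q * j - j * Q) * L =
      (L * Q) * j - (L * j) * Q + Q * (j * L) - j * (Q * L) := by noncomm_ring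
  rw [h2, h, h1, ← h]
  have h3 : Q * L = -(L * Q) := by rw [h1, neg_neg]
  rw [mul_assoc j, h1]
  have h4 : -(Q * L) * j = -(Q * (j * L)) := by rw [h]; noncomm_ring
  rw [h4]
  noncomm_ring

end Commutators

/-! ### The Cartan calculus of an anomaly-free odd vector field -/

section Components

variable {B : Type*} [NormedAddCommGroup B] [NormedSpace ℝ B] [FiniteDimensional ℝ B]
  {M : Type*} [TopologicalSpace M] [ChartedSpace B M] [IsManifold 𝓘(ℝ, B) ∞ M]
  {F : Type*} [NormedAddCommGroup F] [NormedSpace ℝ F]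
  {E : M → Type*} [TopologicalSpace (TotalSpace F E)] [∀ x, TopologicalSpace (E x)]
  [∀ x, AddCommGroup (E x)] [∀ x, Module ℝ (E x)] [FiberBundle F E] [VectorBundle ℝ F E]
  {G : Type*} [NormedAddCommGroup G] [NormedSpace ℝ G]
  {V : M → Type*} [TopologicalSpace (TotalSpace G V)] [∀ x, TopologicalSpace (V x)]
  [∀ x, AddCommGroup (V x)] [∀ x, Module ℝ (V x)] [FiberBundle G V] [VectorBundle ℝ G V]

local notation "𝒮" => superFun B F E G V
local notation "TM" => (TangentSpace 𝓘(ℝ, B) : M → Type _)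

/-! ### Pairings and Lie derivatives of functions -/

lemma DualSec.pair_add (α : DualSec B F E) (ψ φ : Sec B F E) :
    α.pair (ψ + φ) = α.pair ψ + α.pair φ := by
  ext x
  exact map_add (α.toFun x) _ _

lemma DualSec.pair_const_smul (α : DualSec B F E) (r : ℝ) (ψ : Sec B F E) :
    α.pair (r • ψ) = r • α.pair ψ := by
  ext x
  exact map_smul (α.toFun x) _ _

lemma DualSec.pair_smulSec (α : DualSec B F E) (f : Fn B M) (ψ : Sec B F E) :
    α.pair (smulSec f ψ) = f * α.pair ψ := by
  ext x
  exact map_smul (α.toFun x) _ _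

lemma DualSec.add_pair (α α' : DualSec B F E) (ψ : Sec B F E) :
    (α + α').pair ψ = α.pair ψ + α'.pair ψ := rfl

lemma DualSec.smul_pair (f : Fn B M) (α : DualSec B F E) (ψ : Sec B F E) :
    (DualSec.smul f α).pair ψ = f * α.pair ψ := rfl

lemma lieDeriv_add (X : Sec B B TM) (f g : Fn B M) :
    lieDeriv X (f + g) = lieDeriv X f + lieDeriv X g := by
  ext x
  exact dirDeriv_add f g x _

lemma lieDeriv_mul (X : Sec B B TM) (f g : Fn B M) :
    lieDeriv X (f * g) = f * lieDeriv X g + g * lieDeriv X f := by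
  ext x
  exact dirDeriv_mul f g x _

lemma lieDeriv_const_smul (X : Sec B B TM) (r : ℝ) (f : Fn B M) :
    lieDeriv X (r • f) = r • lieDeriv X f := by
  ext x
  exact dirDeriv_const_smul r f x _

lemma add_lieDeriv (X Y : Sec B B TM) (f : Fn B M) :
    lieDeriv (X + Y) f = lieDeriv X f + lieDeriv Y f := by
  ext x
  exact dirDeriv_vadd f x _ _

lemma const_smul_lieDeriv (r : ℝ) (X : Sec B B TM) (f : Fn B M) :
    lieDeriv (r • X) f = r • lieDeriv X f := by
  ext x
  exact dirDeriv_vsmul f x _ _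

lemma smulSec_lieDeriv (g : Fn B M) (X : Sec B B TM) (f : Fn B M) :
    lieDeriv (smulSec g X) f = g * lieDeriv X f := by
  ext x
  exact dirDeriv_vsmul f x _ _

section OnSec

variable {F' : Type*} [NormedAddCommGroup F'] [NormedSpace ℝ F']
  {E' : M → Type*} [TopologicalSpace (TotalSpace F' E')] [∀ x, TopologicalSpace (E' x)]
  [∀ x, AddCommGroup (E' x)] [∀ x, Module ℝ (E' x)] [FiberBundle F' E'] [VectorBundle ℝ F' E']

lemma BundleMap.onSec_add (φ : BundleMap B F E F' E') (ψ ψ' : Sec B F E) :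
    φ.onSec (ψ + ψ') = φ.onSec ψ + φ.onSec ψ' := by
  ext x
  exact map_add (φ.toFun x) _ _

lemma BundleMap.onSec_const_smul (φ : BundleMap B F E F' E') (r : ℝ) (ψ : Sec B F E) :
    φ.onSec (r • ψ) = r • φ.onSec ψ := by
  ext x
  exact map_smul (φ.toFun x) _ _

lemma BundleMap.onSec_smulSec (φ : BundleMap B F E F' E') (f : Fn B M) (ψ : Sec B F E) :
    φ.onSec (smulSec f ψ) = smulSec f (φ.onSec ψ) := by
  ext x
  exact map_smul (φ.toFun x) _ _

end OnSec

/-! ### The components of an odd vector field of degree one -/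

/-- `Q` is an odd derivation of degree `1` without anomaly that is built from the anchor `ρ`, the
bracket `br`, the map `t` and the connection `nab`. -/
structure Components (Q : Module.End ℝ 𝒮) (ρ : BundleMap B F E B TM)
    (br : Sec B F E → Sec B F E → Sec B F E) (t : BundleMap B G V F E)
    (nab : Sec B F E → Sec B G V → Sec B G V) : Prop where
  isOddDer : IsOddDer (superParity B F E G V) Q
  degree_fn : ∀ f, IsHomogeneous 1 (Q (ofFn F E G V f))
  degree_dualE : ∀ α, IsHomogeneous 2 (Q (ofDualE G V α))
  degree_dualV : ∀ β, IsHomogeneous 3 (Q (ofDualV F E β))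
  anchor : ∀ f ψ, contractE ψ (Q (ofFn F E G V f)) = ofFn F E G V (lieDeriv (ρ.onSec ψ) f)
  bracket : ∀ α ψ φ, contractE φ (contractE ψ (Q (ofDualE G V α))) =
    ofFn F E G V (lieDeriv (ρ.onSec ψ) (α.pair φ) - lieDeriv (ρ.onSec φ) (α.pair ψ) -
      α.pair (br ψ φ))
  t : ∀ α v, contractV v (Q (ofDualE G V α)) = ofFn F E G V (α.pair (t.onSec v))
  conn : ∀ β ψ v, contractV v (contractE ψ (Q (ofDualV F E β))) =
    ofFn F E G V (lieDeriv (ρ.onSec ψ) (β.pair v) - β.pair (nab ψ v))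
  anomaly : ∀ β ψ φ, contractE φ (contractE ψ (Q (ofDualV F E β))) = 0

/-- The Lie derivative `L_ψ = [Q, i_ψ]`. -/
def lieE (Q : Module.End ℝ 𝒮) (ψ : Sec B F E) : Module.End ℝ 𝒮 :=
  Q * contractE ψ + contractE ψ * Q

/-- The Lie derivative `L_v = [Q, i_v]`. -/
def lieV (Q : Module.End ℝ 𝒮) (v : Sec B G V) : Module.End ℝ 𝒮 :=
  Q * contractV v - contractV v * Q

lemma lieE_apply (Q : Module.End ℝ 𝒮) (ψ : Sec B F E) (s : 𝒮) :
    lieE Q ψ s = Q (contractE ψ s) + contractE ψ (Q s) := rfl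

lemma lieV_apply (Q : Module.End ℝ 𝒮) (v : Sec B G V) (s : 𝒮) :
    lieV Q v s = Q (contractV v s) - contractV v (Q s) := rfl

lemma IsOddDer.lieE {Q : Module.End ℝ 𝒮} (hQ : IsOddDer (superParity B F E G V) Q)
    (ψ : Sec B F E) : IsEvenDer (superParity B F E G V) (lieE Q ψ) :=
  IsOddDer.anticommutator superParity_superParity hQ (isOddDer_contractE ψ)

lemma IsOddDer.lieV {Q : Module.End ℝ 𝒮} (hQ : IsOddDer (superParity B F E G V) Q)
    (v : Sec B G V) : IsOddDer (superParity B F E G V) (lieV Q v) := by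
  have h := (isEvenDer_contractV (F := F) (E := E) v).commutator_odd hQ
  refine ⟨fun a b => ?_, fun a => ?_⟩
  · have := h.leibniz a b
    simp only [LinearMap.sub_apply, Module.End.mul_apply] at this
    simp only [lieV_apply]
    rw [← neg_sub, this]
    noncomm_ring
  · have := h.map_parity a
    simp only [LinearMap.sub_apply, Module.End.mul_apply] at this
    simp only [lieV_apply]
    rw [← neg_sub, this, ← map_neg, neg_sub]

namespace Components

variable [T2Space M]
  {Q : Module.End ℝ (superFun B F E G V)}
  {ρ : BundleMap B F E B (TangentSpace 𝓘(ℝ, B) : M → Type _)}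
  {br : Sec B F E → Sec B F E → Sec B F E} {t : BundleMap B G V F E}
  {nab : Sec B F E → Sec B G V → Sec B G V}

lemma lieE_ofFn (h : Components Q ρ br t nab) (ψ : Sec B F E) (f : Fn B M) :
    lieE Q ψ (ofFn F E G V f) = ofFn F E G V (lieDeriv (ρ.onSec ψ) f) := by
  rw [lieE_apply, contractE_ofFn, map_zero, zero_add, h.anchor]

lemma lieE_ofDualE (h : Components Q ρ br t nab) (ψ : Sec B F E) (α : DualSec B F E) :
    lieE Q ψ (ofDualE G V α) =
      Q (ofFn F E G V (α.pair ψ)) + contractE ψ (Q (ofDualE G V α)) := by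
  rw [lieE_apply, contractE_ofDualE]

lemma isHomogeneous_lieE_ofDualE (h : Components Q ρ br t nab) (ψ : Sec B F E)
    (α : DualSec B F E) : IsHomogeneous 1 (lieE Q ψ (ofDualE G V α)) := by
  rw [h.lieE_ofDualE]
  exact (h.degree_fn _).add ((h.degree_dualE α).contractE ψ)

/-- Both sides are odd derivations. On `α` the identity is the definition of the bracket. On `β` it
reads `i_φ i_ψ Q β = 0`, which is the vanishing of the anomaly. -/
lemma lieE_contractE (h : Components Q ρ br t nab) (ψ φ : Sec B F E) :
    lieE Q ψ * contractE φ - contractE φ * lieE Q ψ = contractE (br ψ φ) := by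
  rw [← sub_eq_zero]
  refine (((h.isOddDer.lieE ψ).commutator_odd (isOddDer_contractE φ)).sub
    (isOddDer_contractE (br ψ φ))).eq_zero (fun f => ?_) (fun α => ?_) fun β => ?_
  · simp only [LinearMap.sub_apply, Module.End.mul_apply, h.lieE_ofFn, contractE_ofFn, map_zero,
      sub_zero]
  · simp only [LinearMap.sub_apply, Module.End.mul_apply, contractE_ofDualE, h.lieE_ofFn,
      h.lieE_ofDualE, map_add, h.anchor, h.bracket, ofFn_sub]
    abel
  · simp only [LinearMap.sub_apply, Module.End.mul_apply, contractE_ofDualV, map_zero,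
      lieE_apply, h.anomaly, zero_add, sub_zero]

/-- On `f` and `α` both sides vanish for reasons of degree; on `β` the identity is the definition of
the connection. -/
lemma lieE_contractV (h : Components Q ρ br t nab) (ψ : Sec B F E) (v : Sec B G V) :
    lieE Q ψ * contractV v - contractV v * lieE Q ψ = contractV (nab ψ v) := by
  rw [← sub_eq_zero]
  refine (((h.isOddDer.lieE ψ).commutator (isEvenDer_contractV v)).sub
    (isEvenDer_contractV (nab ψ v))).eq_zero (fun f => ?_) (fun α => ?_) fun β => ?_
  · simp only [LinearMap.sub_apply, Module.End.mul_apply, h.lieE_ofFn, contractV_ofFn, map_zero,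
      sub_zero]
  · simp only [LinearMap.sub_apply, Module.End.mul_apply, contractV_ofDualE, map_zero,
      (h.isHomogeneous_lieE_ofDualE ψ α).contractV_eq_zero_of_one v, sub_zero]
  · simp only [LinearMap.sub_apply, Module.End.mul_apply, contractV_ofDualV, h.lieE_ofFn,
      lieE_apply, contractE_ofDualV, map_zero, zero_add, h.conn, ofFn_sub]
    abel

lemma lieV_ofFn (h : Components Q ρ br t nab) (v : Sec B G V) (f : Fn B M) :
    lieV Q v (ofFn F E G V f) = 0 := by
  rw [lieV_apply, contractV_ofFn, map_zero, zero_sub,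
    (h.degree_fn f).contractV_eq_zero_of_one, neg_zero]

lemma lieV_ofDualE (h : Components Q ρ br t nab) (v : Sec B G V) (α : DualSec B F E) :
    lieV Q v (ofDualE G V α) = -ofFn F E G V (α.pair (t.onSec v)) := by
  rw [lieV_apply, contractV_ofDualE, map_zero, zero_sub, h.t]

lemma isHomogeneous_lieV_ofDualV (h : Components Q ρ br t nab) (v : Sec B G V)
    (β : DualSec B G V) : IsHomogeneous 1 (lieV Q v (ofDualV F E β)) := by
  rw [lieV_apply, contractV_ofDualV]
  exact (h.degree_fn _).sub ((h.degree_dualV β).contractV v)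

lemma contractE_lieV_ofDualV (h : Components Q ρ br t nab) (ψ : Sec B F E) (v : Sec B G V)
    (β : DualSec B G V) :
    contractE ψ (lieV Q v (ofDualV F E β)) = ofFn F E G V (β.pair (nab ψ v)) := by
  rw [lieV_apply, contractV_ofDualV, map_sub, h.anchor, ← contractV_contractE, h.conn, ofFn_sub]
  abel

/-- The commutator has degree -3, while the generators have degree at most 2. -/
lemma contractV_lieV (h : Components Q ρ br t nab) (v w : Sec B G V) :
    contractV w * lieV Q v = lieV Q v * contractV w := by
  rw [← sub_eq_zero]
  refine ((isEvenDer_contractV w).commutator_odd (h.isOddDer.lieV v)).eq_zero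
    (fun f => ?_) (fun α => ?_) fun β => ?_
  · simp only [LinearMap.sub_apply, Module.End.mul_apply, h.lieV_ofFn, contractV_ofFn, map_zero,
      sub_zero]
  · simp only [LinearMap.sub_apply, Module.End.mul_apply, contractV_ofDualE, h.lieV_ofDualE,
      map_neg, contractV_ofFn, map_zero, neg_zero, sub_zero]
  · simp only [LinearMap.sub_apply, Module.End.mul_apply, contractV_ofDualV, h.lieV_ofFn,
      (h.isHomogeneous_lieV_ofDualV v β).contractV_eq_zero_of_one, sub_zero]

/-- The operator `L_v + i_{t v}` annihilates the functions of degree one. -/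
lemma lieV_add_contractE_eq_zero (h : Components Q ρ br t nab) (v : Sec B G V) {s : 𝒮}
    (hs : IsHomogeneous 1 s) [FiniteDimensional ℝ F] [ContMDiffVectorBundle ∞ F E 𝓘(ℝ, B)] :
    lieV Q v s + contractE (t.onSec v) s = 0 := by
  obtain ⟨α, rfl⟩ := hs.exists_ofDualE
  rw [h.lieV_ofDualE, contractE_ofDualE, neg_add_cancel]

/-! ### The crossed module of a Q-structure -/

section Square

variable [FiniteDimensional ℝ F] [ContMDiffVectorBundle ∞ F E 𝓘(ℝ, B)]

/-- Turns identities between operators into identities between sections. -/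
lemma contractE_injective : Function.Injective
    (contractE : Sec B F E → Module.End ℝ (superFun B F E G V)) := fun ψ φ hψ =>
  Sec.ext_pair fun α => ofFn_injective (F := F) (E := E) (G := G) (V := V) <| by
    rw [← contractE_ofDualE, hψ, contractE_ofDualE]

lemma contractV_injective [FiniteDimensional ℝ G] [ContMDiffVectorBundle ∞ G V 𝓘(ℝ, B)] :
    Function.Injective (contractV : Sec B G V → Module.End ℝ (superFun B F E G V)) :=
  fun v w hv => Sec.ext_pair fun β => ofFn_injective (F := F) (E := E) (G := G) (V := V) <| by
    rw [← contractV_ofDualV, hv, contractV_ofDualV]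

lemma lieE_commutator (h : Components Q ρ br t nab) (hQ : Q * Q = 0) (ψ φ : Sec B F E) :
    lieE Q ψ * lieE Q φ - lieE Q φ * lieE Q ψ = lieE Q (br ψ φ) :=
  commutator_anticommutator (commute_anticommutator hQ) (h.lieE_contractE ψ φ)

/-- The Jacobi identity for the operators `L_{ψ₁}`, `L_{ψ₂}`, `i_{ψ₃}`, with `[L_{ψ₁}, L_{ψ₂}]`
replaced by `L_{[ψ₁,ψ₂]}`. Flatness is the same argument with `i_v` in place of `i_{ψ₃}`. -/
lemma jacobi (h : Components Q ρ br t nab) (hQ : Q * Q = 0) (ψ₁ ψ₂ ψ₃ : Sec B F E) :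
    br ψ₁ (br ψ₂ ψ₃) = br (br ψ₁ ψ₂) ψ₃ + br ψ₂ (br ψ₁ ψ₃) := by
  refine contractE_injective (G := G) (V := V) ?_
  rw [contractE_add, ← sub_eq_iff_eq_add, ← jacobi_commutator (h.lieE_contractE ψ₁ ψ₃)
    (h.lieE_contractE ψ₂ ψ₃) (h.lieE_contractE ψ₁ _) (h.lieE_contractE ψ₂ _),
    h.lieE_commutator hQ, h.lieE_contractE]

lemma flat (h : Components Q ρ br t nab) (hQ : Q * Q = 0) [FiniteDimensional ℝ G]
    [ContMDiffVectorBundle ∞ G V 𝓘(ℝ, B)] (ψ₁ ψ₂ : Sec B F E) (v : Sec B G V) :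
    nab ψ₁ (nab ψ₂ v) = nab (br ψ₁ ψ₂) v + nab ψ₂ (nab ψ₁ v) := by
  refine contractV_injective (F := F) (E := E) ?_
  rw [contractV_add, ← sub_eq_iff_eq_add, ← jacobi_commutator (h.lieE_contractV ψ₁ v)
    (h.lieE_contractV ψ₂ v) (h.lieE_contractV ψ₁ _) (h.lieE_contractV ψ₂ _),
    h.lieE_commutator hQ, h.lieE_contractV]

lemma lieDeriv_anchor_bracket (h : Components Q ρ br t nab) (hQ : Q * Q = 0) (ψ φ : Sec B F E)
    (f : Fn B M) : lieDeriv (ρ.onSec (br ψ φ)) f =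
      lieDeriv (ρ.onSec ψ) (lieDeriv (ρ.onSec φ) f) -
        lieDeriv (ρ.onSec φ) (lieDeriv (ρ.onSec ψ) f) := by
  refine ofFn_injective (F := F) (E := E) (G := G) (V := V) ?_
  rw [← h.lieE_ofFn, ← h.lieE_commutator hQ, LinearMap.sub_apply, Module.End.mul_apply,
    Module.End.mul_apply, h.lieE_ofFn, h.lieE_ofFn, h.lieE_ofFn, h.lieE_ofFn, ofFn_sub]

/-- `Q f` is a section `α` of `E*`, and `ρ(t v) f = α(t v) = i_v Q α = i_v Q² f = 0`. -/
lemma lieDeriv_anchor_t (h : Components Q ρ br t nab) (hQ : Q * Q = 0) (v : Sec B G V)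
    (f : Fn B M) : lieDeriv (ρ.onSec (t.onSec v)) f = 0 := by
  refine ofFn_injective (F := F) (E := E) (G := G) (V := V) ?_
  obtain ⟨α, hα⟩ := (h.degree_fn f).exists_ofDualE
  have hQQ : Q (Q (ofFn F E G V f)) = 0 := LinearMap.congr_fun hQ _
  rw [← h.anchor, ← hα, contractE_ofDualE, ← h.t, hα, hQQ, map_zero]
  exact (superFun_ext fun x => map_zero _).symm

/-- Apply `[L_ψ, L_v] = L_{∇_ψ v}` to `α`. Both `α` and `L_ψ α` have degree one, so `L_v` acts on
them as `-i_{t v}`, and the left-hand side becomes `-[L_ψ, i_{t v}] α = -i_{[ψ, t v]} α`. -/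
lemma t_nab (h : Components Q ρ br t nab) (hQ : Q * Q = 0) (ψ : Sec B F E) (v : Sec B G V) :
    t.onSec (nab ψ v) = br ψ (t.onSec v) := by
  refine Sec.ext_pair fun α => ofFn_injective (F := F) (E := E) (G := G) (V := V) ?_
  have h1 := LinearMap.congr_fun (commutator_commutator
    (commute_anticommutator hQ (i := contractE ψ)) (h.lieE_contractV ψ v)) (ofDualE G V α)
  have h2 := LinearMap.congr_fun (h.lieE_contractE ψ (t.onSec v)) (ofDualE G V α)
  have h3 := h.lieV_add_contractE_eq_zero v (isHomogeneous_ofDualE (G := G) (V := V) α)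
  have h4 := h.lieV_add_contractE_eq_zero v (h.isHomogeneous_lieE_ofDualE ψ α)
  have h5 := h.lieV_ofDualE (nab ψ v) α
  change lieE Q ψ (lieV Q v (ofDualE G V α)) - lieV Q v (lieE Q ψ (ofDualE G V α)) =
    lieV Q (nab ψ v) (ofDualE G V α) at h1
  change lieE Q ψ (contractE (t.onSec v) (ofDualE G V α)) -
    contractE (t.onSec v) (lieE Q ψ (ofDualE G V α)) =
      contractE (br ψ (t.onSec v)) (ofDualE G V α) at h2
  rw [eq_neg_of_add_eq_zero_left h3, eq_neg_of_add_eq_zero_left h4, h5, map_neg] at h1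
  rw [contractE_ofDualE (br ψ (t.onSec v))] at h2
  rw [← h2, ← neg_neg (ofFn F E G V (α.pair (t.onSec (nab ψ v)))), ← h1]
  abel

/-- Apply `[L_v, L_w] = 0` to `β`. As `L_w β` has degree one, `L_v L_w β = -i_{t v} L_w β`, which is
minus the pairing of `β` with `∇_{t v} w`. -/
lemma nab_t_antisymm (h : Components Q ρ br t nab) (hQ : Q * Q = 0) [FiniteDimensional ℝ G]
    [ContMDiffVectorBundle ∞ G V 𝓘(ℝ, B)] (v w : Sec B G V) :
    nab (t.onSec v) w = -nab (t.onSec w) v := by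
  rw [eq_neg_iff_add_eq_zero]
  refine Sec.ext_pair fun β => ofFn_injective (F := F) (E := E) (G := G) (V := V) ?_
  have h1 := LinearMap.congr_fun (anticommutator_commutator hQ (h.contractV_lieV v w))
    (ofDualV F E β)
  change lieV Q v (lieV Q w (ofDualV F E β)) + lieV Q w (lieV Q v (ofDualV F E β)) = 0 at h1
  rw [eq_neg_of_add_eq_zero_left (h.lieV_add_contractE_eq_zero v
    (h.isHomogeneous_lieV_ofDualV w β)), eq_neg_of_add_eq_zero_left
    (h.lieV_add_contractE_eq_zero w (h.isHomogeneous_lieV_ofDualV v β)),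
    h.contractE_lieV_ofDualV, h.contractE_lieV_ofDualV, ← neg_add, neg_eq_zero, ← ofFn_add,
    ← DualSec.pair_add] at h1
  rw [h1]
  refine superFun_ext fun x => ?_
  change (0 : Fib (E x) (V x)) = algebraMap ℝ _ (β.toFun x 0)
  rw [map_zero, map_zero]

end Square

end Components

end Components

/-! ### The crossed module of an anomaly-free Q-structure -/

section CrossedModuleOfQ

variable {B : Type*} [NormedAddCommGroup B] [NormedSpace ℝ B] [FiniteDimensional ℝ B]
  {M : Type*} [TopologicalSpace M] [T2Space M] [ChartedSpace B M] [IsManifold 𝓘(ℝ, B) ∞ M]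
  {F : Type*} [NormedAddCommGroup F] [NormedSpace ℝ F]
  {E : M → Type*} [TopologicalSpace (TotalSpace F E)] [∀ x, TopologicalSpace (E x)]
  [∀ x, AddCommGroup (E x)] [∀ x, Module ℝ (E x)] [FiberBundle F E] [VectorBundle ℝ F E]
  {G : Type*} [NormedAddCommGroup G] [NormedSpace ℝ G]
  {V : M → Type*} [TopologicalSpace (TotalSpace G V)] [∀ x, TopologicalSpace (V x)]
  [∀ x, AddCommGroup (V x)] [∀ x, Module ℝ (V x)] [FiberBundle G V] [VectorBundle ℝ G V]

local notation "𝒮" => superFun B F E G V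
local notation "TM" => (TangentSpace 𝓘(ℝ, B) : M → Type _)

lemma Sec.ext_lieDeriv {X Y : Sec B B TM} (h : ∀ f, lieDeriv X f = lieDeriv Y f) : X = Y := by
  ext x
  exact eq_of_dirDeriv_eq fun f => DFunLike.congr_fun (h f) x

lemma contractE_ofFn_mul (ψ : Sec B F E) (f : Fn B M) (s : 𝒮) :
    contractE ψ (ofFn F E G V f * s) = ofFn F E G V f * contractE ψ s := by
  rw [(isOddDer_contractE ψ).leibniz, contractE_ofFn, zero_mul, zero_add, superParity_ofFn]

lemma contractV_ofFn_mul (v : Sec B G V) (f : Fn B M) (s : 𝒮) :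
    contractV v (ofFn F E G V f * s) = ofFn F E G V f * contractV v s := by
  rw [(isEvenDer_contractV v).leibniz, contractV_ofFn, zero_mul, zero_add]

lemma IsOddDer.ofFn_mul {Q : Module.End ℝ 𝒮} (hQ : IsOddDer (superParity B F E G V) Q)
    (f : Fn B M) (s : 𝒮) :
    Q (ofFn F E G V f * s) = Q (ofFn F E G V f) * s + ofFn F E G V f * Q s := by
  rw [hQ.leibniz, superParity_ofFn]

lemma IsHomogeneous.contractE_mul {s : 𝒮} (hs : IsHomogeneous 1 s) (ψ : Sec B F E) (s' : 𝒮) :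
    Q2.contractE ψ (s * s') = Q2.contractE ψ s * s' - s * Q2.contractE ψ s' := by
  rw [(isOddDer_contractE ψ).leibniz, hs.superParity, pow_one, neg_one_smul, neg_mul, sub_eq_add_neg]

lemma IsHomogeneous.contractV_mul {s : 𝒮} (hs : IsHomogeneous 1 s) (v : Sec B G V) (s' : 𝒮) :
    Q2.contractV v (s * s') = s * Q2.contractV v s' := by
  rw [(isEvenDer_contractV v).leibniz, hs.contractV_eq_zero_of_one, zero_mul, zero_add]

section Existence

variable [FiniteDimensional ℝ F] [ContMDiffVectorBundle ∞ F E 𝓘(ℝ, B)]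
  {Q : Module.End ℝ (superFun B F E G V)}

/-- For fixed `ψ`, `f ↦ i_ψ Q f` is a derivation of `C^∞(M)`, hence a vector field, and it is
`C^∞(M)`-linear in `ψ`. -/
lemma exists_anchor (hQ : IsOddDer (superParity B F E G V) Q)
    (hf : ∀ f, IsHomogeneous 1 (Q (ofFn F E G V f))) :
    ∃ ρ : BundleMap B F E B TM, ∀ f ψ,
      contractE ψ (Q (ofFn F E G V f)) = ofFn F E G V (lieDeriv (ρ.onSec ψ) f) := by
  have hX (ψ : Sec B F E) : ∃ X : Sec B B TM, ∀ f,
      bodyFn B F E G V (contractE ψ (Q (ofFn F E G V f))) = lieDeriv X f := by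
    let δ : Fn B M →ₗ[ℝ] Fn B M :=
      { toFun := fun f => bodyFn B F E G V (contractE ψ (Q (ofFn F E G V f)))
        map_add' := fun f g => by rw [ofFn_add, map_add, map_add, map_add]
        map_smul' := fun r f => by rw [ofFn_smul, map_smul, map_smul, map_smul]; rfl }
    refine exists_vectorField (δ := δ) fun f g => ?_
    simp only [δ, LinearMap.coe_mk, AddHom.coe_mk]
    rw [Q2.ofFn_mul, hQ.ofFn_mul, ← ofFn_mul_comm, map_add, contractE_ofFn_mul, contractE_ofFn_mul,
      map_add, map_mul, map_mul, bodyFn_ofFn, bodyFn_ofFn, add_comm]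
  choose X hX using hX
  have : IsManifold 𝓘(ℝ, B) ((⊤ : ℕ∞) + 1) M := ‹IsManifold 𝓘(ℝ, B) ∞ M›
  obtain ⟨ρ, hρ⟩ := exists_bundleMap X
    (fun ψ φ => Sec.ext_lieDeriv fun f => by
      rw [add_lieDeriv, ← hX, ← hX, ← hX, contractE_add, LinearMap.add_apply, map_add])
    (fun g ψ => Sec.ext_lieDeriv fun f => by
      rw [smulSec_lieDeriv, ← hX, ← hX, contractE_smul, map_mul, bodyFn_ofFn])
  refine ⟨ρ, fun f ψ => ?_⟩
  rw [hρ, ← hX]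
  exact (IsHomogeneous.ofFn_bodyFn ((hf f).contractE ψ)).symm

variable {ρ : BundleMap B F E B (TangentSpace 𝓘(ℝ, B) : M → Type _)}

/-- Replacing `α` by `f α`, the terms with derivatives of `f` coming from `Q f · α` cancel those of
the two Lie derivatives. The difference is therefore `C^∞(M)`-linear in `α`, that is, the pairing
with a section. The connection arises in the same way. -/
lemma exists_bracket (hQ : IsOddDer (superParity B F E G V) Q)
    (hf : ∀ f, IsHomogeneous 1 (Q (ofFn F E G V f)))
    (hE : ∀ α, IsHomogeneous 2 (Q (ofDualE G V α)))
    (hρ : ∀ f ψ, contractE ψ (Q (ofFn F E G V f)) = ofFn F E G V (lieDeriv (ρ.onSec ψ) f))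
    (ψ φ : Sec B F E) : ∃ χ : Sec B F E, ∀ α, contractE φ (contractE ψ (Q (ofDualE G V α))) =
      ofFn F E G V (lieDeriv (ρ.onSec ψ) (α.pair φ) - lieDeriv (ρ.onSec φ) (α.pair ψ) -
        α.pair χ) := by
  obtain ⟨χ, hχ⟩ := exists_sec_of_dual (fun α => lieDeriv (ρ.onSec ψ) (α.pair φ) -
      lieDeriv (ρ.onSec φ) (α.pair ψ) -
        bodyFn B F E G V (contractE φ (contractE ψ (Q (ofDualE G V α)))))
    (fun α α' => by
      simp only [DualSec.add_pair, lieDeriv_add, ofDualE_add, map_add]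
      abel)
    (fun f α => by
      simp only [DualSec.smul_pair, lieDeriv_mul, ofDualE_smul, hQ.ofFn_mul, map_add,
        (hf f).contractE_mul, contractE_ofFn_mul, map_sub, contractE_ofDualE, hρ, contractE_ofFn,
        mul_zero, sub_zero, map_mul, bodyFn_ofFn]
      ring)
  refine ⟨χ, fun α => ?_⟩
  rw [hχ, sub_sub_cancel]
  exact (IsHomogeneous.ofFn_bodyFn (((hE α).contractE ψ).contractE φ)).symm

/-- No correction term is needed: `i_v` annihilates `Q f`, which has degree one, so `α ↦ i_v Q α` is
already `C^∞(M)`-linear. -/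
lemma exists_t [FiniteDimensional ℝ G] [ContMDiffVectorBundle ∞ G V 𝓘(ℝ, B)]
    (hQ : IsOddDer (superParity B F E G V) Q)
    (hf : ∀ f, IsHomogeneous 1 (Q (ofFn F E G V f)))
    (hE : ∀ α, IsHomogeneous 2 (Q (ofDualE G V α))) :
    ∃ t : BundleMap B G V F E, ∀ α v,
      contractV v (Q (ofDualE G V α)) = ofFn F E G V (α.pair (t.onSec v)) := by
  have hτ (v : Sec B G V) : ∃ χ : Sec B F E, ∀ α : DualSec B F E, α.pair χ =
      bodyFn B F E G V (contractV v (Q (ofDualE G V α))) :=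
    exists_sec_of_dual _ (fun α α' => by rw [ofDualE_add, map_add, map_add, map_add])
      (fun f α => by
        rw [ofDualE_smul, hQ.ofFn_mul, map_add, (hf f).contractV_mul, contractV_ofDualE,
          mul_zero, zero_add, contractV_ofFn_mul, map_mul, bodyFn_ofFn])
  choose τ hτ using hτ
  obtain ⟨t, ht⟩ := exists_bundleMap τ
    (fun v w => Sec.ext_pair fun α => by
      rw [DualSec.pair_add, hτ, hτ, hτ, contractV_add, LinearMap.add_apply, map_add])
    (fun g v => Sec.ext_pair fun α => by
      rw [DualSec.pair_smulSec, hτ, hτ, contractV_smul, map_mul, bodyFn_ofFn])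
  refine ⟨t, fun α v => ?_⟩
  rw [ht, hτ]
  exact (IsHomogeneous.ofFn_bodyFn ((hE α).contractV v)).symm

lemma exists_connection [FiniteDimensional ℝ G] [ContMDiffVectorBundle ∞ G V 𝓘(ℝ, B)]
    (hQ : IsOddDer (superParity B F E G V) Q)
    (hf : ∀ f, IsHomogeneous 1 (Q (ofFn F E G V f)))
    (hV : ∀ β, IsHomogeneous 3 (Q (ofDualV F E β)))
    (hρ : ∀ f ψ, contractE ψ (Q (ofFn F E G V f)) = ofFn F E G V (lieDeriv (ρ.onSec ψ) f))
    (ψ : Sec B F E) (v : Sec B G V) : ∃ w : Sec B G V, ∀ β,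
      contractV v (contractE ψ (Q (ofDualV F E β))) =
        ofFn F E G V (lieDeriv (ρ.onSec ψ) (β.pair v) - β.pair w) := by
  obtain ⟨w, hw⟩ := exists_sec_of_dual (fun β => lieDeriv (ρ.onSec ψ) (β.pair v) -
        bodyFn B F E G V (contractV v (contractE ψ (Q (ofDualV F E β)))))
    (fun β β' => by
      simp only [DualSec.add_pair, lieDeriv_add, ofDualV_add, map_add]
      abel)
    (fun f β => by
      simp only [DualSec.smul_pair, lieDeriv_mul, ofDualV_smul, hQ.ofFn_mul, map_add,
        (hf f).contractE_mul, contractE_ofFn_mul, contractE_ofDualV, hρ, contractV_ofFn_mul,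
        contractV_ofDualV, mul_zero, sub_zero, map_mul, bodyFn_ofFn]
      ring)
  refine ⟨w, fun β => ?_⟩
  rw [hw, sub_sub_cancel]
  exact (IsHomogeneous.ofFn_bodyFn (((hV β).contractE ψ).contractV v)).symm

end Existence

namespace Components

variable {Q : Module.End ℝ (superFun B F E G V)}
  {ρ : BundleMap B F E B (TangentSpace 𝓘(ℝ, B) : M → Type _)}
  {br : Sec B F E → Sec B F E → Sec B F E} {t : BundleMap B G V F E}
  {nab : Sec B F E → Sec B G V → Sec B G V}

/-- Solved for the bracket, the defining relation yields bilinearity and the Leibniz rule by pairing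
with all `α`. -/
lemma pair_bracket (h : Components Q ρ br t nab) (α : DualSec B F E) (ψ φ : Sec B F E) :
    α.pair (br ψ φ) = lieDeriv (ρ.onSec ψ) (α.pair φ) - lieDeriv (ρ.onSec φ) (α.pair ψ) -
      bodyFn B F E G V (contractE φ (contractE ψ (Q (ofDualE G V α)))) := by
  rw [h.bracket, bodyFn_ofFn, sub_sub_cancel]

lemma pair_conn (h : Components Q ρ br t nab) (β : DualSec B G V) (ψ : Sec B F E)
    (v : Sec B G V) : β.pair (nab ψ v) = lieDeriv (ρ.onSec ψ) (β.pair v) -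
      bodyFn B F E G V (contractV v (contractE ψ (Q (ofDualV F E β)))) := by
  rw [h.conn, bodyFn_ofFn, sub_sub_cancel]

end Components

lemma contractE_const_smul (r : ℝ) (ψ : Sec B F E) (s : 𝒮) :
    contractE (r • ψ) s = r • contractE ψ s :=
  superFun_ext fun x => DFunLike.congr_fun (contractOdd_smul r (ψ x)) _

lemma contractV_const_smul (r : ℝ) (v : Sec B G V) (s : 𝒮) :
    contractV (r • v) s = r • contractV v s :=
  superFun_ext fun x => DFunLike.congr_fun (contractEven_smul r (v x)) _

variable [FiniteDimensional ℝ F] [ContMDiffVectorBundle ∞ F E 𝓘(ℝ, B)]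

variable [FiniteDimensional ℝ G] [ContMDiffVectorBundle ∞ G V 𝓘(ℝ, B)]

lemma exists_components {Q : Module.End ℝ (superFun B F E G V)}
    (hQ : IsOddDer (superParity B F E G V) Q)
    (hf : ∀ f, IsHomogeneous 1 (Q (ofFn F E G V f)))
    (hE : ∀ α, IsHomogeneous 2 (Q (ofDualE G V α)))
    (hV : ∀ β, IsHomogeneous 3 (Q (ofDualV F E β)))
    (hH : ∀ β (ψ φ : Sec B F E), contractE φ (contractE ψ (Q (ofDualV F E β))) = 0) :
    ∃ ρ br t nab, Components Q ρ br t nab := by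
  obtain ⟨ρ, hρ⟩ := exists_anchor hQ hf
  choose br hbr using exists_bracket hQ hf hE hρ
  obtain ⟨t, ht⟩ := exists_t hQ hf hE
  choose nab hnab using exists_connection hQ hf hV hρ
  exact ⟨ρ, br, t, nab, ⟨hQ, hf, hE, hV, hρ, fun α ψ φ => hbr ψ φ α, ht,
    fun β ψ v => hnab ψ v β, hH⟩⟩

/-- The crossed module with given components. -/
lemma Components.exists_crossedModule {Q : Module.End ℝ (superFun B F E G V)}
    {ρ : BundleMap B F E B (TangentSpace 𝓘(ℝ, B) : M → Type _)}
    {br : Sec B F E → Sec B F E → Sec B F E} {t : BundleMap B G V F E}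
    {nab : Sec B F E → Sec B G V → Sec B G V} (h : Components Q ρ br t nab) (hQ : Q * Q = 0) :
    ∃ X : CrossedModule B F E G V, Components Q X.algE.anchor (fun ψ φ => X.algE.bracket ψ φ)
      X.t (fun ψ v => X.rep.conn ψ v) := by
  let algE : LieAlgebroid B F E :=
    { anchor := ρ
      bracket := LinearMap.mk₂ ℝ br
        (fun ψ ψ' φ => Sec.ext_pair fun α => by
          simp only [DualSec.pair_add, h.pair_bracket, BundleMap.onSec_add, add_lieDeriv,
            lieDeriv_add, contractE_add, LinearMap.add_apply, map_add]
          abel)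
        (fun r ψ φ => Sec.ext_pair fun α => by
          simp only [DualSec.pair_const_smul, h.pair_bracket, BundleMap.onSec_const_smul,
            const_smul_lieDeriv, lieDeriv_const_smul, contractE_const_smul,
            map_smul, smul_sub])
        (fun ψ φ φ' => Sec.ext_pair fun α => by
          simp only [DualSec.pair_add, h.pair_bracket, BundleMap.onSec_add, add_lieDeriv,
            lieDeriv_add, contractE_add, LinearMap.add_apply, map_add]
          abel)
        (fun r ψ φ => Sec.ext_pair fun α => by
          simp only [DualSec.pair_const_smul, h.pair_bracket, BundleMap.onSec_const_smul,
            const_smul_lieDeriv, lieDeriv_const_smul, contractE_const_smul,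
            map_smul, smul_sub])
      bracket_self := fun ψ => Sec.ext_pair fun α => by
        have h0 : α.pair (0 : Sec B F E) = 0 := by
          ext x
          exact map_zero (α.toFun x)
        rw [LinearMap.mk₂_apply, h.pair_bracket, contractE_self, map_zero, sub_self, sub_zero, h0]
      jacobi := fun ψ₁ ψ₂ ψ₃ => h.jacobi hQ ψ₁ ψ₂ ψ₃
      leibniz := fun ψ φ f x => by
        have key : br ψ (smulSec f φ) =
            smulSec f (br ψ φ) + smulSec (lieDeriv (ρ.onSec ψ) f) φ :=
          Sec.ext_pair fun α => by
            simp only [DualSec.pair_add, DualSec.pair_smulSec, h.pair_bracket,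
              BundleMap.onSec_smulSec, smulSec_lieDeriv, lieDeriv_mul, contractE_smul, map_mul,
              bodyFn_ofFn]
            ring
        exact DFunLike.congr_fun key x }
  let rep : Representation algE G V :=
    { conn := LinearMap.mk₂ ℝ nab
        (fun ψ ψ' v => Sec.ext_pair fun β => by
          simp only [DualSec.pair_add, h.pair_conn, BundleMap.onSec_add, add_lieDeriv,
            contractE_add, LinearMap.add_apply, map_add]
          abel)
        (fun r ψ v => Sec.ext_pair fun β => by
          simp only [DualSec.pair_const_smul, h.pair_conn, BundleMap.onSec_const_smul,
            const_smul_lieDeriv, contractE_const_smul, map_smul, smul_sub])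
        (fun ψ v v' => Sec.ext_pair fun β => by
          simp only [DualSec.pair_add, h.pair_conn, lieDeriv_add, contractV_add,
            LinearMap.add_apply, map_add]
          abel)
        (fun r ψ v => Sec.ext_pair fun β => by
          simp only [DualSec.pair_const_smul, h.pair_conn, lieDeriv_const_smul,
            contractV_const_smul, map_smul, smul_sub])
      smul_left := fun f ψ v => Sec.ext_pair fun β => by
        simp only [LinearMap.mk₂_apply, DualSec.pair_smulSec, h.pair_conn,
          BundleMap.onSec_smulSec, smulSec_lieDeriv, contractE_smul, contractV_ofFn_mul, map_mul,
          bodyFn_ofFn, mul_sub]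
      leibniz := fun ψ f v x => by
        have key : nab ψ (smulSec f v) =
            smulSec (lieDeriv (ρ.onSec ψ) f) v + smulSec f (nab ψ v) :=
          Sec.ext_pair fun β => by
            simp only [DualSec.pair_add, DualSec.pair_smulSec, h.pair_conn, lieDeriv_mul,
              contractV_smul, map_mul, bodyFn_ofFn]
            ring
        exact DFunLike.congr_fun key x
      flat := fun ψ φ v => by
        simp only [LinearMap.mk₂_apply]
        rw [h.flat hQ ψ φ v, add_sub_cancel_right]
        exact sub_self _ }
  have hcomplex (x : M) (v : V x) : ρ.toFun x (t.toFun x v) = 0 := by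
    obtain ⟨v, rfl⟩ := exists_sec_apply_eq B G x v
    refine eq_of_dirDeriv_eq fun f => ?_
    rw [dirDeriv_vzero]
    exact DFunLike.congr_fun (h.lieDeriv_anchor_t hQ v f) x
  let tLin : Sec B G V →ₗ[ℝ] Sec B F E :=
    { toFun := t.onSec
      map_add' := t.onSec_add
      map_smul' := t.onSec_const_smul }
  -- The condition `∇_{t v} w = [v, w]` leaves no choice for the bracket. Antisymmetry is
  -- `nab_t_antisymm`; the Jacobi identity is flatness combined with `t(∇_ψ v) = [ψ, t v]`.
  let algV : LieAlgebroid B G V :=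
    { anchor := ⟨fun x => (ρ.toFun x).comp (t.toFun x), ρ.smooth.comp t.smooth⟩
      bracket := rep.conn.comp tLin
      bracket_self := fun v => by
        have h2 : (2 : ℝ) • nab (t.onSec v) v = 0 := by
          rw [two_smul]
          nth_rewrite 1 [h.nab_t_antisymm hQ v v]
          exact neg_add_cancel _
        exact (smul_eq_zero.1 h2).resolve_left two_ne_zero
      jacobi := fun v₁ v₂ v₃ => by
        change nab (t.onSec v₁) (nab (t.onSec v₂) v₃) =
          nab (t.onSec (nab (t.onSec v₁) v₂)) v₃ + nab (t.onSec v₂) (nab (t.onSec v₁) v₃)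
        rw [h.flat hQ, h.t_nab hQ]
      leibniz := fun v w f x => (rep.leibniz (t.onSec v) f w x).trans (add_comm _ _) }
  refine ⟨⟨algE, algV, t, ⟨fun x v => rfl, fun v w => h.t_nab hQ _ _⟩, ⟨fun x e => rfl,
    fun ψ φ => ?_⟩, hcomplex, rep, fun ψ v => h.t_nab hQ ψ v, fun v w => rfl⟩, h⟩
  ext x
  refine eq_of_dirDeriv_eq fun f => ?_
  refine (DFunLike.congr_fun (h.lieDeriv_anchor_bracket hQ ψ φ f) x).trans ?_
  exact (dirDeriv_mlieBracket (ρ.onSec ψ) (ρ.onSec φ) f x).symm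

/-! ### Pointwise and operator form of the correspondence -/

lemma QStructure.degree_fn (q : QStructure B F E G V) (f : Fn B M) :
    IsHomogeneous 1 (q.Q (ofFn F E G V f)) := q.degree_one 0 _ (isHomogeneous_ofFn f)

lemma QStructure.degree_dualE (q : QStructure B F E G V) (α : DualSec B F E) :
    IsHomogeneous 2 (q.Q (ofDualE G V α)) := q.degree_one 1 _ (isHomogeneous_ofDualE α)

lemma QStructure.degree_dualV (q : QStructure B F E G V) (β : DualSec B G V) :
    IsHomogeneous 3 (q.Q (ofDualV F E β)) := q.degree_one 2 _ (isHomogeneous_ofDualV β)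

lemma QStructure.anomalyFree_iff (q : QStructure B F E G V) : q.AnomalyFree ↔
    ∀ β (ψ φ : Sec B F E), contractE φ (contractE ψ (q.Q (ofDualV F E β))) = 0 := by
  have hfib (x : M) := finiteDimensional_fibre F E x
  have hfib' (x : M) := finiteDimensional_fibre G V x
  refine ⟨fun h β ψ φ => superFun_ext fun x => ?_, fun h β x => ?_⟩
  · exact (evalEven_zero_eq_zero_iff (q.degree_dualV β x)).1 (h β x) _ _
  · refine (evalEven_zero_eq_zero_iff (q.degree_dualV β x)).2 fun u u' => ?_
    obtain ⟨φ, rfl⟩ := exists_sec_apply_eq B F x u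
    obtain ⟨ψ, rfl⟩ := exists_sec_apply_eq B F x u'
    exact congrFun (congrArg Subtype.val (h β ψ φ)) x

lemma IsHomogeneous.eq_ofFn_iff {s : 𝒮} (hs : IsHomogeneous 0 s) (f : Fn B M) :
    s = ofFn F E G V f ↔ ∀ x, scalarPart (E x) (V x) (s.1 x) = f x := by
  refine ⟨fun h x => ?_, fun h => ?_⟩
  · rw [h, ← bodyFn_apply, bodyFn_ofFn]
  · rw [← hs.ofFn_bodyFn]
    congr 1
    ext x
    exact h x

/-- On each generator the degree of its image under `Q` is fixed, and in that degree the body of an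
evaluated interior product is the scalar part of an iterated contraction. `AnomalyFree` supplies the
field `anomaly`. -/
lemma corresponds_iff (q : QStructure B F E G V) (hq : q.AnomalyFree)
    (X : CrossedModule B F E G V) : Corresponds q X ↔ Components q.Q X.algE.anchor
      (fun ψ φ => X.algE.bracket ψ φ) X.t (fun ψ v => X.rep.conn ψ v) := by
  have h1 := q.degree_fn
  have h2 := q.degree_dualE
  have h3 := q.degree_dualV
  refine ⟨fun h => ⟨q.isOddDer, h1, h2, h3, fun f ψ => ?_, fun α ψ φ => ?_, fun α v => ?_,
    fun β ψ v => ?_, q.anomalyFree_iff.1 hq⟩, fun h => ⟨fun f ψ x => ?_, fun α ψ φ x => ?_,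
    fun α v x => ?_, fun β ψ v x => ?_⟩⟩
  · refine (((h1 f).contractE ψ).eq_ofFn_iff _).2 fun x => ?_
    exact (body_interiorProd_evalEven _ _ (h1 f x)).symm.trans (h.anchor f ψ x)
  · refine ((((h2 α).contractE ψ).contractE φ).eq_ofFn_iff _).2 fun x => ?_
    exact (body_interiorProd_interiorProd_evalEven _ _ _ (h2 α x)).symm.trans (h.bracket α ψ φ x)
  · refine (((h2 α).contractV v).eq_ofFn_iff _).2 fun x => ?_
    exact (body_evalEven_of_mem_two _ (h2 α x)).symm.trans (h.t α v x)
  · refine ((((h3 β).contractE ψ).contractV v).eq_ofFn_iff _).2 fun x => ?_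
    exact (body_interiorProd_evalEven_of_mem_three _ _ (h3 β x)).symm.trans (h.conn β ψ v x)
  · exact (body_interiorProd_evalEven _ _ (h1 f x)).trans
      ((((h1 f).contractE ψ).eq_ofFn_iff _).1 (h.anchor f ψ) x)
  · exact (body_interiorProd_interiorProd_evalEven _ _ _ (h2 α x)).trans
      (((((h2 α).contractE ψ).contractE φ).eq_ofFn_iff _).1 (h.bracket α ψ φ) x)
  · exact (body_evalEven_of_mem_two _ (h2 α x)).trans
      ((((h2 α).contractV v).eq_ofFn_iff _).1 (h.t α v) x)
  · exact (body_interiorProd_evalEven_of_mem_three _ _ (h3 β x)).trans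
      (((((h3 β).contractE ψ).contractV v).eq_ofFn_iff _).1 (h.conn β ψ v) x)

lemma exists_corresponds_crossedModule (q : QStructure B F E G V) (hq : q.AnomalyFree) :
    ∃ X, Corresponds q X := by
  obtain ⟨ρ, br, t, nab, h⟩ := exists_components q.isOddDer q.degree_fn q.degree_dualE
    q.degree_dualV (q.anomalyFree_iff.1 hq)
  obtain ⟨X, hX⟩ := h.exists_crossedModule (LinearMap.ext q.square_zero)
  exact ⟨X, (corresponds_iff q hq X).2 hX⟩

end CrossedModuleOfQ

/-! ### Pullbacks and odd derivations of fibre algebras -/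

section FibreMaps

variable {U W U' W' : Type*} [AddCommGroup U] [Module ℝ U] [AddCommGroup W] [Module ℝ W]
  [AddCommGroup U'] [Module ℝ U'] [AddCommGroup W'] [Module ℝ W']

lemma Fib.exists_map (p : U →ₗ[ℝ] U') (q : W →ₗ[ℝ] W') : ∃ φ : Fib U' W' →ₐ[ℝ] Fib U W,
    (∀ α, φ (genOdd U' W' α) = genOdd U W (α ∘ₗ p)) ∧
      ∀ β, φ (genEven U' W' β) = genEven U W (β ∘ₗ q) :=
  Fib.exists_lift ((genOdd U W).comp p.dualMap) ((genEven U W).comp q.dualMap)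
    (fun _ => genOdd_mul_self _) (fun _ _ => genEven_mul_comm _ _)
    (fun _ _ => (genEven_mul_comm _ _).symm)

/-- The pullback along linear maps. -/
def Fib.map (p : U →ₗ[ℝ] U') (q : W →ₗ[ℝ] W') : Fib U' W' →ₐ[ℝ] Fib U W :=
  (Fib.exists_map p q).choose

@[simp]
lemma Fib.map_genOdd (p : U →ₗ[ℝ] U') (q : W →ₗ[ℝ] W') (α : Module.Dual ℝ U') :
    Fib.map p q (genOdd U' W' α) = genOdd U W (α ∘ₗ p) :=
  (Fib.exists_map p q).choose_spec.1 α

@[simp]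
lemma Fib.map_genEven (p : U →ₗ[ℝ] U') (q : W →ₗ[ℝ] W') (β : Module.Dual ℝ W') :
    Fib.map p q (genEven U' W' β) = genEven U W (β ∘ₗ q) :=
  (Fib.exists_map p q).choose_spec.2 β

lemma Fib.map_id : Fib.map (LinearMap.id : U →ₗ[ℝ] U) (LinearMap.id : W →ₗ[ℝ] W) =
    AlgHom.id ℝ (Fib U W) :=
  Fib.algHom_ext (fun α => by simp) fun β => by simp

lemma parity_mul_genOdd (α : Module.Dual ℝ U) (a : Fib U W) :
    parity U W a * genOdd U W α = genOdd U W α * a := by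
  induction a using Fib.induction_left with
  | h1 => rw [map_one, one_mul, mul_one]
  | hsmul r a h => rw [map_smul, smul_mul_assoc, h, mul_smul_comm]
  | hO α' a h =>
    rw [map_mul, parity_genOdd, mul_assoc, h, ← mul_assoc, ← mul_assoc, neg_mul,
      ← genOdd_mul_genOdd]
  | hE β a h =>
    rw [map_mul, parity_genEven, mul_assoc, h, ← mul_assoc, ← mul_assoc, genEven_mul_comm]
  | hadd a b ha hb => rw [map_add, add_mul, ha, hb, mul_add]

/-- Odd derivations of a fibre with given values on the generators. -/
lemma Fib.exists_oddDerivation (o : Module.Dual ℝ U →ₗ[ℝ] Fib U W)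
    (e : Module.Dual ℝ W →ₗ[ℝ] Fib U W) (ho : ∀ α, parity U W (o α) = o α)
    (he : ∀ β, parity U W (e β) = -e β) : ∃ δ : Fib U W →ₗ[ℝ] Fib U W,
      (∀ a b, δ (a * b) = δ a * b + parity U W a * δ b) ∧
        (∀ α, δ (genOdd U W α) = o α) ∧ ∀ β, δ (genEven U W β) = e β := by
  refine Fib.exists_derivation (parity U W) (AlgHom.id ℝ _) o e (fun α => ?_) (fun β β' => ?_)
    fun α β => ?_
  · simp only [parity_genOdd, AlgHom.id_apply]
    rw [neg_mul, ← parity_mul_genOdd, ho, neg_add_cancel]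
  · simp only [parity_genEven, AlgHom.id_apply]
    rw [genEven_mul_comm, genEven_mul_comm β', add_comm]
  · simp only [parity_genEven, parity_genOdd, AlgHom.id_apply]
    rw [neg_mul, ← parity_mul_genOdd, he, neg_mul, neg_neg, genEven_mul_comm, add_comm]

end FibreMaps

/-! ### Differentiation of functions with values in a fixed fibre algebra -/

section TensorDerivative

variable {B : Type*} [NormedAddCommGroup B] [NormedSpace ℝ B]
  {M : Type*} [TopologicalSpace M] [ChartedSpace B M]
  {U W : Type*} [AddCommGroup U] [Module ℝ U] [AddCommGroup W] [Module ℝ W]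

variable (B) in
/-- Evaluation of functions at a point. -/
def evalFn (y : M) : Fn B M →ₐ[ℝ] ℝ where
  toFun f := f y
  map_one' := rfl
  map_mul' _ _ := rfl
  map_zero' := rfl
  map_add' _ _ := rfl
  commutes' _ := rfl

variable (B U W) in
/-- Evaluation at a point of functions with values in the algebra `Fib U W`. -/
def tensorEval (y : M) : Fn B M ⊗[ℝ] Fib U W →ₐ[ℝ] Fib U W :=
  Algebra.TensorProduct.lift ((Algebra.ofId ℝ (Fib U W)).comp (evalFn B y)) (AlgHom.id ℝ _)
    fun f _ => Algebra.commute_algebraMap_left (f y) _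

lemma tensorEval_tmul (y : M) (f : Fn B M) (a : Fib U W) :
    tensorEval B U W y (f ⊗ₜ a) = f y • a :=
  (Algebra.TensorProduct.lift_tmul _ _ _ _ _).trans (Algebra.smul_def (f y) a).symm

variable {x₀ : M} (r : U →ₗ[ℝ] TangentSpace 𝓘(ℝ, B) x₀)

/-- The pullback of the differential of a function at `x₀`. -/
def pullDiff : Fn B M →ₗ[ℝ] Module.Dual ℝ U where
  toFun f :=
    { toFun := fun u => dirDeriv f x₀ (r u)
      map_add' := fun u u' => by rw [map_add, dirDeriv_vadd]
      map_smul' := fun c u => by rw [map_smul, dirDeriv_vsmul]; rfl }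
  map_add' f g := LinearMap.ext fun u => dirDeriv_add f g x₀ _
  map_smul' c f := LinearMap.ext fun u => dirDeriv_const_smul c f x₀ _

lemma pullDiff_apply (f : Fn B M) (u : U) : pullDiff r f u = dirDeriv f x₀ (r u) := rfl

lemma pullDiff_mul (f g : Fn B M) :
    pullDiff r (f * g) = f x₀ • pullDiff r g + g x₀ • pullDiff r f :=
  LinearMap.ext fun u => dirDeriv_mul f g x₀ _

variable (W) in
/-- The operator `f ⊗ a ↦ (df ∘ r) a`. -/
def tensorDeriv : Fn B M ⊗[ℝ] Fib U W →ₗ[ℝ] Fib U W :=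
  TensorProduct.lift ((LinearMap.mul ℝ (Fib U W)).comp ((genOdd U W).comp (pullDiff r)))

lemma tensorDeriv_tmul (f : Fn B M) (a : Fib U W) :
    tensorDeriv W r (f ⊗ₜ a) = genOdd U W (pullDiff r f) * a := rfl

lemma tensorDeriv_mul (w w' : Fn B M ⊗[ℝ] Fib U W) : tensorDeriv W r (w * w') =
    tensorDeriv W r w * tensorEval B U W x₀ w' +
      parity U W (tensorEval B U W x₀ w) * tensorDeriv W r w' := by
  induction w using TensorProduct.induction_on with
  | zero => simp only [zero_mul, map_zero, add_zero]
  | add a b ha hb =>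
    simp only [add_mul, map_add, ha, hb]
    abel
  | tmul f a =>
    induction w' using TensorProduct.induction_on with
    | zero => simp only [mul_zero, map_zero, add_zero]
    | add a b ha hb =>
      simp only [mul_add, map_add, ha, hb]
      abel
    | tmul g b =>
      rw [Algebra.TensorProduct.tmul_mul_tmul, tensorDeriv_tmul, tensorDeriv_tmul,
        tensorDeriv_tmul, tensorEval_tmul, tensorEval_tmul, pullDiff_mul, map_add, map_smul,
        map_smul, map_smul, add_mul, smul_mul_assoc, smul_mul_assoc, smul_mul_assoc,
        mul_smul_comm, ← mul_assoc (parity U W a), parity_mul_genOdd, mul_assoc, mul_assoc,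
        add_comm]

/-- No topology on the fibre algebra is needed: after applying a linear functional `l`, the operator
is a sum of directional derivatives of the real functions `y ↦ l (ξ i * w(y))`, which vanish near
`x₀`. -/
lemma tensorDeriv_eq_zero [FiniteDimensional ℝ U] {w : Fn B M ⊗[ℝ] Fib U W}
    (hw : ∀ᶠ y in 𝓝 x₀, tensorEval B U W y w = 0) : tensorDeriv W r w = 0 := by
  obtain ⟨n, e, ξ, hξ⟩ := exists_dual_family U
  refine (Module.forall_dual_apply_eq_zero_iff ℝ _).1 fun l => ?_
  let m (i : Fin n) : Fn B M ⊗[ℝ] Fib U W →ₗ[ℝ] Fn B M :=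
    TensorProduct.lift (((LinearMap.lsmul ℝ (Fn B M)).comp
      (l.comp (LinearMap.mulLeft ℝ (genOdd U W (ξ i))))).flip)
  have hm (i : Fin n) (f : Fn B M) (a : Fib U W) :
      m i (f ⊗ₜ a) = l (genOdd U W (ξ i) * a) • f := rfl
  have h1 (w : Fn B M ⊗[ℝ] Fib U W) :
      l (tensorDeriv W r w) = ∑ i, dirDeriv (m i w) x₀ (r (e i)) := by
    induction w using TensorProduct.induction_on with
    | zero => simp only [map_zero, ← pullDiff_apply, LinearMap.zero_apply, Finset.sum_const_zero]
    | add a b ha hb => simp only [map_add, ha, hb, dirDeriv_add, Finset.sum_add_distrib]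
    | tmul f a =>
      have h2 : pullDiff r f = ∑ i, dirDeriv f x₀ (r (e i)) • ξ i := by
        ext u
        conv_lhs => rw [← hξ u, map_sum]
        rw [LinearMap.sum_apply]
        refine Finset.sum_congr rfl fun i _ => ?_
        rw [map_smul, LinearMap.smul_apply, smul_eq_mul, smul_eq_mul, mul_comm, pullDiff_apply]
      simp only [tensorDeriv_tmul, h2, map_sum, map_smul, Finset.sum_mul, smul_mul_assoc, hm,
        dirDeriv_const_smul, smul_eq_mul]
      exact Finset.sum_congr rfl fun i _ => mul_comm _ _
  have h3 (i : Fin n) (y : M) (w : Fn B M ⊗[ℝ] Fib U W) :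
      m i w y = l (genOdd U W (ξ i) * tensorEval B U W y w) := by
    induction w using TensorProduct.induction_on with
    | zero =>
      rw [map_zero, map_zero, mul_zero, map_zero]
      rfl
    | add a b ha hb =>
      rw [map_add, map_add, mul_add, map_add, ← ha, ← hb]
      rfl
    | tmul f a =>
      rw [hm, tensorEval_tmul, mul_smul_comm, map_smul, smul_eq_mul, mul_comm]
      rfl
  rw [h1]
  refine Finset.sum_eq_zero fun i _ => ?_
  have h4 : ∀ᶠ y in 𝓝 x₀, m i w y = (0 : Fn B M) y := by
    filter_upwards [hw] with y hy
    rw [h3, hy, mul_zero, map_zero]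
    rfl
  rw [dirDeriv_congr h4, ← pullDiff_apply, map_zero]
  rfl

end TensorDerivative

/-! ### Derivations into the fibre at a point -/

section PointwiseDerivation

variable {B : Type*} [NormedAddCommGroup B] [NormedSpace ℝ B]
  {M : Type*} [TopologicalSpace M] [ChartedSpace B M]
  {F : Type*} [NormedAddCommGroup F] [NormedSpace ℝ F]
  {E : M → Type*} [TopologicalSpace (TotalSpace F E)] [∀ x, TopologicalSpace (E x)]
  [∀ x, AddCommGroup (E x)] [∀ x, Module ℝ (E x)] [FiberBundle F E] [VectorBundle ℝ F E]
  {G : Type*} [NormedAddCommGroup G] [NormedSpace ℝ G]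
  {V : M → Type*} [TopologicalSpace (TotalSpace G V)] [∀ x, TopologicalSpace (V x)]
  [∀ x, AddCommGroup (V x)] [∀ x, Module ℝ (V x)] [FiberBundle G V] [VectorBundle ℝ G V]

local notation "𝒮" => superFun B F E G V

/-- Evaluation of the sections `j u` at `y`. -/
def evalExtend {x₀ : M} (j : E x₀ →ₗ[ℝ] Sec B F E) (y : M) : E x₀ →ₗ[ℝ] E y where
  toFun u := j u y
  map_add' u u' := by rw [map_add]; rfl
  map_smul' c u := by rw [map_smul]; rfl

variable {x₀ : M} {jE : E x₀ →ₗ[ℝ] Sec B F E} {jV : V x₀ →ₗ[ℝ] Sec B G V}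

section

variable {n m : ℕ} {e : Fin n → E x₀} {ξ : Fin n → Module.Dual ℝ (E x₀)}
  {b : Fin m → V x₀} {η : Fin m → Module.Dual ℝ (V x₀)}

lemma dual_eq_sum {U : Type*} [AddCommGroup U] [Module ℝ U] {n : ℕ} {e : Fin n → U}
    {ξ : Fin n → Module.Dual ℝ U} (hξ : ∀ u, ∑ i, ξ i u • e i = u) (α : Module.Dual ℝ U) :
    ∑ i, α (e i) • ξ i = α := by
  ext u
  conv_rhs => rw [← hξ u, map_sum]
  rw [LinearMap.sum_apply]
  exact Finset.sum_congr rfl fun i _ => by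
    rw [map_smul, LinearMap.smul_apply, smul_eq_mul, smul_eq_mul, mul_comm]

lemma tensorEval_dualE (hξ : ∀ u, ∑ i, ξ i u • e i = u) (α : DualSec B F E) (y : M) :
    tensorEval B (E x₀) (V x₀) y (∑ i, α.pair (jE (e i)) ⊗ₜ genOdd (E x₀) (V x₀) (ξ i)) =
      Fib.map (evalExtend jE y) (evalExtend jV y) ((ofDualE G V α).1 y) := by
  refine Eq.trans ?_ (Fib.map_genOdd _ _ _).symm
  rw [← dual_eq_sum hξ (α.toFun y ∘ₗ evalExtend jE y)]
  simp only [map_sum, map_smul, tensorEval_tmul]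
  rfl

lemma tensorEval_dualV (hη : ∀ w, ∑ i, η i w • b i = w) (β : DualSec B G V) (y : M) :
    tensorEval B (E x₀) (V x₀) y (∑ i, β.pair (jV (b i)) ⊗ₜ genEven (E x₀) (V x₀) (η i)) =
      Fib.map (evalExtend jE y) (evalExtend jV y) ((ofDualV F E β).1 y) := by
  refine Eq.trans ?_ (Fib.map_genEven _ _ _).symm
  rw [← dual_eq_sum hη (β.toFun y ∘ₗ evalExtend jV y)]
  simp only [map_sum, map_smul, tensorEval_tmul]
  rfl

lemma tensorEval_fn (f : Fn B M) (y : M) :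
    tensorEval B (E x₀) (V x₀) y (f ⊗ₜ 1) =
      Fib.map (evalExtend jE y) (evalExtend jV y) ((ofFn F E G V f).1 y) := by
  rw [tensorEval_tmul, ← Algebra.algebraMap_eq_smul_one]
  exact (AlgHom.commutes _ _).symm

end

variable [FiniteDimensional ℝ F] [FiniteDimensional ℝ G]

-- The extensions `jE` and `jV` pull the fibres near `x₀` back to the fibre at `x₀`. A function
-- thereby becomes, near `x₀`, a function with values in one fixed algebra, and being a polynomial
-- in the generators it is given by a finite tensor.
variable (jE jV) in
lemma exists_tensor (s : 𝒮) : ∃ w, ∀ᶠ y in 𝓝 x₀, tensorEval B (E x₀) (V x₀) y w =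
    Fib.map (evalExtend jE y) (evalExtend jV y) (s.1 y) := by
  have := finiteDimensional_fibre F E x₀
  have := finiteDimensional_fibre G V x₀
  obtain ⟨n, e, ξ, hξ⟩ := exists_dual_family (E x₀)
  obtain ⟨m, b, η, hη⟩ := exists_dual_family (V x₀)
  obtain ⟨g, hg, hs⟩ := exists_polySuperFun s x₀
  have key : ∃ w, ∀ y, tensorEval B (E x₀) (V x₀) y w =
      Fib.map (evalExtend jE y) (evalExtend jV y) (g.1 y) := by
    clear hs
    induction hg using polySuperFun_induction with
    | hC c => exact ⟨algebraMap ℝ _ c, fun y => (AlgHom.commutes _ _).trans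
        (AlgHom.commutes (Fib.map (evalExtend jE y) (evalExtend jV y)) c).symm⟩
    | hf f => exact ⟨_, tensorEval_fn f⟩
    | hE α => exact ⟨_, tensorEval_dualE hξ α⟩
    | hV β => exact ⟨_, tensorEval_dualV hη β⟩
    | hadd a b _ _ ha hb =>
      obtain ⟨w, hw⟩ := ha
      obtain ⟨w', hw'⟩ := hb
      exact ⟨w + w', fun y => by rw [map_add, hw, hw', ← map_add]; rfl⟩
    | hmul a b _ _ ha hb =>
      obtain ⟨w, hw⟩ := ha
      obtain ⟨w', hw'⟩ := hb
      exact ⟨w * w', fun y => by rw [map_mul, hw, hw', ← map_mul]; rfl⟩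
  obtain ⟨w, hw⟩ := key
  refine ⟨w, ?_⟩
  filter_upwards [hs] with y hy
  rw [hw, hy]

/-- The derivation at `x₀` with horizontal part `r` and vertical part `δ`, with respect to the
local trivialization given by `jE` and `jV`. -/
lemma exists_pointDerivation (hE : ∀ u, jE u x₀ = u) (hV : ∀ w, jV w x₀ = w)
    (r : E x₀ →ₗ[ℝ] TangentSpace 𝓘(ℝ, B) x₀)
    {δ : Fib (E x₀) (V x₀) →ₗ[ℝ] Fib (E x₀) (V x₀)}
    (hδ : ∀ a b, δ (a * b) = δ a * b + parity _ _ a * δ b) :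
    ∃ D : 𝒮 →ₗ[ℝ] Fib (E x₀) (V x₀),
      (∀ s s', D (s * s') = D s * s'.1 x₀ + parity _ _ (s.1 x₀) * D s') ∧
      ∀ s w, (∀ᶠ y in 𝓝 x₀, tensorEval B (E x₀) (V x₀) y w =
        Fib.map (evalExtend jE y) (evalExtend jV y) (s.1 y)) →
          D s = tensorDeriv (V x₀) r w + δ (s.1 x₀) := by
  have := finiteDimensional_fibre F E x₀
  choose w hw using exists_tensor (F := F) (E := E) (G := G) (V := V) jE jV
  -- The representing tensor is not unique, but two of them have the same values near `x₀`, and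
  -- `tensorDeriv` depends on these values only.
  have uniq {w w' : Fn B M ⊗[ℝ] Fib (E x₀) (V x₀)} {s : 𝒮}
      (h : ∀ᶠ y in 𝓝 x₀, tensorEval B (E x₀) (V x₀) y w =
        Fib.map (evalExtend jE y) (evalExtend jV y) (s.1 y))
      (h' : ∀ᶠ y in 𝓝 x₀, tensorEval B (E x₀) (V x₀) y w' =
        Fib.map (evalExtend jE y) (evalExtend jV y) (s.1 y)) :
      tensorDeriv (V x₀) r w = tensorDeriv (V x₀) r w' := by
    rw [← sub_eq_zero, ← map_sub]
    refine tensorDeriv_eq_zero r ?_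
    filter_upwards [h, h'] with y h1 h2
    rw [map_sub, h1, h2, sub_self]
  have hx (s : 𝒮) : tensorEval B (E x₀) (V x₀) x₀ (w s) = s.1 x₀ := by
    have h1 : evalExtend jE x₀ = LinearMap.id := LinearMap.ext hE
    have h2 : evalExtend jV x₀ = LinearMap.id := LinearMap.ext hV
    rw [(hw s).self_of_nhds, h1, h2, Fib.map_id, AlgHom.id_apply]
  refine ⟨{ toFun := fun s => tensorDeriv (V x₀) r (w s) + δ (s.1 x₀)
            map_add' := fun s s' => ?_
            map_smul' := fun c s => ?_ }, fun s s' => ?_, fun s w' h => ?_⟩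
  · have : tensorDeriv (V x₀) r (w (s + s')) = tensorDeriv (V x₀) r (w s + w s') := by
      refine uniq (hw _) ?_
      filter_upwards [hw s, hw s'] with y h1 h2
      rw [map_add, h1, h2, ← map_add]
      rfl
    rw [this, map_add]
    change _ + δ (s.1 x₀ + s'.1 x₀) = _
    rw [map_add]
    abel
  · have : tensorDeriv (V x₀) r (w (c • s)) = tensorDeriv (V x₀) r (c • w s) := by
      refine uniq (hw _) ?_
      filter_upwards [hw s] with y h1
      rw [map_smul, h1, ← map_smul]
      rfl
    rw [this, map_smul]
    change _ + δ (c • s.1 x₀) = _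
    rw [map_smul, RingHom.id_apply, smul_add]
  · have : tensorDeriv (V x₀) r (w (s * s')) = tensorDeriv (V x₀) r (w s * w s') := by
      refine uniq (hw _) ?_
      filter_upwards [hw s, hw s'] with y h1 h2
      rw [map_mul, h1, h2, ← map_mul]
      rfl
    simp only [LinearMap.coe_mk, AddHom.coe_mk]
    rw [this, tensorDeriv_mul, hx, hx]
    change _ + δ (s.1 x₀ * s'.1 x₀) = _
    rw [hδ]
    noncomm_ring
  · simp only [LinearMap.coe_mk, AddHom.coe_mk]
    rw [uniq (hw s) h]

end PointwiseDerivation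

/-! ### Forms on the fibre with prescribed contractions -/

section FibreForms

variable {U W N : Type*} [AddCommGroup U] [Module ℝ U] [AddCommGroup W] [Module ℝ W]
  [AddCommGroup N] [Module ℝ N]

lemma contractOdd_contractOdd_genOdd_mul (u u' : U) (α α' : Module.Dual ℝ U) :
    contractOdd u' (contractOdd u (genOdd U W α * genOdd U W α')) =
      algebraMap ℝ _ (α u * α' u' - α' u * α u') := by
  rw [contractOdd_genOdd_mul, contractOdd_genOdd, map_sub, map_smul, contractOdd_genOdd,
    contractOdd_genOdd_mul, contractOdd_algebraMap, mul_zero, sub_zero, map_sub, map_mul, map_mul,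
    Algebra.smul_def, Algebra.smul_def]
  exact congrArg _ (Algebra.commutes _ _)

lemma genOdd_mul_genOdd_mem (α α' : Module.Dual ℝ U) :
    genOdd U W α * genOdd U W α' ∈ fibDegree U W 2 :=
  mul_mem_fibDegree (k := 1) (l := 1) (genOdd_mem α) (genOdd_mem α')

lemma genOdd_mul_genEven_mem (α : Module.Dual ℝ U) (β : Module.Dual ℝ W) :
    genOdd U W α * genEven U W β ∈ fibDegree U W 3 :=
  mul_mem_fibDegree (k := 1) (l := 2) (genOdd_mem α) (genEven_mem β)

/-- The two-form with values in `N` given by an antisymmetric bilinear map. -/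
lemma exists_twoForm [FiniteDimensional ℝ U] {c : U →ₗ[ℝ] U →ₗ[ℝ] N}
    (hc : ∀ u u', c u u' = -c u' u) : ∃ o : Module.Dual ℝ N →ₗ[ℝ] Fib U W,
      (∀ α, o α ∈ fibDegree U W 2) ∧
      (∀ α u u', contractOdd u' (contractOdd u (o α)) = algebraMap ℝ _ (α (c u u'))) ∧
      ∀ α w, contractEven w (o α) = 0 := by
  obtain ⟨n, e, ξ, hξ⟩ := exists_dual_family U
  -- The sum runs over all ordered pairs, and by antisymmetry each pair contributes twice; hence the
  -- factor 1/2.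
  refine ⟨∑ i, ∑ k, (Module.Dual.eval ℝ N (c (e i) (e k))).smulRight
    ((1 / 2 : ℝ) • (genOdd U W (ξ i) * genOdd U W (ξ k))), fun α => ?_, fun α u u' => ?_,
    fun α w => ?_⟩
  · simp only [LinearMap.sum_apply, LinearMap.smulRight_apply]
    exact Submodule.sum_mem _ fun i _ => Submodule.sum_mem _ fun k _ =>
      Submodule.smul_mem _ _ (Submodule.smul_mem _ _ (genOdd_mul_genOdd_mem _ _))
  · have h1 (u u' : U) : α (c u u') = ∑ i, ∑ k, ξ i u * ξ k u' * α (c (e i) (e k)) := by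
      conv_lhs => rw [← hξ u, ← hξ u']
      simp only [map_sum, map_smul, LinearMap.sum_apply, LinearMap.smul_apply, smul_eq_mul,
        Finset.mul_sum]
      rw [Finset.sum_comm]
      exact Finset.sum_congr rfl fun i _ => Finset.sum_congr rfl fun k _ => by ring
    have h2 : α (c u u') = (1 / 2) * (α (c u u') - α (c u' u)) := by
      rw [hc u' u, map_neg]
      ring
    rw [h2, h1 u u', h1 u' u, ← Finset.sum_sub_distrib, Finset.mul_sum]
    simp only [LinearMap.sum_apply, LinearMap.smulRight_apply, map_sum, map_smul,
      contractOdd_contractOdd_genOdd_mul, ← Finset.sum_sub_distrib, Finset.mul_sum]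
    refine Finset.sum_congr rfl fun i _ => Finset.sum_congr rfl fun k _ => ?_
    rw [Algebra.smul_def, Algebra.smul_def, ← map_mul, ← map_mul]
    congr 1
    rw [Module.Dual.eval_apply]
    ring
  · simp only [LinearMap.sum_apply, LinearMap.smulRight_apply, map_sum, map_smul,
      contractEven_genOdd_mul, contractEven_genOdd, mul_zero, smul_zero, Finset.sum_const_zero]

/-- The element of `U* ⊗ W*` with values in `N` given by a bilinear map. -/
lemma exists_mixedForm [FiniteDimensional ℝ U] [FiniteDimensional ℝ W]
    (c : U →ₗ[ℝ] W →ₗ[ℝ] N) : ∃ o : Module.Dual ℝ N →ₗ[ℝ] Fib U W,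
      (∀ β, o β ∈ fibDegree U W 3) ∧
      (∀ β u u', contractOdd u' (contractOdd u (o β)) = 0) ∧
      ∀ β u w, contractEven w (contractOdd u (o β)) = algebraMap ℝ _ (β (c u w)) := by
  obtain ⟨n, e, ξ, hξ⟩ := exists_dual_family U
  obtain ⟨m, b, η, hη⟩ := exists_dual_family W
  refine ⟨∑ i, ∑ k, (Module.Dual.eval ℝ N (c (e i) (b k))).smulRight
    (genOdd U W (ξ i) * genEven U W (η k)), fun β => ?_, fun β u u' => ?_, fun β u w => ?_⟩
  · simp only [LinearMap.sum_apply, LinearMap.smulRight_apply]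
    exact Submodule.sum_mem _ fun i _ => Submodule.sum_mem _ fun k _ =>
      Submodule.smul_mem _ _ (genOdd_mul_genEven_mem _ _)
  · simp only [LinearMap.sum_apply, LinearMap.smulRight_apply, map_sum, map_smul,
      contractOdd_genOdd_mul, contractOdd_genEven, mul_zero, sub_zero, smul_zero,
      Finset.sum_const_zero]
  · conv_rhs => rw [← hξ u, ← hη w]
    simp only [map_sum, map_smul, LinearMap.sum_apply, LinearMap.smul_apply, smul_eq_mul,
      LinearMap.smulRight_apply, contractOdd_genOdd_mul, contractOdd_genEven, mul_zero, sub_zero,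
      contractEven_genEven, Finset.smul_sum]
    rw [Finset.sum_comm]
    refine Finset.sum_congr rfl fun i _ => Finset.sum_congr rfl fun k _ => ?_
    rw [Algebra.smul_def, Algebra.smul_def, ← map_mul, ← map_mul]
    congr 1
    rw [Module.Dual.eval_apply]
    ring

end FibreForms

/-! ### The vector field of a crossed module at a point -/

section QOfCrossedModule

variable {B : Type*} [NormedAddCommGroup B] [NormedSpace ℝ B] [FiniteDimensional ℝ B]
  {M : Type*} [TopologicalSpace M] [T2Space M] [ChartedSpace B M] [IsManifold 𝓘(ℝ, B) ∞ M]
  {F : Type*} [NormedAddCommGroup F] [NormedSpace ℝ F] [FiniteDimensional ℝ F]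
  {E : M → Type*} [TopologicalSpace (TotalSpace F E)] [∀ x, TopologicalSpace (E x)]
  [∀ x, AddCommGroup (E x)] [∀ x, Module ℝ (E x)] [FiberBundle F E] [VectorBundle ℝ F E]
  [ContMDiffVectorBundle ∞ F E 𝓘(ℝ, B)]
  {G : Type*} [NormedAddCommGroup G] [NormedSpace ℝ G] [FiniteDimensional ℝ G]
  {V : M → Type*} [TopologicalSpace (TotalSpace G V)] [∀ x, TopologicalSpace (V x)]
  [∀ x, AddCommGroup (V x)] [∀ x, Module ℝ (V x)] [FiberBundle G V] [VectorBundle ℝ G V]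
  [ContMDiffVectorBundle ∞ G V 𝓘(ℝ, B)]

local notation "𝒮" => superFun B F E G V

/-! ### Tensoriality -/

lemma LieAlgebroid.bracket_antisymm (A : LieAlgebroid B F E) (ψ φ : Sec B F E) :
    A.bracket ψ φ = -A.bracket φ ψ := by
  have h := A.bracket_self (ψ + φ)
  simp only [map_add, LinearMap.add_apply, A.bracket_self, zero_add, add_zero] at h
  exact eq_neg_of_add_eq_zero_right h

lemma LieAlgebroid.bracket_smulSec (A : LieAlgebroid B F E) (ψ φ : Sec B F E) (f : Fn B M) :
    A.bracket ψ (smulSec f φ) =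
      smulSec f (A.bracket ψ φ) + smulSec (lieDeriv (A.anchor.onSec ψ) f) φ := by
  ext x
  exact A.leibniz ψ φ f x

lemma Representation.conn_smulSec {A : LieAlgebroid B F E} (R : Representation A G V)
    (ψ : Sec B F E) (v : Sec B G V) (f : Fn B M) :
    R.conn ψ (smulSec f v) =
      smulSec (lieDeriv (A.anchor.onSec ψ) f) v + smulSec f (R.conn ψ v) := by
  ext x
  exact R.leibniz ψ f v x

/-- The differential of `α ∈ Γ(E*)`, evaluated on two sections. -/
def LieAlgebroid.dual (A : LieAlgebroid B F E) (α : DualSec B F E) (ψ φ : Sec B F E) : Fn B M :=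
  lieDeriv (A.anchor.onSec ψ) (α.pair φ) - lieDeriv (A.anchor.onSec φ) (α.pair ψ) -
    α.pair (A.bracket ψ φ)

/-- The covariant derivative of `β ∈ Γ(V*)`, evaluated on sections. -/
def Representation.dual {A : LieAlgebroid B F E} (R : Representation A G V) (β : DualSec B G V)
    (ψ : Sec B F E) (v : Sec B G V) : Fn B M :=
  lieDeriv (A.anchor.onSec ψ) (β.pair v) - β.pair (R.conn ψ v)

lemma DualSec.pair_neg (α : DualSec B F E) (ψ : Sec B F E) : α.pair (-ψ) = -α.pair ψ := by
  ext x
  exact map_neg (α.toFun x) _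

lemma LieAlgebroid.dual_antisymm (A : LieAlgebroid B F E) (α : DualSec B F E)
    (ψ φ : Sec B F E) : A.dual α ψ φ = -A.dual α φ ψ := by
  rw [dual, dual, A.bracket_antisymm φ ψ, DualSec.pair_neg]
  ring

/-- Replacing `φ` by `f φ`, the derivative of `f` in `ρ(ψ) α(f φ)` cancels the one from the Leibniz
rule of the bracket, so the expression is tensorial. -/
lemma LieAlgebroid.dual_congr_right (A : LieAlgebroid B F E) (α : DualSec B F E)
    (ψ : Sec B F E) {φ φ' : Sec B F E} {x : M} (h : φ x = φ' x) :
    A.dual α ψ φ x = A.dual α ψ φ' x := by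
  let T : Sec B F E →+ ℝ := AddMonoidHom.mk' (fun φ => A.dual α ψ φ x) fun φ φ' => by
    have : A.dual α ψ (φ + φ') = A.dual α ψ φ + A.dual α ψ φ' := by
      simp only [dual, DualSec.pair_add, lieDeriv_add, BundleMap.onSec_add, add_lieDeriv, map_add]
      abel
    rw [this]
    rfl
  refine tensorial_congr (T := T) (fun f φ => ?_) h
  have : A.dual α ψ (smulSec f φ) = f * A.dual α ψ φ := by
    simp only [dual, DualSec.pair_smulSec, lieDeriv_mul, BundleMap.onSec_smulSec,
      smulSec_lieDeriv, A.bracket_smulSec, DualSec.pair_add]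
    ring
  exact DFunLike.congr_fun this x

lemma LieAlgebroid.dual_congr (A : LieAlgebroid B F E) (α : DualSec B F E)
    {ψ ψ' φ φ' : Sec B F E} {x : M} (hψ : ψ x = ψ' x) (hφ : φ x = φ' x) :
    A.dual α ψ φ x = A.dual α ψ' φ' x := by
  rw [A.dual_congr_right α ψ hφ, A.dual_antisymm, A.dual_antisymm α ψ']
  change -A.dual α φ' ψ x = -A.dual α φ' ψ' x
  rw [A.dual_congr_right α φ' hψ]

lemma Representation.dual_congr {A : LieAlgebroid B F E} (R : Representation A G V)
    (β : DualSec B G V) {ψ ψ' : Sec B F E} {v v' : Sec B G V} {x : M} (hψ : ψ x = ψ' x)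
    (hv : v x = v' x) : R.dual β ψ v x = R.dual β ψ' v' x := by
  let T : Sec B F E →+ ℝ := AddMonoidHom.mk' (fun ψ => R.dual β ψ v x) fun ψ ψ' => by
    have : R.dual β (ψ + ψ') v = R.dual β ψ v + R.dual β ψ' v := by
      simp only [dual, DualSec.pair_add, BundleMap.onSec_add, add_lieDeriv, map_add,
        LinearMap.add_apply]
      abel
    rw [this]
    rfl
  let T' : Sec B G V →+ ℝ := AddMonoidHom.mk' (fun v => R.dual β ψ' v x) fun v v' => by
    have : R.dual β ψ' (v + v') = R.dual β ψ' v + R.dual β ψ' v' := by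
      simp only [dual, DualSec.pair_add, lieDeriv_add, map_add]
      abel
    rw [this]
    rfl
  have h1 : R.dual β ψ v x = R.dual β ψ' v x := by
    refine tensorial_congr (T := T) (fun f ψ => ?_) hψ
    have : R.dual β (smulSec f ψ) v = f * R.dual β ψ v := by
      simp only [dual, BundleMap.onSec_smulSec, smulSec_lieDeriv, R.smul_left,
        DualSec.pair_smulSec]
      ring
    exact DFunLike.congr_fun this x
  rw [h1]
  refine tensorial_congr (T := T') (fun f v => ?_) hv
  have : R.dual β ψ' (smulSec f v) = f * R.dual β ψ' v := by
    simp only [dual, DualSec.pair_smulSec, lieDeriv_mul, R.conn_smulSec, DualSec.pair_add]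
    ring
  exact DFunLike.congr_fun this x

/-! ### The values of the vector field -/

/-- Evaluation of sections at a point. -/
def evalSec (x : M) : Sec B F E →ₗ[ℝ] E x where
  toFun ψ := ψ x
  map_add' _ _ := rfl
  map_smul' _ _ := rfl

lemma sum_mul_dirDeriv_pair {x₀ : M} (j : E x₀ →ₗ[ℝ] Sec B F E) {n : ℕ} {e : Fin n → E x₀}
    {ξ : Fin n → Module.Dual ℝ (E x₀)} (hξ : ∀ u, ∑ i, ξ i u • e i = u) (α : DualSec B F E)
    (Y : TangentSpace 𝓘(ℝ, B) x₀) (u : E x₀) :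
    ∑ i, ξ i u * dirDeriv (α.pair (j (e i))) x₀ Y = dirDeriv (α.pair (j u)) x₀ Y := by
  let L : E x₀ →ₗ[ℝ] ℝ :=
    { toFun := fun u => dirDeriv (α.pair (j u)) x₀ Y
      map_add' := fun u u' => by rw [map_add, DualSec.pair_add, dirDeriv_add]
      map_smul' := fun c u => by
        rw [map_smul, DualSec.pair_const_smul, dirDeriv_const_smul]
        rfl }
  change _ = L u
  conv_rhs => rw [← hξ u, map_sum]
  exact Finset.sum_congr rfl fun i _ => (map_smul L _ _).symm

/-- `D` is the value at `x₀` of the vector field to be constructed. In the trivialization by `jE`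
and `jV` its horizontal part is the anchor, and its vertical part consists of `t` and of minus the
bracket and connection of the extended sections. -/
lemma exists_pointQ (X : CrossedModule B F E G V) (x₀ : M) :
    ∃ D : 𝒮 →ₗ[ℝ] Fib (E x₀) (V x₀),
      (∀ s s', D (s * s') = D s * s'.1 x₀ + parity _ _ (s.1 x₀) * D s') ∧
      (∀ s s' : 𝒮, (∀ᶠ y in 𝓝 x₀, s.1 y = s'.1 y) → D s = D s') ∧
      (∀ f, D (ofFn F E G V f) = genOdd _ _ (pullDiff (X.algE.anchor.toFun x₀) f)) ∧
      (∀ α, D (ofDualE G V α) ∈ fibDegree (E x₀) (V x₀) 2 ∧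
        (∀ ψ φ : Sec B F E, contractOdd (φ x₀) (contractOdd (ψ x₀) (D (ofDualE G V α))) =
          algebraMap ℝ _ (X.algE.dual α ψ φ x₀)) ∧
        ∀ v : Sec B G V, contractEven (v x₀) (D (ofDualE G V α)) =
          algebraMap ℝ _ (α.pair (X.t.onSec v) x₀)) ∧
      ∀ β, D (ofDualV F E β) ∈ fibDegree (E x₀) (V x₀) 3 ∧
        (∀ ψ φ : Sec B F E, contractOdd (φ x₀) (contractOdd (ψ x₀) (D (ofDualV F E β))) = 0) ∧
        ∀ (ψ : Sec B F E) (v : Sec B G V),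
          contractEven (v x₀) (contractOdd (ψ x₀) (D (ofDualV F E β))) =
            algebraMap ℝ _ (X.rep.dual β ψ v x₀) := by
  have := finiteDimensional_fibre F E x₀
  have := finiteDimensional_fibre G V x₀
  obtain ⟨jE, hjE⟩ := exists_extend B F (E := E) x₀
  obtain ⟨jV, hjV⟩ := exists_extend B G (E := V) x₀
  obtain ⟨n, e, ξ, hξ⟩ := exists_dual_family (E x₀)
  obtain ⟨m, b, η, hη⟩ := exists_dual_family (V x₀)
  set r := X.algE.anchor.toFun x₀
  obtain ⟨o, ho1, ho2, ho3⟩ := exists_twoForm (W := V x₀)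
    (c := (X.algE.bracket.compl₁₂ jE jE).compr₂ (evalSec x₀)) (fun u u' => by
      change X.algE.bracket (jE u) (jE u') x₀ = -X.algE.bracket (jE u') (jE u) x₀
      rw [X.algE.bracket_antisymm]
      rfl)
  obtain ⟨p, hp1, hp2, hp3⟩ := exists_mixedForm
    ((X.rep.conn.compl₁₂ jE jV).compr₂ (evalSec x₀))
  have hdeg (α : Module.Dual ℝ (E x₀)) : -o α + genEven (E x₀) (V x₀) (α ∘ₗ X.t.toFun x₀) ∈
      fibDegree (E x₀) (V x₀) 2 := add_mem (neg_mem (ho1 α)) (genEven_mem _)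
  obtain ⟨δ, hδ1, hδ2, hδ3⟩ := Fib.exists_oddDerivation
    (-o + (genEven (E x₀) (V x₀)).comp (X.t.toFun x₀).dualMap) (-p)
    (fun α => (parity_eq_smul (hdeg α)).trans (by rw [neg_one_sq, one_smul]; rfl))
    (fun β => (parity_eq_smul (neg_mem (hp1 β))).trans (by
      rw [Odd.neg_one_pow (by decide), neg_one_smul]
      rfl))
  have hδ0 (c : ℝ) : δ (algebraMap ℝ _ c) = 0 := by
    rw [Algebra.algebraMap_eq_smul_one, map_smul,
      map_one_of_leibniz (f := parity _ _) (g := AlgHom.id ℝ _) hδ1, smul_zero]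
  obtain ⟨D, hD1, hD2⟩ := exists_pointDerivation (F := F) (G := G) hjE hjV r hδ1
  have hf (f : Fn B M) : D (ofFn F E G V f) = genOdd _ _ (pullDiff r f) := by
    rw [hD2 _ _ (Eventually.of_forall (tensorEval_fn f)), tensorDeriv_tmul, mul_one]
    exact (congrArg _ (hδ0 (f x₀))).trans (add_zero _)
  have hE (α : DualSec B F E) : D (ofDualE G V α) =
      ∑ i, genOdd _ _ (pullDiff r (α.pair (jE (e i)))) * genOdd _ _ (ξ i) +
        (-o (α.toFun x₀) + genEven (E x₀) (V x₀) (α.toFun x₀ ∘ₗ X.t.toFun x₀)) := by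
    rw [hD2 _ _ (Eventually.of_forall (tensorEval_dualE hξ α)), map_sum]
    exact congrArg _ (hδ2 (α.toFun x₀))
  have hV (β : DualSec B G V) : D (ofDualV F E β) =
      ∑ i, genOdd _ _ (pullDiff r (β.pair (jV (b i)))) * genEven _ _ (η i) +
        -p (β.toFun x₀) := by
    rw [hD2 _ _ (Eventually.of_forall (tensorEval_dualV hη β)), map_sum]
    exact congrArg _ (hδ3 (β.toFun x₀))
  refine ⟨D, hD1, fun s s' h => ?_, hf, fun α => ⟨?_, fun ψ φ => ?_, fun v => ?_⟩,
    fun β => ⟨?_, fun ψ φ => ?_, fun ψ v => ?_⟩⟩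
  · obtain ⟨w, hw⟩ := exists_tensor (F := F) (G := G) jE jV s
    rw [hD2 s w hw, hD2 s' w (by
      filter_upwards [hw, h] with y h1 h2
      rw [h1, h2]), h.self_of_nhds]
  · rw [hE]
    exact add_mem (Submodule.sum_mem _ fun i _ => genOdd_mul_genOdd_mem _ _)
      (hdeg _)
  -- By tensoriality `ψ` and `φ` may be replaced by the extensions of their values at `x₀`, for
  -- which the formula holds by construction. This removes the dependence on the trivialization.
  · rw [X.algE.dual_congr α (hjE (ψ x₀)).symm (hjE (φ x₀)).symm, hE]
    simp only [map_add, map_sum, map_neg, contractOdd_contractOdd_genOdd_mul, ho2,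
      contractOdd_genEven, add_zero, pullDiff_apply]
    rw [← map_sum, ← map_neg, ← map_add, Finset.sum_sub_distrib, sum_mul_dirDeriv_pair jE hξ]
    congr 1
    have h1 : ∑ i, dirDeriv (α.pair (jE (e i))) x₀ (r (ψ x₀)) * ξ i (φ x₀) =
        dirDeriv (α.pair (jE (φ x₀))) x₀ (r (ψ x₀)) := by
      simp only [mul_comm _ (ξ _ (φ x₀))]
      exact sum_mul_dirDeriv_pair jE hξ α _ _
    rw [h1, ← sub_eq_add_neg]
    have h2 : X.algE.dual α (jE (ψ x₀)) (jE (φ x₀)) x₀ =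
        dirDeriv (α.pair (jE (φ x₀))) x₀ (r (jE (ψ x₀) x₀)) -
          dirDeriv (α.pair (jE (ψ x₀))) x₀ (r (jE (φ x₀) x₀)) -
          α.toFun x₀ (X.algE.bracket (jE (ψ x₀)) (jE (φ x₀)) x₀) := rfl
    rw [h2, hjE, hjE]
    rfl
  · rw [hE]
    simp only [map_add, map_sum, map_neg, ho3, contractEven_genOdd_mul, contractEven_genOdd,
      mul_zero, Finset.sum_const_zero, neg_zero, zero_add, contractEven_genEven]
    rfl
  · rw [hV]
    exact add_mem (Submodule.sum_mem _ fun i _ => genOdd_mul_genEven_mem _ _) (neg_mem (hp1 _))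
  · rw [hV]
    simp only [map_add, map_sum, map_neg, hp2, contractOdd_genOdd_mul, contractOdd_genEven,
      mul_zero, sub_zero, map_smul, smul_zero, Finset.sum_const_zero, neg_zero, zero_add]
  · rw [X.rep.dual_congr β (hjE (ψ x₀)).symm (hjV (v x₀)).symm, hV]
    simp only [map_add, map_sum, map_neg, hp3, contractOdd_genOdd_mul, contractOdd_genEven,
      mul_zero, sub_zero, map_smul, contractEven_genEven, pullDiff_apply]
    have h2 : X.rep.dual β (jE (ψ x₀)) (jV (v x₀)) x₀ =
        dirDeriv (β.pair (jV (v x₀))) x₀ (r (jE (ψ x₀) x₀)) -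
          β.toFun x₀ (X.rep.conn (jE (ψ x₀)) (jV (v x₀)) x₀) := rfl
    rw [h2, hjE, ← sum_mul_dirDeriv_pair jV hη, map_sub, map_sum, ← sub_eq_add_neg]
    refine congrArg₂ _ (Finset.sum_congr rfl fun i _ => ?_) rfl
    rw [Algebra.smul_def, ← map_mul, mul_comm]

end QOfCrossedModule

/-! ### The global odd derivation of a crossed module -/

section GlobalDerivation

variable {B : Type*} [NormedAddCommGroup B] [NormedSpace ℝ B] [FiniteDimensional ℝ B]
  {M : Type*} [TopologicalSpace M] [T2Space M] [ChartedSpace B M] [IsManifold 𝓘(ℝ, B) ∞ M]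
  {F : Type*} [NormedAddCommGroup F] [NormedSpace ℝ F] [FiniteDimensional ℝ F]
  {E : M → Type*} [TopologicalSpace (TotalSpace F E)] [∀ x, TopologicalSpace (E x)]
  [∀ x, AddCommGroup (E x)] [∀ x, Module ℝ (E x)] [FiberBundle F E] [VectorBundle ℝ F E]
  [ContMDiffVectorBundle ∞ F E 𝓘(ℝ, B)]
  {G : Type*} [NormedAddCommGroup G] [NormedSpace ℝ G] [FiniteDimensional ℝ G]
  {V : M → Type*} [TopologicalSpace (TotalSpace G V)] [∀ x, TopologicalSpace (V x)]
  [∀ x, AddCommGroup (V x)] [∀ x, Module ℝ (V x)] [FiberBundle G V] [VectorBundle ℝ G V]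
  [ContMDiffVectorBundle ∞ G V 𝓘(ℝ, B)]

local notation "𝒮" => superFun B F E G V

/-- An operator that satisfies the Leibniz rule of an odd derivation and raises the degree of the
generators by one is an odd derivation. -/
lemma isOddDer_of_leibniz {Q : Module.End ℝ 𝒮}
    (hQ : ∀ s s', Q (s * s') = Q s * s' + superParity B F E G V s * Q s')
    (hf : ∀ f, IsHomogeneous 1 (Q (ofFn F E G V f)))
    (hE : ∀ α, IsHomogeneous 2 (Q (ofDualE G V α)))
    (hV : ∀ β, IsHomogeneous 3 (Q (ofDualV F E β))) : IsOddDer (superParity B F E G V) Q := by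
  refine ⟨hQ, fun s => ?_⟩
  set σ := superParity B F E G V
  -- The operator `σ Q σ + Q` again satisfies the Leibniz rule twisted by `σ`, so its vanishing can
  -- be tested on generators, where it is a matter of degrees.
  have h : σ.toLinearMap * Q * σ.toLinearMap + Q = (0 : Module.End ℝ 𝒮) := by
    refine eq_zero_of_generators (τ := σ) (fun s s' => ?_) superParity_ofFn (fun f => ?_)
      (fun α => ?_) fun β => ?_
    · change σ (Q (σ (s * s'))) + Q (s * s') =
        (σ (Q (σ s)) + Q s) * s' + σ s * (σ (Q (σ s')) + Q s')
      rw [map_mul, hQ, hQ, map_add, map_mul, map_mul, superParity_superParity,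
        superParity_superParity]
      noncomm_ring
    · change σ (Q (σ (ofFn F E G V f))) + Q (ofFn F E G V f) = 0
      rw [superParity_ofFn, (hf f).superParity, pow_one, neg_one_smul, neg_add_cancel]
    · change σ (Q (σ (ofDualE G V α))) + Q (ofDualE G V α) = 0
      rw [superParity_ofDualE, map_neg, map_neg, (hE α).superParity, neg_one_sq, one_smul,
        neg_add_cancel]
    · change σ (Q (σ (ofDualV F E β))) + Q (ofDualV F E β) = 0
      rw [superParity_ofDualV, (hV β).superParity, Odd.neg_one_pow (by decide), neg_one_smul,
        neg_add_cancel]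
  have h2 : σ (Q (σ (σ s))) + Q (σ s) = 0 := LinearMap.congr_fun h (σ s)
  rw [superParity_superParity] at h2
  exact eq_neg_of_add_eq_zero_right h2

/-- The odd derivation with the components of a crossed module. -/
lemma CrossedModule.exists_components (X : CrossedModule B F E G V) :
    ∃ Q : Module.End ℝ 𝒮, Components Q X.algE.anchor (fun ψ φ => X.algE.bracket ψ φ)
      X.t (fun ψ v => X.rep.conn ψ v) := by
  choose D hD hloc hf hE hV using exists_pointQ X
  -- It suffices to treat generators. For `Q f` the section of `E*` is explicit; for `Q α` and `Q β`
  -- the iterated contractions are smooth functions or zero.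
  have hmem : ∀ s : 𝒮, (fun x => D x s) ∈ 𝒮 := by
    refine mem_superFun_of_leibniz (D := LinearMap.pi D) (τ := superParity B F E G V)
      (fun s s' x => hD x s s') (fun s s' x h => hloc x s s' h) (fun f => ?_) (fun α => ?_)
      fun β => ?_
    · have : (LinearMap.pi D (ofFn F E G V f)) =
          (ofDualE G V (⟨fun x => pullDiff (X.algE.anchor.toFun x) f,
            (differential f).smooth.comp X.algE.anchor.smooth⟩ : DualSec B F E)).1 :=
        funext fun x => hf x f
      rw [this]
      exact Subtype.property _
    · refine mem_superFun_of_contract (k := 2) two_ne_zero (fun x => (hE x α).1) (fun ψ => ?_)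
        fun v => ?_
      · refine mem_superFun_of_contract (k := 1) one_ne_zero
          (fun x => contractOdd_mem _ (hE x α).1) (fun φ => ?_) fun v => ?_
        · have : (fun x => contractOdd (φ x) (contractOdd (ψ x) (D x (ofDualE G V α)))) =
              (ofFn F E G V (X.algE.dual α ψ φ)).1 := funext fun x => (hE x α).2.1 ψ φ
          exact this ▸ Subtype.property _
        · have : (fun x => contractEven (v x) (contractOdd (ψ x) (D x (ofDualE G V α)))) = 0 :=
            funext fun x => contractEven_eq_zero_of_mem_one _ (contractOdd_mem _ (hE x α).1)
          exact this ▸ zero_mem 𝒮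
      · have : (fun x => contractEven (v x) (D x (ofDualE G V α))) =
            (ofFn F E G V (α.pair (X.t.onSec v))).1 := funext fun x => (hE x α).2.2 v
        exact this ▸ Subtype.property _
    · have h3 (ψ : Sec B F E) (v : Sec B G V) :
          (fun x => contractEven (v x) (contractOdd (ψ x) (D x (ofDualV F E β)))) =
            (ofFn F E G V (X.rep.dual β ψ v)).1 := funext fun x => (hV x β).2.2 ψ v
      refine mem_superFun_of_contract (k := 3) three_ne_zero (fun x => (hV x β).1) (fun ψ => ?_)
        fun v => ?_
      · refine mem_superFun_of_contract (k := 2) two_ne_zero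
          (fun x => contractOdd_mem _ (hV x β).1) (fun φ => ?_) fun v => ?_
        · have : (fun x => contractOdd (φ x) (contractOdd (ψ x) (D x (ofDualV F E β)))) = 0 :=
            funext fun x => (hV x β).2.1 ψ φ
          exact this ▸ zero_mem 𝒮
        · exact h3 ψ v ▸ Subtype.property _
      · refine mem_superFun_of_contract (k := 1) one_ne_zero
          (fun x => contractEven_mem _ (hV x β).1) (fun ψ => ?_) fun w => ?_
        · have : (fun x => contractOdd (ψ x) (contractEven (v x) (D x (ofDualV F E β)))) =
              (ofFn F E G V (X.rep.dual β ψ v)).1 :=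
            (funext fun x => (contractEven_contractOdd _ _ _).symm).trans (h3 ψ v)
          exact this ▸ Subtype.property _
        · have : (fun x => contractEven (w x) (contractEven (v x) (D x (ofDualV F E β)))) = 0 :=
            funext fun x => contractEven_eq_zero_of_mem_one _ (contractEven_mem _ (hV x β).1)
          exact this ▸ zero_mem 𝒮
  let Q : Module.End ℝ 𝒮 :=
    { toFun := fun s => ⟨fun x => D x s, hmem s⟩
      map_add' := fun s s' => superFun_ext fun x => map_add (D x) s s'
      map_smul' := fun c s => superFun_ext fun x => map_smul (D x) c s }
  have h1 (f : Fn B M) : IsHomogeneous 1 (Q (ofFn F E G V f)) := fun x => by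
    have : (Q (ofFn F E G V f)).1 x = genOdd _ _ (pullDiff (X.algE.anchor.toFun x) f) := hf x f
    rw [this]
    exact genOdd_mem _
  have h2 (α : DualSec B F E) : IsHomogeneous 2 (Q (ofDualE G V α)) := fun x => (hE x α).1
  have h3 (β : DualSec B G V) : IsHomogeneous 3 (Q (ofDualV F E β)) := fun x => (hV x β).1
  exact ⟨Q, isOddDer_of_leibniz (fun s s' => superFun_ext fun x => hD x s s') h1 h2 h3, h1, h2, h3,
    fun f ψ => superFun_ext fun x => (congrArg _ (hf x f)).trans (contractOdd_genOdd _ _),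
    fun α ψ φ => superFun_ext fun x => (hE x α).2.1 ψ φ,
    fun α v => superFun_ext fun x => (hE x α).2.2 v,
    fun β ψ v => superFun_ext fun x => (hV x β).2.2 ψ v,
    fun β ψ φ => superFun_ext fun x => (hV x β).2.1 ψ φ⟩

end GlobalDerivation

/-! ### Graded Jacobi identities for `[L, Q]`, without assuming `Q² = 0` -/

section RingIdentities

variable {R : Type*} [Ring R]

lemma anticommutator_curvature (Q L j : R) : j * (L * Q - Q * L) + (L * Q - Q * L) * j =
    L * (Q * j + j * Q) - (Q * j + j * Q) * L -
      (Q * (L * j - j * L) + (L * j - j * L) * Q) := by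
  noncomm_ring

lemma commutator_curvature (Q L j : R) : j * (L * Q - Q * L) =
    (L * Q - Q * L) * j - L * (Q * j - j * Q) + (Q * j - j * Q) * L +
      (Q * (L * j - j * L) - (L * j - j * L) * Q) := by
  noncomm_ring

end RingIdentities

/-! ### The identities of a crossed module imply `Q² = 0` -/

section SquareZero

variable {B : Type*} [NormedAddCommGroup B] [NormedSpace ℝ B] [FiniteDimensional ℝ B]
  {M : Type*} [TopologicalSpace M] [T2Space M] [ChartedSpace B M] [IsManifold 𝓘(ℝ, B) ∞ M]
  {F : Type*} [NormedAddCommGroup F] [NormedSpace ℝ F] [FiniteDimensional ℝ F]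
  {E : M → Type*} [TopologicalSpace (TotalSpace F E)] [∀ x, TopologicalSpace (E x)]
  [∀ x, AddCommGroup (E x)] [∀ x, Module ℝ (E x)] [FiberBundle F E] [VectorBundle ℝ F E]
  [ContMDiffVectorBundle ∞ F E 𝓘(ℝ, B)]
  {G : Type*} [NormedAddCommGroup G] [NormedSpace ℝ G] [FiniteDimensional ℝ G]
  {V : M → Type*} [TopologicalSpace (TotalSpace G V)] [∀ x, TopologicalSpace (V x)]
  [∀ x, AddCommGroup (V x)] [∀ x, Module ℝ (V x)] [FiberBundle G V] [VectorBundle ℝ G V]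
  [ContMDiffVectorBundle ∞ G V 𝓘(ℝ, B)]

local notation "𝒮" => superFun B F E G V

lemma ofFn_zero : ofFn F E G V (0 : Fn B M) = 0 := superFun_ext fun _ => map_zero _

lemma IsHomogeneous.eq_zero_of_one {s : 𝒮} (hs : IsHomogeneous 1 s)
    (h : ∀ ψ : Sec B F E, Q2.contractE ψ s = 0) : s = 0 :=
  eq_zero_of_contract_superFun one_ne_zero hs h hs.contractV_eq_zero_of_one

namespace Components

variable {Q : Module.End ℝ (superFun B F E G V)}
  {ρ : BundleMap B F E B (TangentSpace 𝓘(ℝ, B) : M → Type _)}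
  {br : Sec B F E → Sec B F E → Sec B F E} {t : BundleMap B G V F E}
  {nab : Sec B F E → Sec B G V → Sec B G V}

lemma degree_one (h : Components Q ρ br t nab) {k : ℕ} {s : 𝒮} (hs : IsHomogeneous k s) :
    IsHomogeneous (k + 1) (Q s) :=
  h.isOddDer.degree_one h.degree_fn h.degree_dualE h.degree_dualV hs

lemma isHomogeneous_lieE (h : Components Q ρ br t nab) (ψ : Sec B F E) {k : ℕ} {s : 𝒮}
    (hs : IsHomogeneous (k + 1) s) : IsHomogeneous (k + 1) (lieE Q ψ s) :=
  (h.degree_one (hs.contractE ψ)).add ((h.degree_one hs).contractE ψ)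

/-- The curvature `[L_ψ, L_φ] - L_{[ψ, φ]}` vanishes. -/
lemma lieE_commutator_of_jacobi (h : Components Q ρ br t nab)
    (hanchor : ∀ ψ φ f, lieDeriv (ρ.onSec (br ψ φ)) f =
      lieDeriv (ρ.onSec ψ) (lieDeriv (ρ.onSec φ) f) -
        lieDeriv (ρ.onSec φ) (lieDeriv (ρ.onSec ψ) f))
    (hjac : ∀ ψ₁ ψ₂ ψ₃, br ψ₁ (br ψ₂ ψ₃) = br (br ψ₁ ψ₂) ψ₃ + br ψ₂ (br ψ₁ ψ₃))
    (hflat : ∀ ψ₁ ψ₂ v, nab ψ₁ (nab ψ₂ v) = nab (br ψ₁ ψ₂) v + nab ψ₂ (nab ψ₁ v))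
    (ψ φ : Sec B F E) : lieE Q ψ * lieE Q φ - lieE Q φ * lieE Q ψ = lieE Q (br ψ φ) := by
  rw [← sub_eq_zero]
  set R := lieE Q ψ * lieE Q φ - lieE Q φ * lieE Q ψ - lieE Q (br ψ φ) with hR
  have hf (f : Fn B M) : R (ofFn F E G V f) = 0 := by
    change lieE Q ψ (lieE Q φ (ofFn F E G V f)) - lieE Q φ (lieE Q ψ (ofFn F E G V f)) -
      lieE Q (br ψ φ) (ofFn F E G V f) = 0
    rw [h.lieE_ofFn, h.lieE_ofFn, h.lieE_ofFn, h.lieE_ofFn, h.lieE_ofFn, hanchor, ofFn_sub,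
      sub_self]
  have hdeg {k : ℕ} {s : 𝒮} (hs : IsHomogeneous (k + 1) s) : IsHomogeneous (k + 1) (R s) :=
    ((h.isHomogeneous_lieE ψ (h.isHomogeneous_lieE φ hs)).sub
      (h.isHomogeneous_lieE φ (h.isHomogeneous_lieE ψ hs))).sub (h.isHomogeneous_lieE _ hs)
  -- By the Jacobi identity of the bracket, and below by flatness, `R` commutes with all
  -- contractions. On `α` and `β` these lead down to functions, where `R` vanishes by the anchor
  -- property.
  have hE (χ : Sec B F E) : R * contractE χ = contractE χ * R := by
    have h1 := jacobi_commutator (h.lieE_contractE ψ χ) (h.lieE_contractE φ χ)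
      (h.lieE_contractE ψ _) (h.lieE_contractE φ _)
    rw [hjac, contractE_add, add_sub_cancel_right, ← h.lieE_contractE] at h1
    rw [← sub_eq_zero, hR, sub_mul _ (lieE Q (br ψ φ)), mul_sub _ _ (lieE Q (br ψ φ)),
      sub_sub_sub_comm, h1, sub_self]
  have hV (v : Sec B G V) : R * contractV v = contractV v * R := by
    have h1 := jacobi_commutator (h.lieE_contractV ψ v) (h.lieE_contractV φ v)
      (h.lieE_contractV ψ _) (h.lieE_contractV φ _)
    rw [hflat, contractV_add, add_sub_cancel_right, ← h.lieE_contractV] at h1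
    rw [← sub_eq_zero, hR, sub_mul _ (lieE Q (br ψ φ)), mul_sub _ _ (lieE Q (br ψ φ)),
      sub_sub_sub_comm, h1, sub_self]
  refine (((h.isOddDer.lieE ψ).commutator (h.isOddDer.lieE φ)).sub
    (h.isOddDer.lieE (br ψ φ))).eq_zero hf (fun α => ?_) fun β => ?_
  · refine (hdeg (k := 0) (isHomogeneous_ofDualE α)).eq_zero_of_one fun χ => ?_
    refine (LinearMap.congr_fun (hE χ) _).symm.trans ?_
    rw [Module.End.mul_apply, contractE_ofDualE, hf]
  · refine eq_zero_of_contract_superFun two_ne_zero (hdeg (k := 1) (isHomogeneous_ofDualV β))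
      (fun χ => ?_) fun v => ?_
    · refine (LinearMap.congr_fun (hE χ) _).symm.trans ?_
      rw [Module.End.mul_apply, contractE_ofDualV, map_zero]
    · refine (LinearMap.congr_fun (hV v) _).symm.trans ?_
      rw [Module.End.mul_apply, contractV_ofDualV, hf]

/-- The identities of a crossed module imply `Q² = 0`. -/
lemma square_zero (h : Components Q ρ br t nab)
    (hanchor : ∀ ψ φ f, lieDeriv (ρ.onSec (br ψ φ)) f =
      lieDeriv (ρ.onSec ψ) (lieDeriv (ρ.onSec φ) f) -
        lieDeriv (ρ.onSec φ) (lieDeriv (ρ.onSec ψ) f))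
    (hjac : ∀ ψ₁ ψ₂ ψ₃, br ψ₁ (br ψ₂ ψ₃) = br (br ψ₁ ψ₂) ψ₃ + br ψ₂ (br ψ₁ ψ₃))
    (hflat : ∀ ψ₁ ψ₂ v, nab ψ₁ (nab ψ₂ v) = nab (br ψ₁ ψ₂) v + nab ψ₂ (nab ψ₁ v))
    (hρt : ∀ v f, lieDeriv (ρ.onSec (t.onSec v)) f = 0)
    (ht : ∀ ψ v, t.onSec (nab ψ v) = br ψ (t.onSec v))
    (hanti : ∀ v w, nab (t.onSec v) w = -nab (t.onSec w) v) : Q * Q = 0 := by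
  -- By `hZ`, `Z ψ = [L_ψ, Q]` is the commutator `[i_ψ, Q²]`. The vanishing of `Z ψ` on a generator
  -- controls the odd contractions of `Q²` on it, so both are treated together, in the order `f`,
  -- `α`, `β`.
  let Z (ψ : Sec B F E) : Module.End ℝ 𝒮 := lieE Q ψ * Q - Q * lieE Q ψ
  have hZ (ψ : Sec B F E) : contractE ψ * (Q * Q) = Z ψ + Q * Q * contractE ψ := by
    simp only [Z, lieE]
    noncomm_ring
  have hZdeg (ψ : Sec B F E) {k : ℕ} {s : 𝒮} (hs : IsHomogeneous k s) :
      IsHomogeneous (k + 1) (Z ψ s) := by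
    have h1 : Z ψ s = contractE ψ (Q (Q s)) - Q (Q (contractE ψ s)) :=
      eq_sub_of_add_eq (LinearMap.congr_fun (hZ ψ) s).symm
    rw [h1]
    refine ((h.degree_one (h.degree_one hs)).contractE ψ).sub ?_
    cases k with
    | zero =>
      rw [hs.contractE_eq_zero, map_zero, map_zero]
      exact fun x => zero_mem _
    | succ k => exact h.degree_one (h.degree_one (hs.contractE ψ))
  have hZE (ψ φ : Sec B F E) : contractE φ * Z ψ = -(Z ψ * contractE φ) := by
    have h1 := h.lieE_commutator_of_jacobi hanchor hjac hflat ψ φ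
    have h2 : lieE Q (br ψ φ) = Q * contractE (br ψ φ) + contractE (br ψ φ) * Q := rfl
    rw [h2, ← h.lieE_contractE, ← sub_eq_zero] at h1
    rw [eq_neg_iff_add_eq_zero, ← h1]
    exact anticommutator_curvature Q (lieE Q ψ) (contractE φ)
  have hZV (ψ : Sec B F E) (v : Sec B G V) : contractV v * Z ψ =
      Z ψ * contractV v - lieE Q ψ * lieV Q v + lieV Q v * lieE Q ψ + lieV Q (nab ψ v) := by
    have h2 : lieV Q (nab ψ v) = Q * contractV (nab ψ v) - contractV (nab ψ v) * Q := rfl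
    rw [h2, ← h.lieE_contractV]
    exact commutator_curvature Q (lieE Q ψ) (contractV v)
  have hZf (ψ : Sec B F E) (f : Fn B M) : Z ψ (ofFn F E G V f) = 0 := by
    refine (hZdeg ψ (isHomogeneous_ofFn f)).eq_zero_of_one fun φ => ?_
    refine (LinearMap.congr_fun (hZE ψ φ) _).trans ?_
    rw [LinearMap.neg_apply, Module.End.mul_apply, contractE_ofFn, map_zero, neg_zero]
  have hf (f : Fn B M) : Q (Q (ofFn F E G V f)) = 0 := by
    refine eq_zero_of_contract_superFun two_ne_zero (h.degree_one (h.degree_fn f)) (fun ψ => ?_)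
      fun v => ?_
    · refine (LinearMap.congr_fun (hZ ψ) _).trans ?_
      rw [LinearMap.add_apply, hZf, Module.End.mul_apply, contractE_ofFn, map_zero, add_zero]
    · obtain ⟨α, hα⟩ := (h.degree_fn f).exists_ofDualE
      rw [← hα, h.t, ← contractE_ofDualE, hα, h.anchor, hρt, ofFn_zero]
  have hZα (ψ : Sec B F E) (α : DualSec B F E) : Z ψ (ofDualE G V α) = 0 := by
    refine eq_zero_of_contract_superFun two_ne_zero (hZdeg ψ (isHomogeneous_ofDualE α))
      (fun φ => ?_) fun v => ?_
    · refine (LinearMap.congr_fun (hZE ψ φ) _).trans ?_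
      rw [LinearMap.neg_apply, Module.End.mul_apply, contractE_ofDualE, hZf, neg_zero]
    -- What remains is `L_{∇_ψ v} α - [L_ψ, L_v] α`. As `L_v = -i_{t v}` in degree one, this
    -- vanishes by `t(∇_ψ v) = [ψ, t v]`.
    · refine (LinearMap.congr_fun (hZV ψ v) _).trans ?_
      change Z ψ (contractV v (ofDualE G V α)) - lieE Q ψ (lieV Q v (ofDualE G V α)) +
        lieV Q v (lieE Q ψ (ofDualE G V α)) + lieV Q (nab ψ v) (ofDualE G V α) = 0
      have h1 := LinearMap.congr_fun (h.lieE_contractE ψ (t.onSec v)) (ofDualE G V α)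
      change lieE Q ψ (contractE (t.onSec v) (ofDualE G V α)) -
        contractE (t.onSec v) (lieE Q ψ (ofDualE G V α)) =
          contractE (br ψ (t.onSec v)) (ofDualE G V α) at h1
      rw [contractV_ofDualE, map_zero, h.lieV_ofDualE (nab ψ v), ht,
        ← contractE_ofDualE (br ψ (t.onSec v)), ← h1,
        eq_neg_of_add_eq_zero_left (h.lieV_add_contractE_eq_zero v (isHomogeneous_ofDualE α)),
        eq_neg_of_add_eq_zero_left
          (h.lieV_add_contractE_eq_zero v (h.isHomogeneous_lieE_ofDualE ψ α)), map_neg]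
      abel
  have hα (α : DualSec B F E) : Q (Q (ofDualE G V α)) = 0 := by
    have h1 (ψ : Sec B F E) : contractE ψ (Q (Q (ofDualE G V α))) = 0 := by
      refine (LinearMap.congr_fun (hZ ψ) _).trans ?_
      rw [LinearMap.add_apply, hZα, Module.End.mul_apply, contractE_ofDualE, zero_add]
      exact hf _
    have h2 : IsHomogeneous 3 (Q (Q (ofDualE G V α))) := h.degree_one (h.degree_dualE α)
    refine eq_zero_of_contract_superFun three_ne_zero h2 h1 fun v =>
      (h2.contractV v).eq_zero_of_one fun ψ => ?_
    rw [← contractV_contractE, h1, map_zero]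
  have hZβ (ψ : Sec B F E) (β : DualSec B G V) : Z ψ (ofDualV F E β) = 0 := by
    have h1 (φ : Sec B F E) : contractE φ (Z ψ (ofDualV F E β)) = 0 := by
      refine (LinearMap.congr_fun (hZE ψ φ) _).trans ?_
      rw [LinearMap.neg_apply, Module.End.mul_apply, contractE_ofDualV, map_zero, neg_zero]
    have h2 : IsHomogeneous 3 (Z ψ (ofDualV F E β)) := hZdeg ψ (isHomogeneous_ofDualV β)
    refine eq_zero_of_contract_superFun three_ne_zero h2 h1 fun v =>
      (h2.contractV v).eq_zero_of_one fun ψ => ?_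
    rw [← contractV_contractE, h1, map_zero]
  refine (h.isOddDer.square superParity_superParity).eq_zero hf hα fun β => ?_
  change Q (Q (ofDualV F E β)) = 0
  have h1 (ψ : Sec B F E) : contractE ψ (Q (Q (ofDualV F E β))) = 0 := by
    refine (LinearMap.congr_fun (hZ ψ) _).trans ?_
    rw [LinearMap.add_apply, hZβ, Module.End.mul_apply, contractE_ofDualV, map_zero, add_zero]
  have h2 : IsHomogeneous 4 (Q (Q (ofDualV F E β))) := h.degree_one (h.degree_dualV β)
  refine eq_zero_of_contract_superFun four_ne_zero h2 h1 fun v => ?_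
  refine eq_zero_of_contract_superFun two_ne_zero (h2.contractV v) (fun ψ => ?_) fun w => ?_
  · rw [← contractV_contractE, h1, map_zero]
  -- Only the `S²(V*)` part of `Q² β` is left. Its contraction with `v` and `w` is `(L_v L_w + L_w
  -- L_v) β`, that is, minus the pairing of `β` with `∇_{t v} w + ∇_{t w} v`.
  · have h3 (v : Sec B G V) (s : 𝒮) : contractV v (Q s) = Q (contractV v s) - lieV Q v s := by
      rw [lieV_apply, sub_sub_cancel]
    have h4 (v : Sec B G V) (f : Fn B M) : lieV Q v (Q (ofFn F E G V f)) = 0 := by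
      rw [lieV_apply, (h.degree_fn f).contractV_eq_zero_of_one, map_zero, hf, map_zero, sub_self]
    have h5 (v w : Sec B G V) : lieV Q v (lieV Q w (ofDualV F E β)) =
        -ofFn F E G V (β.pair (nab (t.onSec v) w)) := by
      rw [← h.contractE_lieV_ofDualV]
      exact eq_neg_of_add_eq_zero_left
        (h.lieV_add_contractE_eq_zero v (h.isHomogeneous_lieV_ofDualV w β))
    have h6 : contractV w (lieV Q v (Q (ofDualV F E β))) =
        lieV Q v (contractV w (Q (ofDualV F E β))) := LinearMap.congr_fun (h.contractV_lieV v w) _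
    have h7 : contractV w (lieV Q v (ofDualV F E β)) = 0 :=
      (h.isHomogeneous_lieV_ofDualV v β).contractV_eq_zero_of_one w
    rw [h3 v (Q _), h3 v, contractV_ofDualV, map_sub, map_sub Q, hf, zero_sub, map_neg, h3 w,
      h6, h3 w, contractV_ofDualV, map_sub, h7, map_zero, h4, h5, h5, hanti w v,
      DualSec.pair_neg]
    have h8 (f : Fn B M) : ofFn F E G V (-f) = -ofFn F E G V f :=
      superFun_ext fun _ => map_neg _ _
    rw [h8]
    abel

end Components

end SquareZero

/-! ### Uniqueness and the bijection -/

section Correspondence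

variable {B : Type*} [NormedAddCommGroup B] [NormedSpace ℝ B] [FiniteDimensional ℝ B]
  {M : Type*} [TopologicalSpace M] [T2Space M] [ChartedSpace B M] [IsManifold 𝓘(ℝ, B) ∞ M]
  {F : Type*} [NormedAddCommGroup F] [NormedSpace ℝ F] [FiniteDimensional ℝ F]
  {E : M → Type*} [TopologicalSpace (TotalSpace F E)] [∀ x, TopologicalSpace (E x)]
  [∀ x, AddCommGroup (E x)] [∀ x, Module ℝ (E x)] [FiberBundle F E] [VectorBundle ℝ F E]
  [ContMDiffVectorBundle ∞ F E 𝓘(ℝ, B)]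
  {G : Type*} [NormedAddCommGroup G] [NormedSpace ℝ G] [FiniteDimensional ℝ G]
  {V : M → Type*} [TopologicalSpace (TotalSpace G V)] [∀ x, TopologicalSpace (V x)]
  [∀ x, AddCommGroup (V x)] [∀ x, Module ℝ (V x)] [FiberBundle G V] [VectorBundle ℝ G V]
  [ContMDiffVectorBundle ∞ G V 𝓘(ℝ, B)]

lemma CrossedModule.square_zero (X : CrossedModule B F E G V)
    {Q : Module.End ℝ (superFun B F E G V)}
    (h : Components Q X.algE.anchor (fun ψ φ => X.algE.bracket ψ φ) X.t
      (fun ψ v => X.rep.conn ψ v)) : Q * Q = 0 := by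
  refine h.square_zero (fun ψ φ f => ?_) X.algE.jacobi (fun ψ φ v => ?_) (fun v f => ?_) X.t_conn
    fun v w => ?_
  · ext x
    rw [X.anchor_hom.map_bracket]
    exact dirDeriv_mlieBracket (X.algE.anchor.onSec ψ) (X.algE.anchor.onSec φ) f x
  · exact eq_add_of_sub_eq (sub_eq_zero.1 ((sub_right_comm _ _ _).symm.trans (X.rep.flat ψ φ v))) |>.trans
      (add_comm _ _)
  · ext x
    refine (congrArg (dirDeriv f x) (X.complex x (v x))).trans (dirDeriv_vzero f x)
  · rw [X.conn_t, X.conn_t, X.algV.bracket_antisymm]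

/-- A crossed module determines a Q-structure without anomaly. -/
lemma CrossedModule.exists_corresponds (X : CrossedModule B F E G V) :
    ∃ q : QStructure B F E G V, q.AnomalyFree ∧ Corresponds q X := by
  obtain ⟨Q, h⟩ := X.exists_components
  let q : QStructure B F E G V :=
    { Q := Q
      degree_one := fun k s hs => h.degree_one hs
      graded_leibniz := fun k s s' hs => by
        rw [h.isOddDer.leibniz, hs.superParity, smul_mul_assoc]
      square_zero := fun s => LinearMap.congr_fun (X.square_zero h) s }
  have hq : q.AnomalyFree := q.anomalyFree_iff.2 h.anomaly
  exact ⟨q, hq, (corresponds_iff q hq X).2 h⟩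

/-- The fields of `Components` list all contractions to degree zero of the values on generators,
which determine an odd derivation of degree one. -/
lemma Components.unique {Q Q' : Module.End ℝ (superFun B F E G V)}
    {ρ : BundleMap B F E B (TangentSpace 𝓘(ℝ, B) : M → Type _)}
    {br : Sec B F E → Sec B F E → Sec B F E} {t : BundleMap B G V F E}
    {nab : Sec B F E → Sec B G V → Sec B G V} (h : Components Q ρ br t nab)
    (h' : Components Q' ρ br t nab) : Q = Q' := by
  rw [← sub_eq_zero]
  refine (h.isOddDer.sub h'.isOddDer).eq_zero (fun f => ?_) (fun α => ?_) fun β => ?_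
  · refine ((h.degree_fn f).sub (h'.degree_fn f)).eq_zero_of_one fun ψ => ?_
    rw [map_sub, h.anchor, h'.anchor, sub_self]
  · have h2 := (h.degree_dualE α).sub (h'.degree_dualE α)
    refine eq_zero_of_contract_superFun two_ne_zero h2 (fun ψ =>
      (h2.contractE ψ).eq_zero_of_one fun φ => ?_) fun v => ?_
    · rw [map_sub, map_sub, h.bracket, h'.bracket, sub_self]
    · rw [LinearMap.sub_apply, map_sub, h.t, h'.t, sub_self]
  · have h3 := (h.degree_dualV β).sub (h'.degree_dualV β)
    refine eq_zero_of_contract_superFun three_ne_zero h3 (fun ψ =>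
      eq_zero_of_contract_superFun two_ne_zero (h3.contractE ψ) (fun φ => ?_) fun v => ?_)
      fun v => (h3.contractV v).eq_zero_of_one fun ψ => ?_
    · rw [LinearMap.sub_apply, map_sub, map_sub, h.anomaly, h'.anomaly, sub_self]
    · rw [LinearMap.sub_apply, map_sub, map_sub, h.conn, h'.conn, sub_self]
    · rw [← contractV_contractE, map_sub, map_sub, h.conn, h'.conn, sub_self]

/-- The algebroid `V` carries no further data: its anchor is `ρ ∘ t = 0` and its bracket is `∇_{t v}
w`. -/
lemma CrossedModule.ext_components {X X' : CrossedModule B F E G V}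
    (hρ : X.algE.anchor = X'.algE.anchor) (hbr : X.algE.bracket = X'.algE.bracket)
    (ht : X.t = X'.t) (hconn : X.rep.conn = X'.rep.conn) : X = X' := by
  have hV : X.algV = X'.algV := by
    have h1 : X.algV.anchor = X'.algV.anchor := BundleMap.ext fun x => LinearMap.ext fun v => by
      rw [← X.t_hom.anchor_comp, ← X'.t_hom.anchor_comp, X.complex, X'.complex]
    have h2 : X.algV.bracket = X'.algV.bracket := LinearMap.ext₂ fun v w => by
      rw [← X.conn_t, ← X'.conn_t, ht, hconn]
    cases hA : X.algV
    cases hA' : X'.algV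
    simp only [hA, hA'] at h1 h2
    subst h1 h2
    rfl
  obtain ⟨⟨a, br, _, _, _⟩, A, t, _, _, _, ⟨c, _, _, _⟩, _, _⟩ := X
  obtain ⟨⟨a', br', _, _, _⟩, A', t', _, _, _, ⟨c', _, _, _⟩, _, _⟩ := X'
  simp only at hρ hbr ht hconn hV
  subst hρ hbr ht hconn hV
  rfl

lemma Components.crossedModule_unique {Q : Module.End ℝ (superFun B F E G V)}
    {X X' : CrossedModule B F E G V}
    (h : Components Q X.algE.anchor (fun ψ φ => X.algE.bracket ψ φ) X.t
      (fun ψ v => X.rep.conn ψ v))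
    (h' : Components Q X'.algE.anchor (fun ψ φ => X'.algE.bracket ψ φ) X'.t
      (fun ψ v => X'.rep.conn ψ v)) : X = X' := by
  have hρ : X.algE.anchor = X'.algE.anchor := BundleMap.ext_onSec fun ψ =>
    Sec.ext_lieDeriv fun f => ofFn_injective (F := F) (E := E) (G := G) (V := V)
      ((h.anchor f ψ).symm.trans (h'.anchor f ψ))
  refine CrossedModule.ext_components hρ (LinearMap.ext₂ fun ψ φ => Sec.ext_pair fun α => ?_)
    (BundleMap.ext_onSec fun v => Sec.ext_pair fun α =>
      ofFn_injective (F := F) (E := E) (G := G) (V := V) ((h.t α v).symm.trans (h'.t α v)))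
    (LinearMap.ext₂ fun ψ v => Sec.ext_pair fun β => ?_)
  · exact (h.pair_bracket α ψ φ).trans (hρ ▸ (h'.pair_bracket α ψ φ).symm)
  · exact (h.pair_conn β ψ v).trans (hρ ▸ (h'.pair_conn β ψ v).symm)

end Correspondence

end Q2

end

open Q2 in
theorem mainTheorem8
    {B : Type*} [NormedAddCommGroup B] [NormedSpace ℝ B] [FiniteDimensional ℝ B]
    {M : Type*} [TopologicalSpace M] [T2Space M] [SecondCountableTopology M]
    [ChartedSpace B M] [IsManifold 𝓘(ℝ, B) ∞ M]
    {F : Type*} [NormedAddCommGroup F] [NormedSpace ℝ F] [FiniteDimensional ℝ F]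
    {E : M → Type*} [TopologicalSpace (TotalSpace F E)] [∀ x, TopologicalSpace (E x)]
    [∀ x, AddCommGroup (E x)] [∀ x, Module ℝ (E x)] [FiberBundle F E] [VectorBundle ℝ F E]
    [ContMDiffVectorBundle ∞ F E 𝓘(ℝ, B)]
    {G : Type*} [NormedAddCommGroup G] [NormedSpace ℝ G] [FiniteDimensional ℝ G]
    {V : M → Type*} [TopologicalSpace (TotalSpace G V)] [∀ x, TopologicalSpace (V x)]
    [∀ x, AddCommGroup (V x)] [∀ x, Module ℝ (V x)] [FiberBundle G V] [VectorBundle ℝ G V]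
    [ContMDiffVectorBundle ∞ G V 𝓘(ℝ, B)] :
    ∃ Φ : {q : QStructure B F E G V // q.AnomalyFree} ≃ CrossedModule B F E G V,
      ∀ q X, Φ q = X ↔ Corresponds q.1 X := by
  -- The relation `Corresponds` is total and single-valued in both directions, which makes it the
  -- graph of a bijection.
  choose Φ hΦ using fun q : {q : QStructure B F E G V // q.AnomalyFree} =>
    exists_corresponds_crossedModule q.1 q.2
  choose Ψ hΨ hΨX using fun X : CrossedModule B F E G V => X.exists_corresponds
  have huniq (q : {q : QStructure B F E G V // q.AnomalyFree}) (X : CrossedModule B F E G V)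
      (h : Corresponds q.1 X) : Φ q = X :=
    ((corresponds_iff q.1 q.2 _).1 (hΦ q)).crossedModule_unique ((corresponds_iff q.1 q.2 X).1 h)
  refine ⟨⟨Φ, fun X => ⟨Ψ X, hΨ X⟩, fun q => Subtype.ext ?_, fun X => huniq ⟨Ψ X, hΨ X⟩ X (hΨX X)⟩,
    fun q X => ⟨fun h => h ▸ hΦ q, huniq q X⟩⟩
  have h : (Ψ (Φ q)).Q = q.1.Q := ((corresponds_iff _ (hΨ _) _).1 (hΨX (Φ q))).unique
    ((corresponds_iff q.1 q.2 _).1 (hΦ q))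
  change Ψ (Φ q) = q.1
  -- The operator is the only data of a Q-structure; the other fields are proofs.
  generalize Ψ (Φ q) = q₁ at h
  generalize q.1 = q₂ at h
  cases q₁
  cases q₂
  cases h
  rfl
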